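/- **Setting.** Let $k$ be an algebraically closed field of characteristic $0$, let $\mathcal C$ be a fusion category over $k$ (associativity $\alpha$, unit constraints $\ell,r$), and let $(G,\Gamma,\blacktriangleright,\blacktriangleleft)$ be a matched pair of finite groups: a left action $\blacktriangleright$ of $\Gamma$ on the set $G$ and a right action $\blacktriangleleft$ of $G$ on the set $\Gamma$ with $st\blacktriangleleft g=(s\blacktriangleleft(t\blacktriangleright g))(t\blacktriangleleft g)$ and $s\blacktriangleright gh=(s\blacktriangleright g)((s\blacktriangleleft g)\blacktriangleright h)$. Let a $(G,\Gamma)$-crossed action on $\mathcal C$ be given, that is: * a faithful grading $\mathcal C=\bigoplus_{s\in\Gamma}\mathcal C_s$ (write $|X|=s$ for $X\in\mathcal C_s$); * a right action of $G$ by $k$-linear autoequivalences $-\triangleleft g$, with isomorphisms $\mathbf R^2_{g,h}\colon(-\triangleleft g)\triangleleft h\to-\triangleleft gh$ and $\mathbf R^0\colon\mathrm{Id}\to-\triangleleft 1$ satisfying the usual associativity and unit axioms, such that $\mathcal C_s\triangleleft g=\mathcal C_{s\blacktriangleleft g}$; * isomorphisms $\eta^g_{X,Y}\colon(X\otimes Y)\triangleleft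 g\to X\triangleleft(t\blacktriangleright g)\otimes Y\triangleleft g$ for $X\in\mathcal C$, $Y\in\mathcal C_t$, natural in $X$ and $Y$, and isomorphisms $\eta^g_0\colon\mathbf 1\triangleleft g\to\mathbf 1$, such that (suppressing $\alpha$, $\ell$, $r$), for $Y\in\mathcal C_s$ and $Z\in\mathcal C_t$, - $(\eta^{t\blacktriangleright g}_{X,Y}\otimes\mathrm{id})\,\eta^g_{X\otimes Y,Z}=(\mathrm{id}\otimes\eta^g_{Y,Z})\,\eta^g_{X,Y\otimes Z}$; - $(\mathrm{id}\otimes\eta_0^g)\,\eta^g_{X,\mathbf 1}=\mathrm{id}$ and $(\eta_0^{t\blacktriangleright g}\otimes\mathrm{id})\,\eta^g_{\mathbf 1,Z}=\mathrm{id}$; - $\eta^{gh}_{X,Z}\,\mathbf R^2_{g,h}=\bigl(\mathbf R^2_{t\blacktriangleright g,(t\blacktriangleleft g)\blacktriangleright h}\otimes\mathbf R^2_{g,h}\bigr)\,\eta^h_{X\triangleleft(t\blacktriangleright g),\,Z\triangleleft g}\,(\eta^g_{X,Z}\triangleleft h)$ and $\eta_0^{gh}\,\mathbf R^2_{g,h}=\eta_0^h\,(\eta_0^g\triangleleft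 h)$; - $\eta^1_{X,Z}\,\mathbf R^0_{X\otimes Z}=\mathbf R^0_X\otimes\mathbf R^0_Z$ and $\eta^1_0\,\mathbf R^0_{\mathbf 1}=\mathrm{id}$. In the formulas below, constructions written for homogeneous objects are extended additively to all objects. **The bicrossed product.** $\mathcal B=\operatorname{vec}_G\bowtie\mathcal C$ is the category $\operatorname{vec}_G\boxtimes\mathcal C$, with objects the direct sums of symbols $g\bowtie X$ ($g\in G$, $X\in\mathcal C$ homogeneous), and with tensor product $(g\bowtie X)\otimes(h\bowtie Y)=g(|X|\blacktriangleright h)\bowtie(X\triangleleft h\otimes Y)$ and unit $1\bowtie\mathbf 1$. The associativity $\bigl((g\bowtie X)\otimes(h\bowtie Y)\bigr)\otimes(g'\bowtie Z)\to(g\bowtie X)\otimes\bigl((h\bowtie Y)\otimes(g'\bowtie Z)\bigr)$ is given by $$\alpha\circ(\mathbf R^2_{h,|Y|\blacktriangleright g'}\otimes\mathrm{id}\otimes\mathrm{id})\circ(\eta^{g'}_{X\triangleleft h,Y}\otimes\mathrm{id}),$$ and the left and right unit constraints of $g\bowtie X$ are given by $\ell_X(\eta_0^g\otimes\mathrm{id}_X)$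 and $r_X((\mathbf R^0_X)^{-1}\otimes\mathrm{id}_{\mathbf 1})$. The category $\mathcal C$ is a right $\mathcal B$-module category by $M\,\overline\otimes\,(g\bowtie C)=M\triangleleft g\otimes C$, with associativity constraint $M\,\overline\otimes\,\bigl((g\bowtie C)\otimes(g'\bowtie C')\bigr)\to\bigl(M\,\overline\otimes\,(g\bowtie C)\bigr)\,\overline\otimes\,(g'\bowtie C')$ equal to $$((\eta^{g'}_{M\triangleleft g,C})^{-1}\otimes\mathrm{id}_{C'})\,((\mathbf R^2_{g,|C|\blacktriangleright g'})_M^{-1}\otimes\mathrm{id}_{C\triangleleft g'}\otimes\mathrm{id}_{C'})\,\alpha^{-1}$$ and unit constraint $r_M((\mathbf R^0_M)^{-1}\otimes\mathrm{id}_{\mathbf 1})$. **The two categories.** $\mathcal B^*_{\mathcal C}=\operatorname{End}_{\mathcal B}(\mathcal C)$ is the category of $k$-linear right $\mathcal B$-module endofunctors $(\mathbf F,s)$ of $\mathcal C$, $s_{M,x}\colon\mathbf F(M\,\overline\otimes\,x)\to\mathbf F(M)\,\overline\otimes\,x$, with composition of functors as tensor product. The crossed extension $\mathcal C^{(G,\Gamma)}$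 has as objects the pairs $(U,u)$ with $U\in\mathcal C$ and isomorphisms $u_g\colon U\triangleleft g\to U$ ($g\in G$) such that $u_{gh}\mathbf R^2_{g,h}=u_h(u_g\triangleleft h)$, as morphisms $(U,u)\to(V,v)$ the $f\colon U\to V$ with $v_g(f\triangleleft g)=f\,u_g$, tensor product $(U,u)\otimes(V,v)=(U\otimes V,w)$ with $w_g=(u_{t\blacktriangleright g}\otimes v_g)\,\eta^g_{U,V_t}$ on $U\otimes V_t$ for $V=\bigoplus_tV_t$, $V_t\in\mathcal C_t$, unit $(\mathbf 1,\eta_0)$, and the associativity and unit constraints of $\mathcal C$. **Theorem.** The assignments * $\mathbf T(\mathbf F,s)=(\mathbf F(\mathbf 1),u)$ with $u_g=\mathbf F(r_{\mathbf 1})\,\mathbf F(\eta^g_0\otimes\mathrm{id}_{\mathbf 1})\,s^{-1}_{\mathbf 1,g\bowtie\mathbf 1}\,r^{-1}_{\mathbf F(\mathbf 1)\triangleleft g}$, and $\mathbf T(\varepsilon)=\varepsilon_{\mathbf 1}$, * $\mathbf S(U,u)=(U\otimes-,s)$ with $s_{M,g\bowtie C}=((\eta^g_{U,M})^{-1}\otimes\mathrm{id}_C)\,(u^{-1}_{|M|\blacktriangleright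 g}\otimes\mathrm{id}_{M\triangleleft g}\otimes\mathrm{id}_C)\,\alpha^{-1}_{U,M\triangleleft g,C}$ for homogeneous $M$, and $\mathbf S(f)=f\otimes\mathrm{id}$, are well-defined $k$-linear functors $\mathbf T\colon\operatorname{End}_{\mathcal B}(\mathcal C)\to\mathcal C^{(G,\Gamma)}$ and $\mathbf S\colon\mathcal C^{(G,\Gamma)}\to\operatorname{End}_{\mathcal B}(\mathcal C)$, and they are mutually quasi-inverse equivalences of categories. Moreover $\mathbf S$ is a (strong) monoidal functor with tensor structure $\mathbf S(U,u)\circ\mathbf S(V,v)\to\mathbf S((U,u)\otimes(V,v))$ given at $M\in\mathcal C$ by $\alpha^{-1}_{U,V,M}\colon U\otimes(V\otimes M)\to(U\otimes V)\otimes M$, and $\mathbf T$ also admits a (strong) monoidal structure. In particular $\mathcal B^*_{\mathcal C}=\operatorname{End}_{\mathcal B}(\mathcal C)\simeq\mathcal C^{(G,\Gamma)}$ as tensor categories. -/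

import Mathlib

set_option linter.unusedSectionVars false
set_option linter.unusedSimpArgs false

open CategoryTheory CategoryTheory.Limits CategoryTheory.MonoidalCategory

noncomputable section

attribute [local instance] Abelian.hasFiniteBiproducts

/-- A matched pair of groups `(G, Γ, ▶, ◀)`: a left action `s ▶ g = lact s g` of `Γ` on the set `G`
and a right action `s ◀ g = ract s g` of `G` on the set `Γ`, with the two compatibilities. -/
structure MatchedPair (G Γ : Type*) [Group G] [Group Γ] where
  lact : Γ → G → G
  ract : Γ → G → Γ
  one_lact : ∀ g, lact 1 g = g
  mul_lact : ∀ s t g, lact (s * t) g = lact s (lact t g)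
  ract_one : ∀ s, ract s 1 = s
  ract_mul : ∀ s g h, ract s (g * h) = ract (ract s g) h
  mul_ract : ∀ s t g, ract (s * t) g = ract s (lact t g) * ract t g
  lact_mul : ∀ s g h, lact s (g * h) = lact s g * lact (ract s g) h

theorem MatchedPair.lact_one {G Γ : Type*} [Group G] [Group Γ] (mp : MatchedPair G Γ) (s : Γ) :
    mp.lact s 1 = 1 := by
  have h := mp.lact_mul s 1 1
  rw [mp.ract_one, mul_one] at h
  exact (mul_eq_left.mp h.symm)

theorem MatchedPair.one_ract {G Γ : Type*} [Group G] [Group Γ] (mp : MatchedPair G Γ) (g : G) :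
    mp.ract 1 g = 1 := by
  have h := mp.mul_ract 1 1 g
  rw [mp.one_lact, mul_one] at h
  exact (mul_eq_left.mp h.symm)

/-- Together with `[Abelian C] [Linear k C] [MonoidalPreadditive C] [MonoidalLinear k C]
[RigidCategory C]` (the tensor product is bilinear and all duals exist), this says that `C` is a
fusion category over `k`: the unit is simple, the morphism spaces are finite-dimensional, and `C` is
semisimple with finitely many simple objects up to isomorphism. -/
class IsFusionCategory (k C : Type*) [Field k] [Category C] [Abelian C] [Linear k C]
    [MonoidalCategory C] : Prop where
  simple_unit : Simple (𝟙_ C)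
  finiteDimensional_hom : ∀ X Y : C, FiniteDimensional k (X ⟶ Y)
  exists_iso_biproduct_simple : ∀ X : C, ∃ (n : ℕ) (S : Fin n → C),
    (∀ i, Simple (S i)) ∧ Nonempty (X ≅ ⨁ S)
  finite_simple : ∃ (n : ℕ) (S : Fin n → C), ∀ X : C, Simple X → ∃ i, Nonempty (X ≅ S i)

/-- A faithful grading `C = ⨁_{s ∈ Γ} C_s` of a monoidal abelian category by a finite group:
`comp s` is the (replete) full subcategory `C_s`, there are no nonzero morphisms between different
components, every object is a direct sum of homogeneous ones, `C_s ⊗ C_t ⊆ C_{st}`, `C_s ≠ 0`. -/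
structure FaithfulGrading (Γ C : Type*) [Group Γ] [Finite Γ] [Category C] [Abelian C]
    [MonoidalCategory C] where
  comp : Γ → ObjectProperty C
  comp_of_iso : ∀ {s X Y}, (X ≅ Y) → comp s X → comp s Y
  hom_eq_zero : ∀ {s t X Y}, s ≠ t → comp s X → comp t Y → ∀ f : X ⟶ Y, f = 0
  exists_decomp : ∀ X : C, ∃ Y : Γ → C, (∀ s, comp s (Y s)) ∧ Nonempty (X ≅ ⨁ Y)
  comp_tensor : ∀ {s t X Y}, comp s X → comp t Y → comp (s * t) (X ⊗ Y)
  exists_nonzero : ∀ s, ∃ X, comp s X ∧ ¬ IsZero X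

/-- A `k`-linear right action of `G` on `C`: endofunctors `act g = (- ◁ g)` with isomorphisms
`R²_{g,h} = mulIso g h : (- ◁ g) ◁ h ≅ - ◁ gh` and `R⁰ = oneIso : id ≅ - ◁ 1`.
(The functors `act g` are equivalences, hence exact.) The `eqToHom`s identify `X ◁ g` and `X ◁ g'`
for provably equal `g`, `g'`. -/
structure RightGroupAction (k G C : Type*) [Field k] [Group G] [Category C] [Preadditive C]
    [Linear k C] where
  act : G → C ⥤ C
  additive : ∀ g, (act g).Additive
  linear : ∀ g, (act g).Linear k
  mulIso : ∀ g h, act g ⋙ act h ≅ act (g * h)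
  oneIso : 𝟭 C ≅ act 1
  mulIso_assoc : ∀ g h l X,
    (act l).map ((mulIso g h).hom.app X) ≫ (mulIso (g * h) l).hom.app X ≫
        eqToHom (by rw [mul_assoc]) =
      (mulIso h l).hom.app ((act g).obj X) ≫ (mulIso g (h * l)).hom.app X
  oneIso_mulIso : ∀ g X,
    oneIso.hom.app ((act g).obj X) ≫ (mulIso g 1).hom.app X = eqToHom (by simp)
  map_oneIso_mulIso : ∀ g X,
    (act g).map (oneIso.hom.app X) ≫ (mulIso 1 g).hom.app X = eqToHom (by simp)

/-- A `(G, Γ)`-crossed action on `C`, for a matched pair `mp` of groups: a faithful `Γ`-grading, a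
right `G`-action with `C_s ◁ g = C_{s ◀ g}` (the inclusion `⊆` for all `g` gives equality), natural
isomorphisms `η^g_{X,Y} : (X ⊗ Y) ◁ g ≅ X ◁ (t ▶ g) ⊗ Y ◁ g` for `X ∈ C`, `Y ∈ C_t`, and isomorphisms
`η₀^g : 1 ◁ g ≅ 1`, compatible with associativity, units, the composition in `G` and its unit. -/
structure CrossedAction (k C : Type*) {G Γ : Type*} [Field k] [Group G] [Group Γ] [Finite Γ]
    [Category C] [Abelian C] [Linear k C] [MonoidalCategory C] (mp : MatchedPair G Γ) extends
    FaithfulGrading Γ C, RightGroupAction k G C where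
  comp_act : ∀ {s X} (g : G), comp s X → comp (mp.ract s g) ((act g).obj X)
  η : ∀ (g : G) (X : C) {t : Γ} {Y : C}, comp t Y →
    ((act g).obj (X ⊗ Y) ≅ (act (mp.lact t g)).obj X ⊗ (act g).obj Y)
  η₀ : ∀ g : G, (act g).obj (𝟙_ C) ≅ 𝟙_ C
  η_natural : ∀ (g : G) {X X' : C} {t : Γ} {Y Y' : C} (hY : comp t Y) (hY' : comp t Y')
    (f : X ⟶ X') (f' : Y ⟶ Y'),
    (act g).map (f ⊗ₘ f') ≫ (η g X' hY').hom =
      (η g X hY).hom ≫ ((act (mp.lact t g)).map f ⊗ₘ (act g).map f')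
  η_assoc : ∀ (g : G) (X : C) {s t : Γ} {Y Z : C} (hY : comp s Y) (hZ : comp t Z),
    (η g (X ⊗ Y) hZ).hom ≫ (η (mp.lact t g) X hY).hom ▷ (act g).obj Z ≫ (α_ _ _ _).hom =
      (act g).map (α_ X Y Z).hom ≫ (η g X (comp_tensor hY hZ)).hom ≫
        (eqToHom (by rw [mp.mul_lact]) ⊗ₘ (η g Y hZ).hom)
  η_right_unit : ∀ (g : G) (X : C) (h : comp 1 (𝟙_ C)),
    (η g X h).hom ≫ (eqToHom (by rw [mp.one_lact]) ⊗ₘ (η₀ g).hom) ≫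
      (ρ_ ((act g).obj X)).hom = (act g).map (ρ_ X).hom
  η_left_unit : ∀ (g : G) {t : Γ} {Y : C} (hY : comp t Y),
    (η g (𝟙_ C) hY).hom ≫ (η₀ (mp.lact t g)).hom ▷ _ ≫ (λ_ ((act g).obj Y)).hom =
      (act g).map (λ_ Y).hom
  η_mul : ∀ (g h : G) (X : C) {t : Γ} {Y : C} (hY : comp t Y),
    (mulIso g h).hom.app (X ⊗ Y) ≫ (η (g * h) X hY).hom =
      (act h).map (η g X hY).hom ≫ (η h _ (comp_act g hY)).hom ≫
        (((mulIso (mp.lact t g) (mp.lact (mp.ract t g) h)).hom.app X ≫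
          eqToHom (by rw [mp.lact_mul])) ⊗ₘ (mulIso g h).hom.app Y)
  η₀_mul : ∀ g h : G,
    (mulIso g h).hom.app (𝟙_ C) ≫ (η₀ (g * h)).hom = (act h).map (η₀ g).hom ≫ (η₀ h).hom
  η_one : ∀ (X : C) {t : Γ} {Y : C} (hY : comp t Y),
    oneIso.hom.app (X ⊗ Y) ≫ (η 1 X hY).hom =
      ((oneIso.hom.app X ≫ eqToHom (by rw [mp.lact_one])) ⊗ₘ oneIso.hom.app Y)
  η₀_one : oneIso.hom.app (𝟙_ C) ≫ (η₀ 1).hom = 𝟙 (𝟙_ C)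


namespace CrossedAction

variable {k C G Γ : Type*} [Field k] [Group G] [Group Γ] [Finite Γ]
  [Category C] [Abelian C] [Linear k C] [MonoidalCategory C] {mp : MatchedPair G Γ}
  (A : CrossedAction k C mp)

instance (g : G) : (A.act g).Additive := A.additive g

instance (g : G) : (A.act g).Linear k := A.linear g

/-- The transport `X ◁ g ≅ X ◁ h` for `g = h`. -/
def castIso {g h : G} (w : g = h) (X : C) : (A.act g).obj X ≅ (A.act h).obj X :=
  eqToIso (by rw [w])

@[simp] theorem castIso_rfl (g : G) (X : C) : A.castIso (rfl : g = g) X = Iso.refl _ := rfl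

theorem castIso_natural {g h : G} (w : g = h) {X Y : C} (f : X ⟶ Y) :
    (A.act g).map f ≫ (A.castIso w Y).hom = (A.castIso w X).hom ≫ (A.act h).map f := by
  subst w; simp

@[simp] theorem castIso_trans {g h l : G} (w : g = h) (w' : h = l) (X : C) :
    (A.castIso w X).hom ≫ (A.castIso w' X).hom = (A.castIso (w.trans w') X).hom := by
  subst w; simp

@[simp] theorem castIso_trans_assoc {g h l : G} (w : g = h) (w' : h = l) (X : C) {Z : C}
    (a : (A.act l).obj X ⟶ Z) :
    (A.castIso w X).hom ≫ (A.castIso w' X).hom ≫ a = (A.castIso (w.trans w') X).hom ≫ a := by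
  subst w; simp

/-- `R² : (X ◁ g) ◁ h ≅ X ◁ l` for `l = gh`. -/
def R {g h l : G} (w : g * h = l) (X : C) : (A.act h).obj ((A.act g).obj X) ≅ (A.act l).obj X :=
  (A.mulIso g h).app X ≪≫ A.castIso w X

/-- `η^g : (X ⊗ Y) ◁ g ≅ X ◁ l ⊗ Y ◁ g` for `Y` of degree `t` and `l = t ▶ g`. -/
def E {g l : G} {t : Γ} (w : mp.lact t g = l) (X : C) {Y : C} (hY : A.comp t Y) :
    (A.act g).obj (X ⊗ Y) ≅ (A.act l).obj X ⊗ (A.act g).obj Y :=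
  A.η g X hY ≪≫ whiskerRightIso (A.castIso w X) _

@[simp] theorem R_cast {g h l l' : G} (w : g * h = l) (w' : l = l') (X : C) :
    (A.R w X).hom ≫ (A.castIso w' X).hom = (A.R (w.trans w') X).hom := by
  subst w'; simp

theorem R_natural {g h l : G} (w : g * h = l) {X Y : C} (f : X ⟶ Y) :
    (A.act h).map ((A.act g).map f) ≫ (A.R w Y).hom = (A.R w X).hom ≫ (A.act l).map f := by
  subst w; simpa [R] using (A.mulIso g h).hom.naturality f

theorem R_natural_assoc {g h l : G} (w : g * h = l) {X Y : C} (f : X ⟶ Y) {Z : C}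
    (a : (A.act l).obj Y ⟶ Z) :
    (A.act h).map ((A.act g).map f) ≫ (A.R w Y).hom ≫ a =
      (A.R w X).hom ≫ (A.act l).map f ≫ a := by
  simpa only [Category.assoc] using congrArg (· ≫ a) (A.R_natural w f)

theorem R_assoc {g h l a b d : G} (w₁ : g * h = a) (w₂ : a * l = b) (w₃ : h * l = d)
    (w₄ : g * d = b) (X : C) :
    (A.act l).map (A.R w₁ X).hom ≫ (A.R w₂ X).hom =
      (A.R w₃ ((A.act g).obj X)).hom ≫ (A.R w₄ X).hom := by
  subst w₁ w₃ w₂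
  have := A.mulIso_assoc g h l X
  simp only [R, castIso, Iso.trans_hom, Iso.app_hom, eqToIso.hom, eqToHom_refl,
    Category.comp_id] at this ⊢
  rw [← Category.assoc] at this
  have h2 := this =≫ eqToHom (show (A.act (g * (h * l))).obj X = (A.act (g * h * l)).obj X by
    rw [mul_assoc])
  simpa using h2

theorem one_R {g l : G} (w : g * 1 = l) (w' : g = l) (X : C) :
    A.oneIso.hom.app ((A.act g).obj X) ≫ (A.R w X).hom = (A.castIso w' X).hom := by
  subst w'
  have := A.oneIso_mulIso g X
  simp only [R, castIso, Iso.trans_hom, Iso.app_hom, eqToIso.hom]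
  rw [reassoc_of% this]; simp

theorem map_one_R {g l : G} (w : 1 * g = l) (w' : g = l) (X : C) :
    (A.act g).map (A.oneIso.hom.app X) ≫ (A.R w X).hom = (A.castIso w' X).hom := by
  subst w'
  have := A.map_oneIso_mulIso g X
  simp only [R, castIso, Iso.trans_hom, Iso.app_hom, eqToIso.hom]
  rw [reassoc_of% this]; simp

theorem E_cast {g l l' : G} {t : Γ} (w : mp.lact t g = l) (w' : l = l') (X : C) {Y : C}
    (hY : A.comp t Y) : (A.E w X hY).hom ≫ (A.castIso w' X).hom ▷ _ =
      (A.E (w.trans w') X hY).hom := by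
  subst w'; simp

theorem E_cast' {g g' l l' : G} {t : Γ} (w : mp.lact t g = l) (w' : g = g') (w'' : l = l')
    (X : C) {Y : C}
    (hY : A.comp t Y) : (A.E w X hY).hom ≫ ((A.castIso w'' X).hom ⊗ₘ (A.castIso w' Y).hom) =
      (A.castIso w' _).hom ≫ (A.E (w' ▸ w''▸ w) X hY).hom := by
  subst w' w''; simp

theorem E_natural {g l : G} {t : Γ} (w : mp.lact t g = l) {X X' Y Y' : C}
    (hY : A.comp t Y) (hY' : A.comp t Y') (f : X ⟶ X') (f' : Y ⟶ Y') :
    (A.act g).map (f ⊗ₘ f') ≫ (A.E w X' hY').hom =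
      (A.E w X hY).hom ≫ ((A.act l).map f ⊗ₘ (A.act g).map f') := by
  subst w; simpa [E] using A.η_natural g hY hY' f f'

theorem E_natural_assoc {g l : G} {t : Γ} (w : mp.lact t g = l) {X X' Y Y' : C}
    (hY : A.comp t Y) (hY' : A.comp t Y') (f : X ⟶ X') (f' : Y ⟶ Y') {Z : C}
    (a : (A.act l).obj X' ⊗ (A.act g).obj Y' ⟶ Z) :
    (A.act g).map (f ⊗ₘ f') ≫ (A.E w X' hY').hom ≫ a =
      (A.E w X hY).hom ≫ ((A.act l).map f ⊗ₘ (A.act g).map f') ≫ a := by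
  simpa only [Category.assoc] using congrArg (· ≫ a) (A.E_natural w hY hY' f f')

theorem E_natural_left {g l : G} {t : Γ} (w : mp.lact t g = l) {X X' Y : C}
    (hY : A.comp t Y) (f : X ⟶ X') :
    (A.act g).map (f ▷ Y) ≫ (A.E w X' hY).hom =
      (A.E w X hY).hom ≫ (A.act l).map f ▷ (A.act g).obj Y := by
  simpa using A.E_natural w hY hY f (𝟙 Y)

theorem E_natural_left_assoc {g l : G} {t : Γ} (w : mp.lact t g = l) {X X' Y : C}
    (hY : A.comp t Y) (f : X ⟶ X') {Z : C} (a : (A.act l).obj X' ⊗ (A.act g).obj Y ⟶ Z) :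
    (A.act g).map (f ▷ Y) ≫ (A.E w X' hY).hom ≫ a =
      (A.E w X hY).hom ≫ (A.act l).map f ▷ (A.act g).obj Y ≫ a := by
  simpa only [Category.assoc] using congrArg (· ≫ a) (A.E_natural_left w hY f)

theorem E_natural_right {g l : G} {t : Γ} (w : mp.lact t g = l) {X Y Y' : C}
    (hY : A.comp t Y) (hY' : A.comp t Y') (f' : Y ⟶ Y') :
    (A.act g).map (X ◁ f') ≫ (A.E w X hY').hom =
      (A.E w X hY).hom ≫ (A.act l).obj X ◁ (A.act g).map f' := by
  simpa using A.E_natural w hY hY' (𝟙 X) f'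

theorem E_natural_right_assoc {g l : G} {t : Γ} (w : mp.lact t g = l) {X Y Y' : C}
    (hY : A.comp t Y) (hY' : A.comp t Y') (f' : Y ⟶ Y') {Z : C}
    (a : (A.act l).obj X ⊗ (A.act g).obj Y' ⟶ Z) :
    (A.act g).map (X ◁ f') ≫ (A.E w X hY').hom ≫ a =
      (A.E w X hY).hom ≫ (A.act l).obj X ◁ (A.act g).map f' ≫ a := by
  simpa only [Category.assoc] using congrArg (· ≫ a) (A.E_natural_right w hY hY' f')

theorem E_assoc {g l a : G} (X : C) {s t : Γ} {Y Z : C} (hY : A.comp s Y)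
    (hZ : A.comp t Z) (w₁ : mp.lact t g = l) (w₂ : mp.lact s l = a)
    (w₃ : mp.lact (s * t) g = a) :
    (A.E w₁ (X ⊗ Y) hZ).hom ≫ (A.E w₂ X hY).hom ▷ (A.act g).obj Z ≫ (α_ _ _ _).hom =
      (A.act g).map (α_ X Y Z).hom ≫ (A.E w₃ X (A.comp_tensor hY hZ)).hom ≫
        (A.act a).obj X ◁ (A.E w₁ Y hZ).hom := by
  subst w₁ w₂
  have := A.η_assoc g X hY hZ
  simp [E, castIso] at this ⊢
  rw [this, MonoidalCategory.tensorHom_def, eqToHom_whiskerRight]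

theorem E_mul {g h l a b d: G} (X : C) {t : Γ} {Y : C} (hY : A.comp t Y)
    (w₁ : g * h = l) (w₂ : mp.lact t l = b) (w₃ : mp.lact t g = a)
    (w₄ : mp.lact (mp.ract t g) h = d) (w₅ : a * d = b) :
    (A.R w₁ (X ⊗ Y)).hom ≫ (A.E w₂ X hY).hom =
      (A.act h).map (A.E w₃ X hY).hom ≫ (A.E w₄ _ (A.comp_act g hY)).hom ≫
        ((A.R w₅ X).hom ⊗ₘ (A.R w₁ Y).hom) := by
  subst w₁ w₂ w₃ w₄
  have := A.η_mul g h X hY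
  simpa [E, R, castIso] using this

theorem E_mul_assoc {g h l a b d : G} (X : C) {t : Γ} {Y : C} (hY : A.comp t Y)
    (w₁ : g * h = l) (w₂ : mp.lact t l = b) (w₃ : mp.lact t g = a)
    (w₄ : mp.lact (mp.ract t g) h = d) (w₅ : a * d = b) {Z : C}
    (p : (A.act b).obj X ⊗ (A.act l).obj Y ⟶ Z) :
    (A.R w₁ (X ⊗ Y)).hom ≫ (A.E w₂ X hY).hom ≫ p =
      (A.act h).map (A.E w₃ X hY).hom ≫ (A.E w₄ _ (A.comp_act g hY)).hom ≫
        ((A.R w₅ X).hom ⊗ₘ (A.R w₁ Y).hom) ≫ p := by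
  simpa only [Category.assoc] using congrArg (· ≫ p) (A.E_mul X hY w₁ w₂ w₃ w₄ w₅)

theorem E_right_unit {g l : G} (X : C) (h : A.comp 1 (𝟙_ C)) (w : mp.lact 1 g = l)
    (w' : l = g) :
    (A.E w X h).hom ≫ ((A.castIso w' X).hom ⊗ₘ (A.η₀ g).hom) ≫
      (ρ_ ((A.act g).obj X)).hom = (A.act g).map (ρ_ X).hom := by
  subst w
  have := A.η_right_unit g X h
  simpa [E, castIso] using this

theorem E_left_unit {g l : G} {t : Γ} {Y : C} (hY : A.comp t Y) (w : mp.lact t g = l) :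
    (A.E w (𝟙_ C) hY).hom ≫ (A.η₀ l).hom ▷ _ ≫ (λ_ ((A.act g).obj Y)).hom =
      (A.act g).map (λ_ Y).hom := by
  subst w
  have := A.η_left_unit g hY
  simpa [E, castIso] using this

theorem E_one (X : C) {t : Γ} {Y : C} (hY : A.comp t Y) (w : mp.lact t 1 = 1) :
    A.oneIso.hom.app (X ⊗ Y) ≫ (A.E w X hY).hom =
      (A.oneIso.hom.app X ⊗ₘ A.oneIso.hom.app Y) := by
  have := A.η_one X hY
  simp only [E, castIso, Iso.trans_hom, eqToIso.hom, whiskerRightIso_hom]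
  rw [reassoc_of% this, ← tensorHom_id, tensorHom_comp_tensorHom]
  simp

end CrossedAction


namespace CrossedAction

variable {k C G Γ : Type*} [Field k] [Group G] [Group Γ] [Finite Γ]
  [Category C] [Abelian C] [Linear k C] [MonoidalCategory C] {mp : MatchedPair G Γ}
  (A : CrossedAction k C mp)

/-- The symbols `g ⋈ X` with `g ∈ G` and `X ∈ C_s` a homogeneous object, `s = |X|`. -/
structure HomogObj where
  g : G
  deg : Γ
  obj : C
  mem : A.comp deg obj

namespace HomogObj

variable {A}

/-- Morphisms `g ⋈ X ⟶ h ⋈ Y` in `vec_G ⊠ C`: morphisms `X ⟶ Y` if `g = h`, and only `0` if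
`g ≠ h`. -/
@[ext]
structure Hom (x y : HomogObj A) where
  f : x.obj ⟶ y.obj
  eq_zero : x.g ≠ y.g → f = 0

instance : Category (HomogObj A) where
  Hom := Hom
  id x := ⟨𝟙 _, fun h => absurd rfl h⟩
  comp {x y z} a b := ⟨a.f ≫ b.f, fun h => by
    by_cases h' : x.g = y.g
    · rw [b.eq_zero (h' ▸ h), comp_zero]
    · rw [a.eq_zero h', zero_comp]⟩
  id_comp a := Hom.ext (Category.id_comp _)
  comp_id a := Hom.ext (Category.comp_id _)
  assoc a b c := Hom.ext (Category.assoc _ _ _)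

@[ext] theorem hom_ext {x y : HomogObj A} {a b : x ⟶ y} (h : a.f = b.f) : a = b := Hom.ext h

@[simp] theorem id_f (x : HomogObj A) : Hom.f (𝟙 x) = 𝟙 x.obj := rfl

@[simp] theorem comp_f {x y z : HomogObj A} (a : x ⟶ y) (b : y ⟶ z) :
    (a ≫ b).f = a.f ≫ b.f := rfl

/-- Morphisms `g ⋈ X ⟶ h ⋈ Y` as a subgroup of the morphisms `X ⟶ Y`. -/
def homEquiv (x y : HomogObj A) :
    (x ⟶ y) ≃ ({ carrier := {f | x.g ≠ y.g → f = 0}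
                 zero_mem' := fun _ => rfl
                 add_mem' := fun ha hb h => by rw [ha h, hb h, add_zero]
                 neg_mem' := fun ha h => by rw [ha h, neg_zero] } :
      AddSubgroup (x.obj ⟶ y.obj)) where
  toFun a := ⟨a.f, a.eq_zero⟩
  invFun a := ⟨a.1, a.2⟩
  left_inv _ := rfl
  right_inv _ := rfl

instance (x y : HomogObj A) : AddCommGroup (x ⟶ y) := (homEquiv x y).addCommGroup

@[simp] theorem add_f {x y : HomogObj A} (a b : x ⟶ y) : (a + b).f = a.f + b.f := rfl

@[simp] theorem zero_f {x y : HomogObj A} : (0 : x ⟶ y).f = 0 := rfl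

instance : Preadditive (HomogObj A) where
  add_comp _ _ _ a b c := by ext; simp
  comp_add _ _ _ a b c := by ext; simp

/-- An isomorphism `X ≅ Y` gives an isomorphism `g ⋈ X ≅ h ⋈ Y` when `g = h`. -/
@[simps] def mkIso {x y : HomogObj A} (w : x.g = y.g) (e : x.obj ≅ y.obj) : x ≅ y where
  hom := ⟨e.hom, fun h => absurd w h⟩
  inv := ⟨e.inv, fun h => absurd w.symm h⟩

end HomogObj

/-! The right action `M ⊗ (g ⋈ X) = M ◁ g ⊗ X` of the symbols on `C`. -/

/-- `M ⊗ (g ⋈ X) = M ◁ g ⊗ X`. -/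
abbrev actObj (M : C) (x : HomogObj A) : C := (A.act x.g).obj M ⊗ x.obj

/-- The action on morphisms of `C`. -/
def actL {M N : C} (a : M ⟶ N) (x : HomogObj A) : A.actObj M x ⟶ A.actObj N x :=
  (A.act x.g).map a ▷ x.obj

open Classical in
/-- The action on morphisms `g ⋈ X ⟶ h ⋈ Y`; it is `M ◁ g ⊗ a` if `g = h`. -/
def actR (M : C) {x y : HomogObj A} (a : x ⟶ y) : A.actObj M x ⟶ A.actObj M y :=
  if w : x.g = y.g then (A.castIso w M).hom ⊗ₘ a.f else 0

/-- The module associativity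
`M ⊗ ((g ⋈ X) ⊗ (h ⋈ Y)) = M ◁ (g (|X| ▶ h)) ⊗ (X ◁ h ⊗ Y) ≅ (M ◁ g ⊗ X) ◁ h ⊗ Y`
made of `α⁻¹`, `(R²)⁻¹` and `(η^h)⁻¹`. -/
def actAssoc (M : C) (x y : HomogObj A) :
    (A.act (x.g * mp.lact x.deg y.g)).obj M ⊗ ((A.act y.g).obj x.obj ⊗ y.obj) ≅
      A.actObj (A.actObj M x) y :=
  (α_ _ _ _).symm ≪≫ whiskerRightIso (whiskerRightIso (A.R rfl M).symm _) _ ≪≫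
    whiskerRightIso (A.E rfl ((A.act x.g).obj M) x.mem).symm _

/-- The module unit constraint `M ◁ 1 ⊗ 1 ≅ M`. -/
def actUnit (M : C) : (A.act 1).obj M ⊗ 𝟙_ C ≅ M :=
  ρ_ _ ≪≫ (A.oneIso.app M).symm

theorem actR_eq (M : C) {x y : HomogObj A} (a : x ⟶ y) (w : x.g = y.g) :
    A.actR M a = (A.castIso w M).hom ⊗ₘ a.f := dif_pos w

theorem actR_eq_zero (M : C) {x y : HomogObj A} (a : x ⟶ y) (w : x.g ≠ y.g) :
    A.actR M a = 0 := dif_neg w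

@[simp] theorem actL_id (M : C) (x : HomogObj A) : A.actL (𝟙 M) x = 𝟙 _ := by
  simp [actL, actObj]

@[simp] theorem actL_comp {M N P : C} (a : M ⟶ N) (b : N ⟶ P) (x : HomogObj A) :
    A.actL (a ≫ b) x = A.actL a x ≫ A.actL b x := by
  simp [actL, actObj]

@[simp] theorem actR_id (M : C) (x : HomogObj A) : A.actR M (𝟙 x) = 𝟙 _ := by
  simp [A.actR_eq M (𝟙 x) rfl, actObj]

theorem actL_actR {M N : C} (a : M ⟶ N) {x y : HomogObj A} (b : x ⟶ y) :
    A.actL a x ≫ A.actR N b = A.actR M b ≫ A.actL a y := by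
  by_cases h : x.g = y.g
  · rw [A.actR_eq _ _ h, A.actR_eq _ _ h]
    simp only [actL, ← tensorHom_id]
    rw [tensorHom_comp_tensorHom, tensorHom_comp_tensorHom, castIso_natural]
    simp
  · rw [A.actR_eq_zero _ _ h, A.actR_eq_zero _ _ h]; simp

theorem actL_actR_assoc {M N : C} (a : M ⟶ N) {x y : HomogObj A} (b : x ⟶ y) {Z : C}
    (p : A.actObj N y ⟶ Z) :
    A.actL a x ≫ A.actR N b ≫ p = A.actR M b ≫ A.actL a y ≫ p := by
  simpa only [Category.assoc] using congrArg (· ≫ p) (A.actL_actR a b)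

variable [MonoidalPreadditive C]

@[simp] theorem actR_comp (M : C) {x y z : HomogObj A} (a : x ⟶ y) (b : y ⟶ z) :
    A.actR M (a ≫ b) = A.actR M a ≫ A.actR M b := by
  by_cases h : x.g = y.g
  · by_cases h' : y.g = z.g
    · rw [A.actR_eq M _ h, A.actR_eq M _ h', A.actR_eq M _ (h.trans h'),
        tensorHom_comp_tensorHom, castIso_trans, HomogObj.comp_f]
    · rw [A.actR_eq_zero M b h', A.actR_eq_zero M _ (h ▸ h'), comp_zero]
  · rw [A.actR_eq_zero M a h, zero_comp]
    by_cases h' : x.g = z.g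
    · rw [A.actR_eq M _ h', HomogObj.comp_f, a.eq_zero h]; simp
    · rw [A.actR_eq_zero M _ h']

@[simp] theorem actL_zero {M N : C} (x : HomogObj A) : A.actL (0 : M ⟶ N) x = 0 := by
  simp [actL]

@[simp] theorem actR_zero (M : C) (x y : HomogObj A) : A.actR M (0 : x ⟶ y) = 0 := by
  by_cases h : x.g = y.g
  · rw [A.actR_eq _ _ h]; simp
  · rw [A.actR_eq_zero _ _ h]

theorem actL_add {M N : C} (a b : M ⟶ N) (x : HomogObj A) :
    A.actL (a + b) x = A.actL a x + A.actL b x := by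
  simp [actL]

theorem actR_add (M : C) {x y : HomogObj A} (a b : x ⟶ y) :
    A.actR M (a + b) = A.actR M a + A.actR M b := by
  by_cases h : x.g = y.g
  · rw [A.actR_eq _ _ h, A.actR_eq _ _ h, A.actR_eq _ _ h]
    simp [MonoidalPreadditive.tensor_add]
  · rw [A.actR_eq_zero _ _ h, A.actR_eq_zero _ _ h, A.actR_eq_zero _ _ h, add_zero]

end CrossedAction


theorem FaithfulGrading.comp_one {Γ C : Type*} [Group Γ] [Finite Γ] [Category C] [Abelian C]
    [MonoidalCategory C] [Simple (𝟙_ C)] (A : FaithfulGrading Γ C) : A.comp 1 (𝟙_ C) := by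
  obtain ⟨Y, hY, ⟨e⟩⟩ := A.exists_decomp (𝟙_ C)
  obtain ⟨s, hs⟩ : ∃ s, biproduct.ι Y s ≫ e.inv ≠ 0 := by
    by_contra! h
    have : e.inv = 0 := biproduct.hom_ext' _ _ fun s => by rw [h s, comp_zero]
    exact id_nonzero (𝟙_ C) (by rw [← e.hom_inv_id, this, comp_zero])
  have hi := isIso_of_mono_of_nonzero hs
  have h1 : A.comp s (𝟙_ C) := A.comp_of_iso (asIso (biproduct.ι Y s ≫ e.inv)) (hY s)
  have h2 : A.comp (s * s) (𝟙_ C) := A.comp_of_iso (λ_ (𝟙_ C)) (A.comp_tensor h1 h1)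
  have h3 : s * s = s := by
    by_contra h
    exact id_nonzero (𝟙_ C) (A.hom_eq_zero h h2 h1 _)
  rw [mul_eq_left] at h3
  exact h3 ▸ h1

namespace CrossedAction

variable {k C G Γ : Type*} [Field k] [Group G] [Group Γ] [Finite Γ]
  [Category C] [Abelian C] [Linear k C] [MonoidalCategory C] {mp : MatchedPair G Γ}
  (A : CrossedAction k C mp)

theorem comp_one [IsFusionCategory k C] : A.comp 1 (𝟙_ C) :=
  haveI := IsFusionCategory.simple_unit (k := k) (C := C)
  A.toFaithfulGrading.comp_one

variable {A}
variable [MonoidalPreadditive C] [IsFusionCategory k C]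

/-- The tensor product of the symbols:
`(g ⋈ X) ⊗ (h ⋈ Y) = g (|X| ▶ h) ⋈ (X ◁ h ⊗ Y)`, with unit `1 ⋈ 1`. -/
instance : MonoidalCategoryStruct (HomogObj A) where
  tensorObj x y :=
    { g := x.g * mp.lact x.deg y.g
      deg := mp.ract x.deg y.g * y.deg
      obj := (A.act y.g).obj x.obj ⊗ y.obj
      mem := A.comp_tensor (A.comp_act _ x.mem) y.mem }
  tensorUnit :=
    { g := 1
      deg := 1
      obj := 𝟙_ C
      mem := A.comp_one }
  whiskerLeft x {y z} a :=
    { f := A.actR x.obj a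
      eq_zero := fun h => A.actR_eq_zero _ _ fun w => h (by dsimp only; rw [w]) }
  whiskerRight {x y} a z :=
    { f := A.actL a.f z
      eq_zero := fun h => by
        have : a.f = 0 := by
          by_cases w : x.g = y.g
          · by_cases w' : x.deg = y.deg
            · exact absurd (by dsimp only; rw [w, w']) h
            · exact A.hom_eq_zero w' x.mem y.mem _
          · exact a.eq_zero w
        rw [this, actL_zero] }
  associator x y z := HomogObj.mkIso
    (by dsimp only; rw [mp.mul_lact, mp.lact_mul, mul_assoc]) (A.actAssoc x.obj y z).symm
  leftUnitor x := HomogObj.mkIso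
    (by dsimp only; rw [mp.one_lact, one_mul]) (whiskerRightIso (A.η₀ x.g) _ ≪≫ λ_ x.obj)
  rightUnitor x := HomogObj.mkIso
    (by dsimp only; rw [mp.lact_one, mul_one]) (A.actUnit x.obj)
  tensorHom {x y z w} a b :=
    { f := A.actL a.f z ≫ A.actR y.obj b
      eq_zero := fun h => by
        by_cases w₁ : x.g = y.g
        · by_cases w₂ : x.deg = y.deg
          · by_cases w₃ : z.g = w.g
            · exact absurd (by dsimp only; rw [w₁, w₂, w₃]) h
            · rw [A.actR_eq_zero _ _ w₃, comp_zero]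
          · rw [A.hom_eq_zero w₂ x.mem y.mem a.f, actL_zero, zero_comp]
        · rw [a.eq_zero w₁, actL_zero, zero_comp] }

namespace HomogObj

theorem whiskerLeft_f (x : HomogObj A) {y z : HomogObj A} (a : y ⟶ z) :
    (x ◁ a).f = A.actR x.obj a := rfl

theorem whiskerRight_f {x y : HomogObj A} (a : x ⟶ y) (z : HomogObj A) :
    (a ▷ z).f = A.actL a.f z := rfl

theorem tensorHom_f {x y z w : HomogObj A} (a : x ⟶ y) (b : z ⟶ w) :
    (a ⊗ₘ b).f = A.actL a.f z ≫ A.actR y.obj b := rfl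

theorem associator_hom_f (x y z : HomogObj A) :
    (α_ x y z).hom.f = (A.actAssoc x.obj y z).inv := rfl

theorem associator_inv_f (x y z : HomogObj A) :
    (α_ x y z).inv.f = (A.actAssoc x.obj y z).hom := rfl

theorem leftUnitor_hom_f (x : HomogObj A) :
    (λ_ x).hom.f = (A.η₀ x.g).hom ▷ x.obj ≫ (λ_ x.obj).hom := rfl

theorem rightUnitor_hom_f (x : HomogObj A) : (ρ_ x).hom.f = (A.actUnit x.obj).hom := rfl

end HomogObj

variable (A)

theorem actAssoc_inv (M : C) (x y : HomogObj A) : (A.actAssoc M x y).inv =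
    ((A.E rfl ((A.act x.g).obj M) x.mem).hom ≫ (A.R rfl M).hom ▷ _) ▷ y.obj ≫ (α_ _ _ _).hom := by
  simp [actAssoc]

/-- Naturality of the module associativity in `M`. -/
theorem actAssoc_natural₁ {M N : C} (a : M ⟶ N) (x y : HomogObj A) :
    (A.actAssoc M x y).inv ≫ A.actL a (x ⊗ y) =
      A.actL (A.actL a x) y ≫ (A.actAssoc N x y).inv := by
  rw [actAssoc_inv, actAssoc_inv]
  change (_ ≫ _) ≫ (A.act (x.g * mp.lact x.deg y.g)).map a ▷ ((A.act y.g).obj x.obj ⊗ y.obj) =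
    (A.act y.g).map ((A.act x.g).map a ▷ x.obj) ▷ y.obj ≫ _
  rw [← comp_whiskerRight_assoc, E_natural_left_assoc, ← comp_whiskerRight, R_natural]
  simp

/-- Naturality of the module associativity in the first symbol. -/
theorem actAssoc_natural₂ (M : C) {x x' : HomogObj A} (a : x ⟶ x') (y : HomogObj A) :
    (A.actAssoc M x y).inv ≫ A.actR M (a ▷ y) =
      A.actL (A.actR M a) y ≫ (A.actAssoc M x' y).inv := by
  by_cases w : x.g = x'.g
  · by_cases w' : x.deg = x'.deg
    · have hw : (x ⊗ y).g = (x' ⊗ y).g := by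
        change x.g * mp.lact x.deg y.g = x'.g * mp.lact x'.deg y.g
        rw [w, w']
      rw [A.actR_eq M _ hw, A.actR_eq M _ w, actAssoc_inv, actAssoc_inv]
      obtain ⟨g, s, X, hX⟩ := x
      obtain ⟨g', s', X', hX'⟩ := x'
      obtain ⟨a, ha⟩ := a
      dsimp only at w w' a ha
      subst w w'
      change (_ ≫ _) ≫ (𝟙 _ ⊗ₘ ((A.act y.g).map a ▷ y.obj)) = (A.act y.g).map (𝟙 _ ⊗ₘ a) ▷ y.obj ≫ _
      rw [← comp_whiskerRight_assoc, E_natural_assoc _ _ hX hX', CategoryTheory.Functor.map_id]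
      simp only [id_tensorHom, comp_whiskerRight, Category.assoc, ← associator_naturality_middle]
      rw [← comp_whiskerRight_assoc (_ ▷ _), ← whisker_exchange, comp_whiskerRight_assoc]
    · have : a = 0 := by ext; exact A.hom_eq_zero w' x.mem x'.mem _
      subst this
      have h2 : ((0 : x ⟶ x') ▷ y) = 0 := by ext; rw [HomogObj.whiskerRight_f]; simp
      simp [h2]
  · have : a = 0 := by ext; exact a.eq_zero w
    subst this
    have h2 : ((0 : x ⟶ x') ▷ y) = 0 := by ext; rw [HomogObj.whiskerRight_f]; simp
    simp [h2]

/-- Naturality of the module associativity in the second symbol. -/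
theorem actAssoc_natural₃ (M : C) (x : HomogObj A) {y y' : HomogObj A} (a : y ⟶ y') :
    (A.actAssoc M x y).inv ≫ A.actR M (x ◁ a) =
      A.actR (A.actObj M x) a ≫ (A.actAssoc M x y').inv := by
  by_cases w : y.g = y'.g
  · have hw : (x ⊗ y).g = (x ⊗ y').g := by
      change x.g * mp.lact x.deg y.g = x.g * mp.lact x.deg y'.g
      rw [w]
    rw [A.actR_eq M _ hw, HomogObj.whiskerLeft_f, A.actR_eq _ _ w, A.actR_eq _ _ w, actAssoc_inv,
      actAssoc_inv]
    obtain ⟨g, s, X, hX⟩ := y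
    obtain ⟨g', s', X', hX'⟩ := y'
    obtain ⟨a, ha⟩ := a
    dsimp only at w a ha
    subst w
    change (_ ≫ _) ≫ (𝟙 _ ⊗ₘ (𝟙 _ ⊗ₘ a)) = (𝟙 _ ⊗ₘ a) ≫ _
    simp only [id_tensorHom, comp_whiskerRight, Category.assoc]
    rw [← associator_naturality_right, whisker_exchange_assoc, whisker_exchange_assoc]
  · have h2 : x ◁ a = 0 := by ext; rw [HomogObj.whiskerLeft_f, actR_eq_zero _ _ _ w]; simp
    simp [h2, actR_eq_zero _ _ _ w]

theorem pentagon_aux {M X Y : C} {s t : Γ} (hX : A.comp s X) (hY : A.comp t Y)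
    {g h l a b c d p q r : G} (wa : mp.lact t l = a) (wb : h * a = b) (wc : mp.lact s b = c)
    (wd : g * c = d) (wp : mp.lact s h = p) (wq : g * p = q)
    (wr : mp.lact (mp.ract s h * t) l = r) (we : q * r = d) :
    (A.E wa ((A.act h).obj ((A.act g).obj M ⊗ X)) hY).hom ≫
      ((A.R wb ((A.act g).obj M ⊗ X)).hom ≫ (A.E wc ((A.act g).obj M) hX).hom ≫
        (A.R wd M).hom ▷ (A.act b).obj X) ▷ (A.act l).obj Y ≫ (α_ _ _ _).hom =
    (A.act l).map ((A.E wp ((A.act g).obj M) hX).hom ▷ Y ≫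
      (A.R wq M).hom ▷ (A.act h).obj X ▷ Y ≫ (α_ _ _ _).hom) ≫
    (A.E wr ((A.act q).obj M) (A.comp_tensor (A.comp_act h hX) hY)).hom ≫
    (A.R we M).hom ▷ _ ≫
    (A.act d).obj M ◁ ((A.E wa ((A.act h).obj X) hY).hom ≫ (A.R wb X).hom ▷ (A.act l).obj Y) := by
  have w4 : mp.lact (mp.ract s h) a = r := by rw [← wr, mp.mul_lact, wa]
  have w5 : p * r = c := by rw [← wc, ← wb, mp.lact_mul, wp, w4]
  have e1 := A.E_mul ((A.act g).obj M) hX wb wc wp w4 w5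
  have e2 := A.R_assoc wq we w5 wd M
  have e3 := A.E_natural_left wa hY (A.E wp ((A.act g).obj M) hX).hom
  have e4 := A.E_assoc ((A.act p).obj ((A.act g).obj M)) (A.comp_act h hX) hY wa w4 wr
  rw [reassoc_of% e1]
  simp only [comp_whiskerRight, Category.assoc, Functor.map_comp]
  rw [← reassoc_of% e3]
  congr 1
  have e5 : (A.act l).map ((A.R wq M).hom ▷ (A.act h).obj X ▷ Y) ≫
      (A.act l).map (α_ ((A.act q).obj M) ((A.act h).obj X) Y).hom =
      (A.act l).map (α_ _ _ _).hom ≫ (A.act l).map ((A.R wq M).hom ▷ ((A.act h).obj X ⊗ Y)) := by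
    rw [← Functor.map_comp, ← Functor.map_comp, associator_naturality_left]
  have e6 := congrArg (fun u => u ▷ (A.act l).obj ((A.act h).obj X ⊗ Y)) e2
  simp only [comp_whiskerRight] at e6
  rw [reassoc_of% e5, E_natural_left_assoc, reassoc_of% e6]
  rw [MonoidalCategory.tensorHom_def']
  simp only [comp_whiskerRight, Category.assoc, MonoidalCategory.whiskerLeft_comp]
  rw [associator_naturality_left, associator_naturality_left_assoc,
    associator_naturality_middle_assoc, reassoc_of% e4]
  congr 2
  simp only [← whisker_exchange, ← whisker_exchange_assoc]

end CrossedAction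


namespace CrossedAction

variable {k C G Γ : Type*} [Field k] [Group G] [Group Γ] [Finite Γ]
  [Category C] [Abelian C] [Linear k C] [MonoidalCategory C] {mp : MatchedPair G Γ}
  (A : CrossedAction k C mp) [MonoidalPreadditive C] [IsFusionCategory k C]

theorem pentagon_coh {P B D X Y W : C} (f : P ⟶ B ⊗ Y) (g : B ⟶ D ⊗ X) (Z : C)
    (h : P ⟶ D ⊗ W) (l : W ⟶ X ⊗ Y) (e : f ≫ g ▷ Y ≫ (α_ _ _ _).hom = h ≫ D ◁ l) :
    (f ▷ Z ≫ (α_ _ _ _).hom) ≫ (g ▷ (Y ⊗ Z) ≫ (α_ _ _ _).hom) =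
      (h ▷ Z ≫ (α_ _ _ _).hom) ≫ D ◁ (l ▷ Z ≫ (α_ _ _ _).hom) := by
  have e' := congrArg (fun u => u ▷ Z ≫ (α_ _ _ _).hom ≫ D ◁ (α_ _ _ _).hom) e
  simp only [comp_whiskerRight, Category.assoc, MonoidalCategory.whiskerLeft_comp] at e' ⊢
  rw [← associator_naturality_middle_assoc, ← e', ← associator_naturality_left_assoc]
  simp

/-- The pentagon of the module associativity. -/
theorem actAssoc_pentagon (M : C) (x y z : HomogObj A) :
    (A.actAssoc (A.actObj M x) y z).inv ≫ (A.actAssoc M x (y ⊗ z)).inv =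
      A.actL (A.actAssoc M x y).inv z ≫ (A.actAssoc M (x ⊗ y) z).inv ≫
        A.actR M (α_ x y z).hom := by
  have w : ((x ⊗ y) ⊗ z).g = (x ⊗ (y ⊗ z)).g := by
    change (x.g * mp.lact x.deg y.g) * mp.lact (mp.ract x.deg y.g * y.deg) z.g =
      x.g * mp.lact x.deg (y.g * mp.lact y.deg z.g)
    rw [mp.mul_lact, mp.lact_mul, mul_assoc]
  have key := A.pentagon_aux (M := M) x.mem y.mem (g := x.g) (h := y.g) (l := z.g) rfl rfl rfl rfl
    rfl rfl rfl w
  rw [A.actR_eq M _ w]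
  simp only [actAssoc_inv, HomogObj.associator_hom_f]
  refine (pentagon_coh (D := (A.act (x ⊗ y ⊗ z).g).obj M) (W := (A.act z.g).obj (x ⊗ y).obj)
    (B := (A.act (y.g * mp.lact y.deg z.g)).obj (A.actObj M x))
    ((A.E rfl ((A.act y.g).obj (A.actObj M x)) y.mem).hom ≫ (A.R rfl (A.actObj M x)).hom ▷ _)
    ((A.E rfl ((A.act x.g).obj M) x.mem).hom ≫ (A.R rfl M).hom ▷ _) z.obj
    ((A.act z.g).map ((A.actAssoc M x y).inv) ≫
      (A.E rfl ((A.act (x ⊗ y).g).obj M) (x ⊗ y).mem).hom ≫ (A.R w M).hom ▷ _)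
    ((A.E rfl ((A.act y.g).obj x.obj) y.mem).hom ≫ (A.R rfl x.obj).hom ▷ _) ?_).trans ?_
  · simp only [actAssoc_inv, comp_whiskerRight, Category.assoc] at key ⊢
    exact key
  · have e := A.R_cast (rfl : (x ⊗ y).g * mp.lact (x ⊗ y).deg z.g = _) w M
    have e2 : (A.R w M).hom ▷ (A.act z.g).obj (x ⊗ y).obj =
      (A.R rfl M).hom ▷ (A.act z.g).obj (x ⊗ y).obj ≫
        (A.castIso w M).hom ▷ (A.act z.g).obj (x ⊗ y).obj := by
      rw [← comp_whiskerRight, e]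
    rw [e2, actAssoc_inv, MonoidalCategory.tensorHom_def]
    simp only [comp_whiskerRight, Category.assoc, associator_naturality_left_assoc]
    erw [associator_naturality_left_assoc]
    rfl

theorem unit_aux (M : C) {g l : G} (w : mp.lact 1 g = l) (w' : l = g) (w'' : 1 * l = g):
    (A.E w ((A.act 1).obj M) A.comp_one).hom ≫ ((A.R w'' M).hom ⊗ₘ (A.η₀ g).hom) ≫ (ρ_ _).hom =
      (A.act g).map ((ρ_ ((A.act 1).obj M)).hom ≫ A.oneIso.inv.app M) := by
  subst w'
  have e := A.E_right_unit ((A.act 1).obj M) A.comp_one w rfl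
  have e' := A.map_one_R w'' rfl M
  simp only [castIso_rfl, Iso.refl_hom] at e e'
  have h : (A.R w'' M).hom = (A.act l).map (A.oneIso.inv.app M) := by
    rw [← cancel_epi ((A.act l).map (A.oneIso.hom.app M)), e', ← CategoryTheory.Functor.map_comp]
    simp
  rw [CategoryTheory.Functor.map_comp, ← e, h]
  simp only [MonoidalCategory.tensorHom_def, Category.assoc, 
    id_whiskerRight, Category.id_comp, ← rightUnitor_naturality, whisker_exchange_assoc]
  rfl

/-- Compatibility of the module unit constraint with the left unit constraint. -/
theorem actAssoc_leftUnit (M : C) (x : HomogObj A) :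
    (A.actAssoc M (𝟙_ _) x).inv ≫ A.actR M (λ_ x).hom = A.actL (A.actUnit M).hom x := by
  have w : (𝟙_ (HomogObj A) ⊗ x).g = x.g := by
    change 1 * mp.lact 1 x.g = x.g
    rw [mp.one_lact, one_mul]
  rw [A.actR_eq M _ w, HomogObj.leftUnitor_hom_f, actAssoc_inv]
  have e := congrArg (fun u => u ▷ x.obj) (A.unit_aux M (g := x.g) rfl (mp.one_lact _) w)
  simp only [comp_whiskerRight] at e
  have e2 := A.R_cast (rfl : 1 * mp.lact 1 x.g = _) w M
  change _ = (A.act x.g).map ((ρ_ ((A.act 1).obj M)).hom ≫ A.oneIso.inv.app M) ▷ x.obj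
  rw [← e, ← e2]
  refine Eq.trans (b := ((A.E rfl ((A.act 1).obj M) A.comp_one).hom ▷ x.obj ≫
    (A.R (rfl : 1 * mp.lact 1 x.g = _) M).hom ▷ (A.act x.g).obj (𝟙_ C) ▷ x.obj ≫ (α_ _ _ _).hom) ≫
      ((A.castIso w M).hom ⊗ₘ (A.η₀ x.g).hom ▷ x.obj ≫ (λ_ x.obj).hom)) ?_ ?_
  · rw [← comp_whiskerRight_assoc]; rfl
  · simp [MonoidalCategory.tensorHom_def, -R_cast]

theorem unit_aux' (M : C) {X : C} {s : Γ} (hX : A.comp s X) {g l : G} (w : mp.lact s 1 = l)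
    (w' : l = 1) (w'' : g * l = g) :
    (A.E w ((A.act g).obj M) hX).hom ≫ ((A.R w'' M).hom ⊗ₘ A.oneIso.inv.app X) =
      A.oneIso.inv.app ((A.act g).obj M ⊗ X) := by
  subst w'
  have e := A.E_one ((A.act g).obj M) hX w
  have e' := A.one_R w'' rfl M
  simp only [castIso_rfl, Iso.refl_hom] at e'
  have h : (A.R w'' M).hom = A.oneIso.inv.app ((A.act g).obj M) := by
    rw [← cancel_epi (A.oneIso.hom.app ((A.act g).obj M)), e', Iso.hom_inv_id_app]
    rfl
  rw [← cancel_epi (A.oneIso.hom.app ((A.act g).obj M ⊗ X)), reassoc_of% e, h,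
    tensorHom_comp_tensorHom, Iso.hom_inv_id_app, Iso.hom_inv_id_app, Iso.hom_inv_id_app]
  exact id_tensorHom_id _ _

/-- Compatibility of the module unit constraint with the right unit constraint. -/
theorem actAssoc_rightUnit (M : C) (x : HomogObj A) :
    (A.actAssoc M x (𝟙_ _)).inv ≫ A.actR M (ρ_ x).hom = (A.actUnit (A.actObj M x)).hom := by
  have w : (x ⊗ 𝟙_ (HomogObj A)).g = x.g := by
    change x.g * mp.lact x.deg 1 = x.g
    rw [mp.lact_one, mul_one]
  rw [A.actR_eq M _ w, HomogObj.rightUnitor_hom_f, actAssoc_inv]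
  have e := congrArg (fun u => u ▷ 𝟙_ C ≫ (ρ_ _).hom)
    (A.unit_aux' M x.mem rfl (mp.lact_one _) w)
  have e2 := A.R_cast (rfl : x.g * mp.lact x.deg 1 = _) w M
  simp only [comp_whiskerRight, Category.assoc] at e
  refine Eq.trans (b := ((A.E rfl ((A.act x.g).obj M) x.mem).hom ▷ 𝟙_ C ≫
    (A.R (rfl : x.g * mp.lact x.deg 1 = _) M).hom ▷ (A.act 1).obj x.obj ▷ 𝟙_ C ≫ (α_ _ _ _).hom) ≫
      ((A.castIso w M).hom ⊗ₘ ((ρ_ _).hom ≫ A.oneIso.inv.app x.obj))) ?_ ?_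
  · rw [← comp_whiskerRight_assoc]; rfl
  · change _ = (ρ_ _).hom ≫ A.oneIso.inv.app ((A.act x.g).obj M ⊗ x.obj)
    refine Eq.trans (b := A.oneIso.inv.app ((A.act x.g).obj M ⊗ x.obj) ▷ 𝟙_ C ≫ (ρ_ _).hom) ?_
      (rightUnitor_naturality _)
    refine Eq.trans ?_ e
    rw [← e2]
    simp [MonoidalCategory.tensorHom_def, -R_cast]

variable {A}

open HomogObj in
instance : MonoidalCategory (HomogObj A) where
  tensorHom_def _ _ := rfl
  id_tensorHom_id x y := by
    ext
    rw [tensorHom_f]; simp; rfl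
  tensorHom_comp_tensorHom a b c d := by
    ext
    simp only [comp_f, tensorHom_f, actL_comp, actR_comp, Category.assoc]
    rw [← actL_actR_assoc]
  whiskerLeft_id x y := by ext; rw [whiskerLeft_f]; simp; rfl
  id_whiskerRight x y := by ext; rw [whiskerRight_f]; simp; rfl
  associator_naturality {x₁ x₂ x₃ y₁ y₂ y₃} a b c := by
    ext
    have h₁ := A.actAssoc_natural₁ a.f x₂ x₃
    have h₂ := A.actAssoc_natural₂ y₁.obj b x₃
    have h₃ := A.actAssoc_natural₃ y₁.obj y₂ c
    simp only [comp_f, tensorHom_f, associator_hom_f, actL_comp, Category.assoc]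
    have h₄ : b ⊗ₘ c = b ▷ x₃ ≫ y₂ ◁ c := rfl
    rw [reassoc_of% h₁, h₄, actR_comp, reassoc_of% h₂, h₃]
    rfl
  leftUnitor_naturality {x y} a := by
    ext
    simp only [comp_f, whiskerLeft_f, leftUnitor_hom_f]
    by_cases w : x.g = y.g
    · rw [A.actR_eq _ _ w]
      obtain ⟨g, s, X, hX⟩ := x
      obtain ⟨g', s', Y, hY⟩ := y
      obtain ⟨a, ha⟩ := a
      dsimp only at w a ha ⊢
      subst w
      change (𝟙 _ ⊗ₘ a) ≫ _ = _
      rw [id_tensorHom, whisker_exchange_assoc]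
      simp
    · rw [A.actR_eq_zero _ _ w, a.eq_zero w]; simp
  rightUnitor_naturality {x y} a := by
    ext
    simp only [comp_f, whiskerRight_f, rightUnitor_hom_f]
    change (A.act 1).map a.f ▷ 𝟙_ C ≫ (ρ_ _).hom ≫ A.oneIso.inv.app _ =
      ((ρ_ _).hom ≫ A.oneIso.inv.app _) ≫ a.f
    simp
  pentagon x y z w := by
    ext
    have := A.actAssoc_pentagon x.obj y z w
    simp only [comp_f, whiskerRight_f, whiskerLeft_f, associator_hom_f] at this ⊢
    exact this.symm
  triangle x y := by
    ext
    simp only [comp_f, whiskerRight_f, whiskerLeft_f, associator_hom_f]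
    exact A.actAssoc_leftUnit x.obj y

end CrossedAction


namespace CrossedAction

variable {k C G Γ : Type*} [Field k] [Group G] [Group Γ] [Finite Γ]
  [Category C] [Abelian C] [Linear k C] [MonoidalCategory C] {mp : MatchedPair G Γ}
  {A : CrossedAction k C mp} [MonoidalPreadditive C] [IsFusionCategory k C]

open HomogObj in
instance : MonoidalPreadditive (HomogObj A) where
  whiskerLeft_zero := by intros; ext; rw [whiskerLeft_f]; simp
  zero_whiskerRight := by intros; ext; rw [whiskerRight_f]; simp
  whiskerLeft_add := by
    intros; ext; rw [whiskerLeft_f, actR_add]; rfl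
  add_whiskerRight := by
    intros; ext; rw [whiskerRight_f, add_f, actL_add]; rfl

/-- `C` as a right module category over the symbols. -/
instance : MonoidalRightAction (HomogObj A) C where
  actionObj M x := A.actObj M x
  actionHomRight M _ _ a := A.actR M a
  actionHomLeft a x := A.actL a x
  actionAssocIso M x y := A.actAssoc M x y
  actionUnitIso M := A.actUnit M
  actionHom_def _ _ := rfl
  actionHomRight_id _ _ := A.actR_id _ _
  id_actionHomLeft _ _ := A.actL_id _ _
  actionHom_comp a b c d := by
    simp only [actL_comp, actR_comp, Category.assoc, actL_actR_assoc]
  actionAssocIso_hom_naturality {M N x₁ x₂ y₁ y₂} f a b := by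
    rw [← Iso.inv_comp_eq]
    have h₁ := A.actAssoc_natural₁ f x₁ y₁
    have h₂ := A.actAssoc_natural₂ N a y₁
    have h₃ := A.actAssoc_natural₃ N x₂ b
    have h₄ : a ⊗ₘ b = a ▷ y₁ ≫ x₂ ◁ b := rfl
    rw [h₄, actR_comp, Category.assoc, Category.assoc, reassoc_of% h₁, reassoc_of% h₂, reassoc_of% h₃,
      actL_comp, Category.assoc]
    simp
  actionUnitIso_hom_naturality a := by
    change ((ρ_ _).hom ≫ A.oneIso.inv.app _) ≫ a =
      (A.act 1).map a ▷ 𝟙_ C ≫ (ρ_ _).hom ≫ A.oneIso.inv.app _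
    simp
  actionHomRight_whiskerRight {x y} a z M := by
    rw [← Iso.inv_comp_eq, A.actAssoc_natural₂ M a z]
  whiskerRight_actionHomLeft x {y z} a M := by
    rw [← Iso.inv_comp_eq, A.actAssoc_natural₃ M x a]
  actionHom_associator x y z M := by
    have := A.actAssoc_pentagon M x y z
    rw [← Iso.inv_comp_eq]
    have h : A.actL (A.actAssoc M x y).hom z ≫ A.actL (A.actAssoc M x y).inv z = 𝟙 _ := by
      rw [← actL_comp, Iso.hom_inv_id, actL_id]
    calc _ = A.actL (A.actAssoc M x y).hom z ≫ (A.actL (A.actAssoc M x y).inv z ≫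
        (A.actAssoc M (x ⊗ y) z).inv ≫ A.actR M (α_ x y z).hom) ≫
          (A.actAssoc M x (y ⊗ z)).hom ≫ (A.actAssoc (A.actObj M x) y z).hom := by
          simp only [Category.assoc, reassoc_of% h]
      _ = _ := by simp [← this]
  actionHom_leftUnitor x M := by
    rw [← A.actAssoc_leftUnit M x, Iso.hom_inv_id_assoc]
  actionHom_rightUnitor x M := by
    rw [← A.actAssoc_rightUnit M x, Iso.hom_inv_id_assoc]

end CrossedAction


section Mat

open MonoidalRightAction

/-- Additivity of a right action in both variables. -/
class IsBiadditiveAction (B D : Type*) [Category B] [Preadditive B] [MonoidalCategory B]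
    [Category D] [Preadditive D] [MonoidalRightAction B D] : Prop where
  actionHomLeft_add : ∀ {M N : D} (f g : M ⟶ N) (x : B), (f + g) ⊵ᵣ x = f ⊵ᵣ x + g ⊵ᵣ x
  actionHomRight_add : ∀ (M : D) {x y : B} (a b : x ⟶ y), M ⊴ᵣ (a + b) = M ⊴ᵣ a + M ⊴ᵣ b

variable {B : Type*} [Category B] [Preadditive B]

namespace CategoryTheory.Mat_

open Classical in
/-- The matrix with entries `φ i : X_i ⟶ Y_{e i}` at `(i, e i)`, and zero elsewhere. -/
def diag {X Y : Mat_ B} (e : X.ι → Y.ι) (φ : ∀ i, X.X i ⟶ Y.X (e i)) : X ⟶ Y :=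
  fun i j => if h : e i = j then φ i ≫ eqToHom (congrArg Y.X h) else 0

theorem diag_self {X Y : Mat_ B} (e : X.ι → Y.ι) (φ : ∀ i, X.X i ⟶ Y.X (e i)) (i : X.ι) :
    diag e φ i (e i) = φ i := by
  simp [diag]

theorem diag_of_ne {X Y : Mat_ B} (e : X.ι → Y.ι) (φ : ∀ i, X.X i ⟶ Y.X (e i)) {i : X.ι} {j : Y.ι}
    (h : e i ≠ j) : diag e φ i j = 0 := by
  simp [diag, h]

theorem diag_comp_apply {X Y Z : Mat_ B} (e : X.ι → Y.ι) (φ : ∀ i, X.X i ⟶ Y.X (e i)) (f : Y ⟶ Z)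
    (i : X.ι) (j : Z.ι) : (diag e φ ≫ f) i j = φ i ≫ f (e i) j := by
  rw [comp_apply, Finset.sum_eq_single (e i), diag_self]
  · intro b _ hb
    rw [diag_of_ne _ _ hb.symm, zero_comp]
  · simp

theorem comp_diag_apply {X Y Z : Mat_ B} (e : Y.ι → Z.ι) (he : e.Injective)
    (φ : ∀ i, Y.X i ⟶ Z.X (e i)) (f : X ⟶ Y)
    (i : X.ι) (j : Y.ι) : (f ≫ diag e φ) i (e j) = f i j ≫ φ j := by
  rw [comp_apply, Finset.sum_eq_single j, diag_self]
  · intro b _ hb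
    rw [diag_of_ne _ _ (fun h => hb (he h)), comp_zero]
  · simp

theorem diag_congr {X Y : Mat_ B} (e : X.ι → Y.ι) {φ ψ : ∀ i, X.X i ⟶ Y.X (e i)}
    (h : ∀ i, φ i = ψ i) : diag e φ = diag e ψ := by
  rw [funext h]

theorem id_eq_diag (X : Mat_ B) : 𝟙 X = diag id (fun i => 𝟙 (X.X i)) := by
  ext i j
  by_cases h : i = j
  · subst h
    exact (id_apply_self X i).trans (diag_self (X := X) (Y := X) id (fun i => 𝟙 (X.X i)) i).symm
  · rw [diag_of_ne _ _ h]; exact id_apply_of_ne X i j h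

theorem diag_comp_diag {X Y Z : Mat_ B} (e : X.ι → Y.ι) (φ : ∀ i, X.X i ⟶ Y.X (e i))
    (e' : Y.ι → Z.ι) (φ' : ∀ i, Y.X i ⟶ Z.X (e' i)) :
    diag e φ ≫ diag e' φ' = diag (fun i => e' (e i)) (fun i => φ i ≫ φ' (e i)) := by
  ext i j
  rw [diag_comp_apply]
  by_cases h : e' (e i) = j
  · subst h
    rw [diag_self e' φ' (e i)]
    exact (diag_self (X := X) (Y := Z) (fun i => e' (e i)) (fun i => φ i ≫ φ' (e i)) i).symm
  · rw [diag_of_ne _ _ h, comp_zero]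
    exact (diag_of_ne (X := X) (Y := Z) (fun i => e' (e i)) (fun i => φ i ≫ φ' (e i)) h).symm

variable [MonoidalCategory B]

/-- The tensor product of objects, `(X ⊗ Y)_{(i,j)} = X_i ⊗ Y_j`. -/
abbrev tObj (X Y : Mat_ B) : Mat_ B := ⟨X.ι × Y.ι, fun p => X.X p.1 ⊗ Y.X p.2⟩

/-- The unit object. -/
abbrev uObj : Mat_ B := ⟨PUnit, fun _ => 𝟙_ B⟩

/-- The tensor product of matrices. -/
def tHom {X X' Y Y' : Mat_ B} (f : X ⟶ X') (g : Y ⟶ Y') : tObj X Y ⟶ tObj X' Y' :=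
  fun p q => f p.1 q.1 ⊗ₘ g p.2 q.2

theorem tHom_apply {X X' Y Y' : Mat_ B} (f : X ⟶ X') (g : Y ⟶ Y') (p : X.ι × Y.ι)
    (q : X'.ι × Y'.ι) : tHom f g p q = f p.1 q.1 ⊗ₘ g p.2 q.2 := rfl

/-- The associator. -/
def tAssoc (X Y Z : Mat_ B) : tObj (tObj X Y) Z ≅ tObj X (tObj Y Z) where
  hom := diag (X := tObj (tObj X Y) Z) (Y := tObj X (tObj Y Z))
    (fun p => (p.1.1, (p.1.2, p.2))) fun p => (α_ (X.X p.1.1) (Y.X p.1.2) (Z.X p.2)).hom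
  inv := diag (X := tObj X (tObj Y Z)) (Y := tObj (tObj X Y) Z)
    (fun p => ((p.1, p.2.1), p.2.2)) fun p => (α_ (X.X p.1) (Y.X p.2.1) (Z.X p.2.2)).inv
  hom_inv_id := by
    rw [diag_comp_diag, id_eq_diag]
    exact diag_congr id fun _ => Iso.hom_inv_id _
  inv_hom_id := by
    rw [diag_comp_diag, id_eq_diag]
    exact diag_congr id fun _ => Iso.inv_hom_id _

/-- The left unitor. -/
def tLeft (X : Mat_ B) : tObj uObj X ≅ X where
  hom := diag (X := tObj uObj X) (fun p => p.2) fun p => (λ_ (X.X p.2)).hom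
  inv := diag (Y := tObj uObj X) (fun i => (PUnit.unit, i)) fun i => (λ_ (X.X i)).inv
  hom_inv_id := by
    rw [diag_comp_diag, id_eq_diag]
    exact diag_congr id fun _ => Iso.hom_inv_id _
  inv_hom_id := by
    rw [diag_comp_diag, id_eq_diag]
    exact diag_congr id fun _ => Iso.inv_hom_id _

/-- The right unitor. -/
def tRight (X : Mat_ B) : tObj X uObj ≅ X where
  hom := diag (X := tObj X uObj) (fun p => p.1) fun p => (ρ_ (X.X p.1)).hom
  inv := diag (Y := tObj X uObj) (fun i => (i, PUnit.unit)) fun i => (ρ_ (X.X i)).inv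
  hom_inv_id := by
    rw [diag_comp_diag, id_eq_diag]
    exact diag_congr id fun _ => Iso.hom_inv_id _
  inv_hom_id := by
    rw [diag_comp_diag, id_eq_diag]
    exact diag_congr id fun _ => Iso.inv_hom_id _

variable [MonoidalPreadditive B]

theorem tHom_diag_diag {X X' Y Y' : Mat_ B} (e : X.ι → X'.ι) (φ : ∀ i, X.X i ⟶ X'.X (e i))
    (e' : Y.ι → Y'.ι) (φ' : ∀ i, Y.X i ⟶ Y'.X (e' i)) :
    tHom (diag e φ) (diag e' φ') = diag (X := tObj X Y) (Y := tObj X' Y')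
      (fun p => (e p.1, e' p.2)) (fun p => φ p.1 ⊗ₘ φ' p.2) := by
  ext p q
  rw [tHom_apply]
  obtain ⟨q₁, q₂⟩ := q
  by_cases h : e p.1 = q₁
  · by_cases h' : e' p.2 = q₂
    · subst h h'
      rw [diag_self e φ, diag_self e' φ']
      exact (diag_self (X := tObj X Y) (Y := tObj X' Y') (fun p => (e p.1, e' p.2))
        (fun p => φ p.1 ⊗ₘ φ' p.2) p).symm
    · rw [diag_of_ne _ _ h', MonoidalPreadditive.tensor_zero]
      exact (diag_of_ne (X := tObj X Y) (Y := tObj X' Y') (fun p => (e p.1, e' p.2))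
        (fun p => φ p.1 ⊗ₘ φ' p.2) (fun h'' => h' (Prod.ext_iff.mp h'').2)).symm
  · rw [diag_of_ne _ _ h, MonoidalPreadditive.zero_tensor]
    exact (diag_of_ne (X := tObj X Y) (Y := tObj X' Y') (fun p => (e p.1, e' p.2))
        (fun p => φ p.1 ⊗ₘ φ' p.2) (fun h'' => h (Prod.ext_iff.mp h'').1)).symm

theorem tHom_comp {X₁ Y₁ Z₁ X₂ Y₂ Z₂ : Mat_ B} (f : X₁ ⟶ Y₁) (f' : X₂ ⟶ Y₂) (g : Y₁ ⟶ Z₁)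
    (g' : Y₂ ⟶ Z₂) : tHom f f' ≫ tHom g g' = tHom (f ≫ g) (f' ≫ g') := by
  ext p q
  rw [tHom_apply, comp_apply, comp_apply, comp_apply]
  simp only [tHom_apply]
  rw [sum_tensor, Fintype.sum_prod_type]
  refine Finset.sum_congr rfl fun i _ => ?_
  rw [tensor_sum]
  exact Finset.sum_congr rfl fun j _ => tensorHom_comp_tensorHom _ _ _ _

/-- The tensor product of matrices, entrywise given by that of `B`. -/
instance : MonoidalCategoryStruct (Mat_ B) where
  tensorObj := tObj
  tensorUnit := uObj
  tensorHom f g := tHom f g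
  whiskerLeft X _ _ g := tHom (𝟙 X) g
  whiskerRight f Z := tHom f (𝟙 Z)
  associator := tAssoc
  leftUnitor := tLeft
  rightUnitor := tRight

instance : MonoidalCategory (Mat_ B) := .ofTensorHom
  (id_tensorHom_id := fun X Y => by
    change tHom (𝟙 X) (𝟙 Y) = 𝟙 (tObj X Y)
    rw [id_eq_diag, id_eq_diag, tHom_diag_diag, id_eq_diag]
    exact diag_congr id fun _ => id_tensorHom_id _ _)
  (tensorHom_comp_tensorHom := fun f f' g g' => tHom_comp f f' g g')
  (id_tensorHom := fun _ _ _ _ => rfl)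
  (tensorHom_id := fun _ _ => rfl)
  (associator_naturality := fun {X₁ X₂ X₃ Y₁ Y₂ Y₃} f g h => by
    change tHom (tHom f g) h ≫ (tAssoc _ _ _).hom = (tAssoc _ _ _).hom ≫ tHom f (tHom g h)
    ext p q
    refine Eq.trans ?_ (diag_comp_apply (X := tObj (tObj X₁ X₂) X₃) (Y := tObj X₁ (tObj X₂ X₃))
      _ _ _ _ _).symm
    refine (comp_diag_apply (Y := tObj (tObj Y₁ Y₂) Y₃) (Z := tObj Y₁ (tObj Y₂ Y₃)) _
      ?_ _ _ p ((q.1, q.2.1), q.2.2)).trans (associator_naturality _ _ _)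
    rintro ⟨⟨_, _⟩, _⟩ ⟨⟨_, _⟩, _⟩ h
    cases h; rfl)
  (leftUnitor_naturality := fun {X Y} f => by
    change tHom (𝟙 uObj) f ≫ (tLeft _).hom = (tLeft _).hom ≫ f
    ext p q
    refine Eq.trans ?_ (diag_comp_apply (X := tObj uObj X) (Y := X) _ _ _ _ _).symm
    refine (comp_diag_apply (Y := tObj uObj Y) (Z := Y) (fun p => p.2)
      ?_ _ _ p (PUnit.unit, q)).trans ?_
    · rintro ⟨_, _⟩ ⟨_, _⟩ h
      cases h; rfl
    · rw [tHom_apply, id_apply_self]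
      simp)
  (rightUnitor_naturality := fun {X Y} f => by
    change tHom f (𝟙 uObj) ≫ (tRight _).hom = (tRight _).hom ≫ f
    ext p q
    refine Eq.trans ?_ (diag_comp_apply (X := tObj X uObj) (Y := X) _ _ _ _ _).symm
    refine (comp_diag_apply (Y := tObj Y uObj) (Z := Y) (fun p => p.1)
      ?_ _ _ p (q, PUnit.unit)).trans ?_
    · rintro ⟨_, _⟩ ⟨_, _⟩ h
      cases h; rfl
    · rw [tHom_apply, id_apply_self]
      simp)
  (pentagon := fun W X Y Z => by
    change tHom (tAssoc _ _ _).hom (𝟙 _) ≫ (tAssoc _ _ _).hom ≫ tHom (𝟙 _) (tAssoc _ _ _).hom =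
      (tAssoc _ _ _).hom ≫ (tAssoc _ _ _).hom
    simp only [tAssoc]
    rw [id_eq_diag, id_eq_diag, tHom_diag_diag, tHom_diag_diag, diag_comp_diag, diag_comp_diag,
      diag_comp_diag]
    refine diag_congr _ fun p => ?_
    simp)
  (triangle := fun X Y => by
    change (tAssoc _ _ _).hom ≫ tHom (𝟙 _) (tLeft _).hom = tHom (tRight _).hom (𝟙 _)
    simp only [tAssoc, tLeft, tRight]
    rw [id_eq_diag, id_eq_diag, tHom_diag_diag, tHom_diag_diag, diag_comp_diag]
    refine diag_congr _ fun p => ?_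
    simp)

end CategoryTheory.Mat_

end Mat


section MatAction

open MonoidalRightAction CategoryTheory.Mat_

variable {B D : Type*} [Category B] [Preadditive B] [MonoidalCategory B] [MonoidalPreadditive B]
  [Category D] [Preadditive D] [HasFiniteBiproducts D] [MonoidalRightAction B D]
  [IsBiadditiveAction B D]

namespace CategoryTheory.Mat_

theorem actL_zero' {M N : D} (x : B) : (0 : M ⟶ N) ⊵ᵣ x = 0 := by
  simpa using (IsBiadditiveAction.actionHomLeft_add (0 : M ⟶ N) 0 x).symm

theorem actL_sum {M N : D} {J : Type*} [Fintype J] (f : J → (M ⟶ N)) (x : B) :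
    (∑ j, f j) ⊵ᵣ x = ∑ j, f j ⊵ᵣ x :=
  map_sum (AddMonoidHom.mk' (fun f : M ⟶ N => f ⊵ᵣ x)
    fun f g => IsBiadditiveAction.actionHomLeft_add f g x) f _

theorem actR_zero' (M : D) (x y : B) : M ⊴ᵣ (0 : x ⟶ y) = 0 := by
  simpa using (IsBiadditiveAction.actionHomRight_add M (0 : x ⟶ y) 0).symm

theorem actR_sum (M : D) {x y : B} {J : Type*} [Fintype J] (f : J → (x ⟶ y)) :
    M ⊴ᵣ (∑ j, f j) = ∑ j, M ⊴ᵣ f j :=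
  map_sum (AddMonoidHom.mk' (fun f : x ⟶ y => M ⊴ᵣ f)
    fun f g => IsBiadditiveAction.actionHomRight_add M f g) f _

/-- The action of `X = (X_i)` on `M` is `⨁ i, M ⊗ X_i`. -/
abbrev mAct (M : D) (X : Mat_ B) : D := ⨁ fun i => M ⊙ᵣ X.X i

/-- The action on morphisms of `D`. -/
def mActL {M N : D} (f : M ⟶ N) (X : Mat_ B) : mAct M X ⟶ mAct N X :=
  biproduct.map fun i => f ⊵ᵣ X.X i

/-- The action on matrices. -/
def mActR (M : D) {X Y : Mat_ B} (f : X ⟶ Y) : mAct M X ⟶ mAct M Y :=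
  biproduct.matrix fun i j => M ⊴ᵣ f i j

theorem mAct_hom_ext {M N : D} {X : Mat_ B} {y : B} {f g : mAct M X ⊙ᵣ y ⟶ N}
    (h : ∀ i, biproduct.ι (fun i => M ⊙ᵣ X.X i) i ⊵ᵣ y ≫ f =
      biproduct.ι (fun i => M ⊙ᵣ X.X i) i ⊵ᵣ y ≫ g) : f = g := by
  have e : 𝟙 (mAct M X ⊙ᵣ y) = ∑ i, biproduct.π (fun i => M ⊙ᵣ X.X i) i ⊵ᵣ y ≫
      biproduct.ι (fun i => M ⊙ᵣ X.X i) i ⊵ᵣ y := by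
    rw [← id_actionHomLeft, ← biproduct.total, actL_sum]
    simp
  rw [← Category.id_comp f, ← Category.id_comp g, e, Preadditive.sum_comp, Preadditive.sum_comp]
  exact Finset.sum_congr rfl fun i _ => by rw [Category.assoc, Category.assoc, h]

theorem ι_mActL {M N : D} (f : M ⟶ N) (X : Mat_ B) (i : X.ι) :
    biproduct.ι (fun i => M ⊙ᵣ X.X i) i ≫ mActL f X =
      f ⊵ᵣ X.X i ≫ biproduct.ι (fun i => N ⊙ᵣ X.X i) i := by
  simp [mActL]

theorem mActR_diag (M : D) {X Y : Mat_ B} (e : X.ι → Y.ι) (φ : ∀ i, X.X i ⟶ Y.X (e i)) (i : X.ι) :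
    biproduct.ι (fun i => M ⊙ᵣ X.X i) i ≫ mActR M (diag e φ) =
      M ⊴ᵣ φ i ≫ biproduct.ι (fun i => M ⊙ᵣ Y.X i) (e i) := by
  refine biproduct.hom_ext _ _ fun j => ?_
  rw [mActR, biproduct.ι_matrix, biproduct.lift_π, Category.assoc]
  by_cases h : e i = j
  · subst h
    rw [diag_self, biproduct.ι_π_self, Category.comp_id]
  · rw [diag_of_ne _ _ h, biproduct.ι_π_ne _ h, comp_zero, actR_zero']

theorem mActR_id (M : D) (X : Mat_ B) : mActR M (𝟙 X) = 𝟙 _ := by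
  refine biproduct.hom_ext' _ _ fun i => ?_
  rw [id_eq_diag, mActR_diag]
  simp

theorem mActR_comp (M : D) {X Y Z : Mat_ B} (f : X ⟶ Y) (g : Y ⟶ Z) :
    mActR M (f ≫ g) = mActR M f ≫ mActR M g := by
  refine biproduct.hom_ext' _ _ fun i => biproduct.hom_ext _ _ fun j => ?_
  simp [mActR, actR_sum, biproduct.lift_matrix]

theorem mActL_mActR {M N : D} (f : M ⟶ N) {X Y : Mat_ B} (g : X ⟶ Y) :
    mActL f X ≫ mActR N g = mActR M g ≫ mActL f Y := by
  refine biproduct.hom_ext' _ _ fun i => biproduct.hom_ext _ _ fun j => ?_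
  simp [mActR, mActL, action_exchange]

/-- `M ⊗ (X ⊗ Y) ≅ (M ⊗ X) ⊗ Y`, given by the associativity constraint of the action of `B` on the
summands. -/
def mAssoc (M : D) (X Y : Mat_ B) : mAct M (tObj X Y) ≅ mAct (mAct M X) Y where
  hom := biproduct.desc fun p => (αᵣ M (X.X p.1) (Y.X p.2)).hom ≫
    biproduct.ι (fun i => M ⊙ᵣ X.X i) p.1 ⊵ᵣ Y.X p.2 ≫
      biproduct.ι (fun j => mAct M X ⊙ᵣ Y.X j) p.2
  inv := biproduct.desc fun j => ∑ i, biproduct.π (fun i => M ⊙ᵣ X.X i) i ⊵ᵣ Y.X j ≫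
    (αᵣ M (X.X i) (Y.X j)).inv ≫ biproduct.ι (fun p => M ⊙ᵣ (tObj X Y).X p) (i, j)
  hom_inv_id := by
    refine biproduct.hom_ext' _ _ fun ⟨i, j⟩ => ?_
    rw [biproduct.ι_desc_assoc, Category.assoc, Category.assoc, biproduct.ι_desc, Preadditive.comp_sum, Preadditive.comp_sum,
      Finset.sum_eq_single i]
    · rw [← comp_actionHomLeft_assoc, biproduct.ι_π_self, id_actionHomLeft, Category.id_comp,
        Iso.hom_inv_id_assoc]
      exact (Category.comp_id _).symm
    · intro b _ hb
      rw [← comp_actionHomLeft_assoc, biproduct.ι_π_ne _ hb.symm, actL_zero', zero_comp,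
        comp_zero]
    · simp
  inv_hom_id := by
    refine biproduct.hom_ext' _ _ fun j => mAct_hom_ext fun i => ?_
    rw [biproduct.ι_desc_assoc, Preadditive.sum_comp, Preadditive.comp_sum, Finset.sum_eq_single i]
    · rw [Category.assoc, ← comp_actionHomLeft_assoc, biproduct.ι_π_self, id_actionHomLeft,
        Category.id_comp, Category.assoc, biproduct.ι_desc, Iso.inv_hom_id_assoc, Category.comp_id]
    · intro b _ hb
      rw [Category.assoc, ← comp_actionHomLeft_assoc, biproduct.ι_π_ne _ hb.symm, actL_zero',
        zero_comp]
    · simp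

theorem ι_mAssoc_hom (M : D) (X Y : Mat_ B) (i : X.ι) (j : Y.ι) :
    biproduct.ι (fun p => M ⊙ᵣ (tObj X Y).X p) (i, j) ≫ (mAssoc M X Y).hom =
      (αᵣ M (X.X i) (Y.X j)).hom ≫ biproduct.ι (fun i => M ⊙ᵣ X.X i) i ⊵ᵣ Y.X j ≫
        biproduct.ι (fun j => mAct M X ⊙ᵣ Y.X j) j := by
  simp [mAssoc]

/-- `M ⊗ 1 ≅ M`. -/
def mUnit (M : D) : mAct M (uObj : Mat_ B) ≅ M where
  hom := biproduct.desc fun _ => (ρᵣ[B] M).hom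
  inv := (ρᵣ[B] M).inv ≫ biproduct.ι (fun _ => M ⊙ᵣ 𝟙_ B) PUnit.unit
  hom_inv_id := by
    refine biproduct.hom_ext' _ _ fun i => ?_
    simp
  inv_hom_id := by
    simp

theorem ι_mActR (M : D) {X Y : Mat_ B} (f : X ⟶ Y) (i : X.ι) :
    biproduct.ι (fun i => M ⊙ᵣ X.X i) i ≫ mActR M f =
      ∑ j, M ⊴ᵣ f i j ≫ biproduct.ι (fun i => M ⊙ᵣ Y.X i) j := by
  refine biproduct.hom_ext _ _ fun j => ?_
  rw [Preadditive.sum_comp, Finset.sum_eq_single j]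
  · simp [mActR]
  · intro b _ hb
    rw [Category.assoc, biproduct.ι_π_ne _ hb, comp_zero]
  · simp

theorem mAssoc_natural (M : D) {X X' Y Y' : Mat_ B} (f : X ⟶ X') (g : Y ⟶ Y') :
    mActR M (tHom f g) ≫ (mAssoc M X' Y').hom =
      (mAssoc M X Y).hom ≫ mActL (mActR M f) Y ≫ mActR _ g := by
  refine biproduct.hom_ext' _ _ fun ⟨i, j⟩ => ?_
  rw [← Category.assoc, ι_mActR, ← Category.assoc, ι_mAssoc_hom, Category.assoc, Category.assoc,
    ← Category.assoc (biproduct.ι _ j), ι_mActL, Category.assoc, ι_mActR,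
    ← comp_actionHomLeft_assoc, ι_mActR, actL_sum, Preadditive.sum_comp, Preadditive.sum_comp,
    Preadditive.comp_sum, Fintype.sum_prod_type]
  refine Finset.sum_congr rfl fun i' _ => ?_
  rw [Preadditive.comp_sum, Preadditive.comp_sum]
  refine Finset.sum_congr rfl fun j' _ => ?_
  have h := actionAssocIso_hom_naturality (𝟙 M) (f i i') (g j j')
  rw [id_actionHom, id_actionHom, actionHom_def] at h
  rw [Category.assoc, ι_mAssoc_hom, tHom_apply, reassoc_of% h, comp_actionHomLeft, Category.assoc,
    action_exchange_assoc]

theorem mAssoc_natural_left {M N : D} (f : M ⟶ N) (X Y : Mat_ B) :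
    mActL f (tObj X Y) ≫ (mAssoc N X Y).hom = (mAssoc M X Y).hom ≫ mActL (mActL f X) Y := by
  refine biproduct.hom_ext' _ _ fun ⟨i, j⟩ => ?_
  have h := actionAssocIso_hom_naturality f (𝟙 (X.X i)) (𝟙 (Y.X j))
  rw [id_tensorHom_id, actionHom_id, actionHom_id, actionHom_id] at h
  rw [← Category.assoc, ι_mActL, Category.assoc, ι_mAssoc_hom, reassoc_of% h,
    reassoc_of% (ι_mAssoc_hom M X Y i j), ι_mActL, ← comp_actionHomLeft_assoc,
    ← comp_actionHomLeft_assoc, ι_mActL]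

theorem mAssoc_pentagon (M : D) (X Y Z : Mat_ B) :
    mActR M (tAssoc X Y Z).hom ≫ (mAssoc M X (tObj Y Z)).hom ≫ (mAssoc (mAct M X) Y Z).hom =
      (mAssoc M (tObj X Y) Z).hom ≫ mActL (mAssoc M X Y).hom Z := by
  refine biproduct.hom_ext' _ _ fun ⟨⟨i, j⟩, l⟩ => ?_
  have h := actionHom_associator (X.X i) (Y.X j) (Z.X l) M
  have h₁ := actionAssocIso_hom_naturality (biproduct.ι (fun i => M ⊙ᵣ X.X i) i) (𝟙 (Y.X j)) (𝟙 (Z.X l))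
  rw [id_tensorHom_id, actionHom_id, actionHom_id, actionHom_id] at h₁
  rw [tAssoc, ← Category.assoc, mActR_diag, Category.assoc, ← Category.assoc (biproduct.ι _ (i, j, l)),
    ι_mAssoc_hom]
  simp only [Category.assoc]
  rw [ι_mAssoc_hom, reassoc_of% h₁, reassoc_of% h,
    reassoc_of% (ι_mAssoc_hom M (tObj X Y) Z (i, j) l)]
  rw [ι_mActL, ← comp_actionHomLeft_assoc (biproduct.ι _ (i, j)), ι_mAssoc_hom,
    comp_actionHomLeft, comp_actionHomLeft]
  try simp only [Category.assoc]

theorem mAssoc_leftUnit (M : D) (X : Mat_ B) :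
    mActR M (tLeft X).hom = (mAssoc M uObj X).hom ≫ mActL (mUnit M).hom X := by
  refine biproduct.hom_ext' _ _ fun ⟨u, i⟩ => ?_
  rw [tLeft, mActR_diag, ← Category.assoc, ι_mAssoc_hom, Category.assoc, Category.assoc, ι_mActL,
    ← comp_actionHomLeft_assoc, mUnit, biproduct.ι_desc, actionHom_leftUnitor, Category.assoc]

theorem mAssoc_rightUnit (M : D) (X : Mat_ B) :
    mActR M (tRight X).hom = (mAssoc M X uObj).hom ≫ (mUnit (mAct M X)).hom := by
  refine biproduct.hom_ext' _ _ fun ⟨i, u⟩ => ?_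
  rw [tRight, mActR_diag, ← Category.assoc, ι_mAssoc_hom, Category.assoc, Category.assoc, mUnit,
    biproduct.ι_desc, ← actionUnitIso_hom_naturality, actionHom_rightUnitor, Category.assoc]

end CategoryTheory.Mat_

open CategoryTheory.Mat_

/-- A biadditive right action of `B` extends to the additive envelope. -/
instance : MonoidalRightAction (Mat_ B) D where
  actionObj M X := mAct M X
  actionHomLeft f X := mActL f X
  actionHomRight M _ _ f := mActR M f
  actionHom f g := mActL f _ ≫ mActR _ g
  actionAssocIso M X Y := mAssoc M X Y
  actionUnitIso M := mUnit M
  actionHom_def f g := rfl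
  actionHomRight_id X M := mActR_id M X
  id_actionHomLeft X M := by
    refine biproduct.hom_ext' _ _ fun i => ?_
    rw [ι_mActL, id_actionHomLeft, Category.id_comp]
    exact (Category.comp_id _).symm
  actionHom_comp {X X' X'' M M' M''} f₁ f₂ g₁ g₂ := by
    have h : mActL (f₁ ≫ f₂) X = mActL f₁ X ≫ mActL f₂ X := by
      refine biproduct.hom_ext' _ _ fun i => ?_
      rw [ι_mActL, ← Category.assoc, ι_mActL, Category.assoc, ι_mActL, comp_actionHomLeft,
        Category.assoc]
    rw [h, mActR_comp]
    simp only [Category.assoc]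
    rw [← Category.assoc (mActL f₂ X), mActL_mActR, Category.assoc]
  actionAssocIso_hom_naturality {M N X X' Y Y'} f g h := by
    change (mActL f (tObj X Y) ≫ mActR N (tHom g h)) ≫ (mAssoc N X' Y').hom = (mAssoc M X Y).hom ≫
      mActL (mActL f X ≫ mActR N g) Y ≫ mActR _ h
    have e : mActL (mActL f X ≫ mActR N g) Y = mActL (mActL f X) Y ≫ mActL (mActR N g) Y := by
      refine biproduct.hom_ext' _ _ fun i => ?_
      rw [ι_mActL, ← Category.assoc, ι_mActL, Category.assoc, ι_mActL, comp_actionHomLeft,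
        Category.assoc]
    rw [Category.assoc, mAssoc_natural, ← Category.assoc, mAssoc_natural_left, e]
    simp only [Category.assoc]
  actionUnitIso_hom_naturality {M N} f := by
    change (mUnit M).hom ≫ f = mActL f uObj ≫ (mUnit N).hom
    refine biproduct.hom_ext' _ _ fun i => ?_
    rw [reassoc_of% (ι_mActL f (uObj : Mat_ B) i), mUnit, mUnit, biproduct.ι_desc_assoc,
      biproduct.ι_desc, actionUnitIso_hom_naturality]
  actionHomRight_whiskerRight {X X'} f Y M := by
    have h := mAssoc_natural M f (𝟙 Y)
    rw [mActR_id, Category.comp_id] at h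
    exact ((Iso.comp_inv_eq _).mpr h.symm).symm.trans (Category.assoc _ _ _)
  whiskerRight_actionHomLeft X {Y Y'} f M := by
    have h := mAssoc_natural M (𝟙 X) f
    have e : mActL (mActR M (𝟙 X)) Y = 𝟙 _ := by
      rw [mActR_id]
      refine biproduct.hom_ext' _ _ fun i => ?_
      rw [ι_mActL, id_actionHomLeft, Category.id_comp]
      exact (Category.comp_id _).symm
    rw [e, Category.id_comp] at h
    exact ((Iso.comp_inv_eq _).mpr h.symm).symm.trans (Category.assoc _ _ _)
  actionHom_associator X Y Z M := mAssoc_pentagon M X Y Z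
  actionHom_leftUnitor X M := mAssoc_leftUnit M X
  actionHom_rightUnitor X M := mAssoc_rightUnit M X

end MatAction

section ModuleEnd

open MonoidalRightAction

variable {k : Type*} [Field k] {B M : Type*} [Category B] [MonoidalCategory B] [Category M]
  [Preadditive M] [Linear k M] [MonoidalRightAction B M]

variable (k B M) in
/-- The action of `B` on `M` is `k`-linear in the variable from `M`. -/
class IsLinearAction : Prop where
  actionHomLeft_add : ∀ {m n : M} (f g : m ⟶ n) (x : B), (f + g) ⊵ᵣ x = f ⊵ᵣ x + g ⊵ᵣ x
  actionHomLeft_smul : ∀ (c : k) {m n : M} (f : m ⟶ n) (x : B), (c • f) ⊵ᵣ x = c • f ⊵ᵣ x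

variable (k B M) in
/-- A `B`-module endofunctor `(F, s)` of a `k`-linear right module category `M` over `B`: a
`k`-linear functor `F : M ⥤ M` and natural isomorphisms `s_{m,x} : F (m ⊗ x) ≅ F m ⊗ x` satisfying
the pentagon and the triangle axioms. -/
structure ModuleEnd where
  F : M ⥤ M
  additive : F.Additive
  linear : F.Linear k
  s : ∀ (m : M) (x : B), F.obj (m ⊙ᵣ x) ≅ F.obj m ⊙ᵣ x
  s_natural_left : ∀ {m n : M} (f : m ⟶ n) (x : B),
    F.map (f ⊵ᵣ x) ≫ (s n x).hom = (s m x).hom ≫ F.map f ⊵ᵣ x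
  s_natural_right : ∀ (m : M) {x y : B} (a : x ⟶ y),
    F.map (m ⊴ᵣ a) ≫ (s m y).hom = (s m x).hom ≫ F.obj m ⊴ᵣ a
  s_assoc : ∀ (m : M) (x y : B),
    (s m (x ⊗ y)).hom ≫ (αᵣ (F.obj m) x y).hom =
      F.map (αᵣ m x y).hom ≫ (s (m ⊙ᵣ x) y).hom ≫ (s m x).hom ⊵ᵣ y
  s_unit : ∀ m : M, (s m (𝟙_ B)).hom ≫ (ρᵣ (F.obj m)).hom = F.map (ρᵣ m).hom

namespace ModuleEnd

/-- Morphisms of module functors `(F, s) ⟶ (F', s')`: natural transformations `ε : F ⟶ F'` with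
`(ε_m ⊗ id_x) s_{m,x} = s'_{m,x} ε_{m ⊗ x}`. -/
@[ext]
structure Hom (P Q : ModuleEnd k B M) where
  ε : P.F ⟶ Q.F
  comm : ∀ (m : M) (x : B), ε.app (m ⊙ᵣ x) ≫ (Q.s m x).hom = (P.s m x).hom ≫ ε.app m ⊵ᵣ x

instance : Category (ModuleEnd k B M) where
  Hom := Hom
  id P := ⟨𝟙 _, fun m x => by simp⟩
  comp {P Q T} a b := ⟨a.ε ≫ b.ε, fun m x => by
    rw [NatTrans.comp_app, NatTrans.comp_app, Category.assoc, b.comm, ← Category.assoc, a.comm,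
      comp_actionHomLeft, Category.assoc]⟩
  id_comp a := Hom.ext (Category.id_comp _)
  comp_id a := Hom.ext (Category.comp_id _)
  assoc a b c := Hom.ext (Category.assoc _ _ _)

@[ext] theorem hom_ext {P Q : ModuleEnd k B M} {a b : P ⟶ Q} (h : ∀ m, a.ε.app m = b.ε.app m) :
    a = b := Hom.ext (NatTrans.ext (funext h))

@[simp] theorem id_ε (P : ModuleEnd k B M) : Hom.ε (𝟙 P) = 𝟙 P.F := rfl

@[simp] theorem comp_ε {P Q T : ModuleEnd k B M} (a : P ⟶ Q) (b : Q ⟶ T) :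
    (a ≫ b).ε = a.ε ≫ b.ε := rfl

instance (P : ModuleEnd k B M) : P.F.Additive := P.additive

instance (P : ModuleEnd k B M) : P.F.Linear k := P.linear

/-- An isomorphism of module functors from one of the underlying functors. -/
@[simps] def mkIso {P Q : ModuleEnd k B M} (e : P.F ≅ Q.F)
    (h : ∀ (m : M) (x : B), e.hom.app (m ⊙ᵣ x) ≫ (Q.s m x).hom = (P.s m x).hom ≫ e.hom.app m ⊵ᵣ x) :
    P ≅ Q where
  hom := ⟨e.hom, h⟩
  inv := ⟨e.inv, fun m x => by
    have h1 : e.hom.app m ⊵ᵣ x ≫ e.inv.app m ⊵ᵣ x = 𝟙 _ := by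
      rw [← comp_actionHomLeft]; simp
    rw [← cancel_epi (e.hom.app (m ⊙ᵣ x)), Iso.hom_inv_id_app_assoc, ← Category.assoc, h,
      Category.assoc, h1, Category.comp_id]⟩
  hom_inv_id := by ext; simp
  inv_hom_id := by ext; simp

/-! The `k`-linear structure on morphisms. -/

section Linear

variable [IsLinearAction k B M]

/-- Morphisms of module functors as a subspace of the natural transformations. -/
def homEquiv (P Q : ModuleEnd k B M) :
    (P ⟶ Q) ≃ ({ carrier := {ε | ∀ (m : M) (x : B),
                    ε.app (m ⊙ᵣ x) ≫ (Q.s m x).hom = (P.s m x).hom ≫ ε.app m ⊵ᵣ x}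
                 zero_mem' := fun m x => by
                    have h : (0 : P.F.obj m ⟶ Q.F.obj m) ⊵ᵣ x = 0 := by
                      simpa using IsLinearAction.actionHomLeft_smul (0 : k)
                        (0 : P.F.obj m ⟶ Q.F.obj m) x
                    change 0 ≫ _ = _ ≫ 0 ⊵ᵣ x
                    rw [h, zero_comp, comp_zero]
                 add_mem' := fun {a b} ha hb m x => by
                    rw [NatTrans.app_add, NatTrans.app_add, IsLinearAction.actionHomLeft_add k,
                      Preadditive.add_comp, Preadditive.comp_add, ha, hb]
                 smul_mem' := fun c a ha m x => by
                    rw [NatTrans.app_smul, NatTrans.app_smul, IsLinearAction.actionHomLeft_smul,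
                      Linear.smul_comp, Linear.comp_smul, ha] } :
      Submodule k (P.F ⟶ Q.F)) where
  toFun a := ⟨a.ε, a.comm⟩
  invFun a := ⟨a.1, a.2⟩
  left_inv _ := rfl
  right_inv _ := rfl

instance (P Q : ModuleEnd k B M) : AddCommGroup (P ⟶ Q) := (homEquiv P Q).addCommGroup

instance (P Q : ModuleEnd k B M) : Module k (P ⟶ Q) := (homEquiv P Q).module k

theorem add_ε {P Q : ModuleEnd k B M} (a b : P ⟶ Q) : (a + b).ε = a.ε + b.ε := rfl

theorem smul_ε {P Q : ModuleEnd k B M} (c : k) (a : P ⟶ Q) : (c • a).ε = c • a.ε := rfl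

instance : Preadditive (ModuleEnd k B M) where
  add_comp _ _ _ a b c := Hom.ext (Preadditive.add_comp _ _ _ _ _ _)
  comp_add _ _ _ a b c := Hom.ext (Preadditive.comp_add _ _ _ _ _ _)

instance : Linear k (ModuleEnd k B M) where
  smul_comp _ _ _ c a b := Hom.ext (Linear.smul_comp _ _ _ _ _ _)
  comp_smul _ _ _ a c b := Hom.ext (Linear.comp_smul _ _ _ _ _ _)

end Linear

/-! The tensor product of `(F, s)` and `(F', s')` is the composition `F ∘ F'`. -/

section Monoidal

/-- The composition `F ∘ F'` with the isomorphisms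
`F (F' (m ⊗ x)) ≅ F (F' m ⊗ x) ≅ F (F' m) ⊗ x`. -/
def tensor (P Q : ModuleEnd k B M) : ModuleEnd k B M where
  F := Q.F ⋙ P.F
  additive := inferInstance
  linear := inferInstance
  s m x := P.F.mapIso (Q.s m x) ≪≫ P.s (Q.F.obj m) x
  s_natural_left f x := by
    simp only [Functor.comp_obj, Functor.comp_map, Iso.trans_hom, Functor.mapIso_hom]
    rw [← Functor.map_comp_assoc, Q.s_natural_left, Functor.map_comp, Category.assoc,
      P.s_natural_left, Category.assoc]
  s_natural_right m x y a := by
    simp only [Functor.comp_obj, Functor.comp_map, Iso.trans_hom, Functor.mapIso_hom]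
    rw [← Functor.map_comp_assoc, Q.s_natural_right, Functor.map_comp, Category.assoc,
      P.s_natural_right, Category.assoc]
  s_assoc m x y := by
    simp only [Functor.comp_obj, Functor.comp_map, Iso.trans_hom, Functor.mapIso_hom, Category.assoc]
    rw [P.s_assoc, ← Functor.map_comp_assoc, Q.s_assoc, comp_actionHomLeft]
    simp only [Functor.map_comp, Category.assoc]
    rw [← Category.assoc (P.F.map ((Q.s m x).hom ⊵ᵣ y)), P.s_natural_left, Category.assoc]
  s_unit m := by
    simp only [Functor.comp_obj, Functor.comp_map, Iso.trans_hom, Functor.mapIso_hom, Category.assoc]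
    rw [P.s_unit, ← Functor.map_comp, Q.s_unit]

variable (k B M) in
/-- The identity functor. -/
def unit : ModuleEnd k B M where
  F := 𝟭 M
  additive := inferInstance
  linear := inferInstance
  s m x := Iso.refl _
  s_natural_left f x := by simp
  s_natural_right m x y a := by simp
  s_assoc m x y := by simp
  s_unit m := by simp

instance : MonoidalCategoryStruct (ModuleEnd k B M) where
  tensorObj := tensor
  tensorUnit := unit k B M
  whiskerLeft P {Q Q'} b := ⟨Functor.whiskerRight b.ε P.F, fun m x => by
    change P.F.map (b.ε.app (m ⊙ᵣ x)) ≫ P.F.map (Q'.s m x).hom ≫ (P.s (Q'.F.obj m) x).hom =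
      (P.F.map (Q.s m x).hom ≫ (P.s (Q.F.obj m) x).hom) ≫ P.F.map (b.ε.app m) ⊵ᵣ x
    rw [← Functor.map_comp_assoc, b.comm, Functor.map_comp, Category.assoc, P.s_natural_left,
      Category.assoc]⟩
  whiskerRight {P P'} a Q := ⟨Functor.whiskerLeft Q.F a.ε, fun m x => by
    change a.ε.app (Q.F.obj (m ⊙ᵣ x)) ≫ P'.F.map (Q.s m x).hom ≫ (P'.s (Q.F.obj m) x).hom =
      (P.F.map (Q.s m x).hom ≫ (P.s (Q.F.obj m) x).hom) ≫ a.ε.app (Q.F.obj m) ⊵ᵣ x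
    rw [Category.assoc, ← a.comm, NatTrans.naturality_assoc]⟩
  associator P Q R := mkIso (Functor.associator R.F Q.F P.F).symm fun m x => by
    change 𝟙 _ ≫ P.F.map (Q.F.map (R.s m x).hom ≫ (Q.s (R.F.obj m) x).hom) ≫
        (P.s (Q.F.obj (R.F.obj m)) x).hom =
      (P.F.map (Q.F.map (R.s m x).hom) ≫ P.F.map (Q.s (R.F.obj m) x).hom ≫
        (P.s (Q.F.obj (R.F.obj m)) x).hom) ≫ 𝟙 _ ⊵ᵣ x
    simp
  leftUnitor P := mkIso P.F.rightUnitor fun m x => by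
    change 𝟙 _ ≫ (P.s m x).hom = ((P.s m x).hom ≫ 𝟙 _) ≫ 𝟙 _ ⊵ᵣ x
    simp
  rightUnitor P := mkIso P.F.leftUnitor fun m x => by
    change 𝟙 _ ≫ (P.s m x).hom = (P.F.map (𝟙 _) ≫ (P.s m x).hom) ≫ 𝟙 _ ⊵ᵣ x
    simp

@[simp] theorem tensorObj_F (P Q : ModuleEnd k B M) : (P ⊗ Q).F = Q.F ⋙ P.F := rfl

@[simp] theorem whiskerLeft_app (P : ModuleEnd k B M) {Q Q' : ModuleEnd k B M} (b : Q ⟶ Q') (m : M) :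
    (P ◁ b).ε.app m = P.F.map (b.ε.app m) := rfl

@[simp] theorem whiskerRight_app {P P' : ModuleEnd k B M} (a : P ⟶ P') (Q : ModuleEnd k B M) (m : M) :
    (a ▷ Q).ε.app m = a.ε.app (Q.F.obj m) := rfl

@[simp] theorem tensorHom_app {P P' Q Q' : ModuleEnd k B M} (a : P ⟶ P') (b : Q ⟶ Q') (m : M) :
    (a ⊗ₘ b).ε.app m = a.ε.app (Q.F.obj m) ≫ P'.F.map (b.ε.app m) := rfl

@[simp] theorem associator_app (P Q R : ModuleEnd k B M) (m : M) :
    (α_ P Q R).hom.ε.app m = 𝟙 _ := rfl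

@[simp] theorem leftUnitor_app (P : ModuleEnd k B M) (m : M) : (λ_ P).hom.ε.app m = 𝟙 _ := rfl

@[simp] theorem rightUnitor_app (P : ModuleEnd k B M) (m : M) : (ρ_ P).hom.ε.app m = 𝟙 _ := rfl

instance : MonoidalCategory (ModuleEnd k B M) where
  tensorHom_def a b := rfl
  id_tensorHom_id P Q := by
    ext m
    change 𝟙 _ ≫ P.F.map (𝟙 _) = 𝟙 _
    simp
  tensorHom_comp_tensorHom {P₁ Q₁ R₁ P₂ Q₂ R₂} a b c d := by
    ext m
    change (a.ε.app (P₂.F.obj m) ≫ Q₁.F.map (b.ε.app m)) ≫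
        c.ε.app (Q₂.F.obj m) ≫ R₁.F.map (d.ε.app m) =
      (a.ε.app (P₂.F.obj m) ≫ c.ε.app (P₂.F.obj m)) ≫ R₁.F.map (b.ε.app m ≫ d.ε.app m)
    simp
  whiskerLeft_id P Q := by
    ext m
    exact P.F.map_id _
  id_whiskerRight P Q := rfl
  associator_naturality {P₁ P₂ P₃ Q₁ Q₂ Q₃} a b c := by
    ext m
    change ((a.ε.app (P₂.F.obj (P₃.F.obj m)) ≫ Q₁.F.map (b.ε.app (P₃.F.obj m))) ≫
        Q₁.F.map (Q₂.F.map (c.ε.app m))) ≫ 𝟙 _ =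
      𝟙 _ ≫ a.ε.app (P₂.F.obj (P₃.F.obj m)) ≫
        Q₁.F.map (b.ε.app (P₃.F.obj m) ≫ Q₂.F.map (c.ε.app m))
    simp
  leftUnitor_naturality {P Q} a := by
    ext m
    change a.ε.app m ≫ 𝟙 _ = 𝟙 _ ≫ a.ε.app m
    simp
  rightUnitor_naturality {P Q} a := by
    ext m
    change a.ε.app m ≫ 𝟙 _ = 𝟙 _ ≫ a.ε.app m
    simp
  pentagon P Q R T := by
    ext m
    change 𝟙 _ ≫ 𝟙 _ ≫ P.F.map (𝟙 _) = 𝟙 _ ≫ 𝟙 _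
    simp
  triangle P Q := by
    ext m
    change 𝟙 _ ≫ P.F.map (𝟙 _) = 𝟙 _
    simp

end Monoidal

end ModuleEnd

end ModuleEnd


namespace CrossedAction

variable {k C G Γ : Type*} [Field k] [Group G] [Group Γ] [Fintype Γ]
  [Category C] [Abelian C] [Linear k C] [MonoidalCategory C] {mp : MatchedPair G Γ}
  (A : CrossedAction k C mp)

/-! A chosen decomposition `M = ⨁ t, M_t` into homogeneous components. -/

/-- The homogeneous component `M_t`. -/
def part (M : C) : Γ → C := (A.exists_decomp M).choose

theorem part_mem (M : C) (t : Γ) : A.comp t (A.part M t) := (A.exists_decomp M).choose_spec.1 t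

/-- `M ≅ ⨁ t, M_t`. -/
def partIso (M : C) : M ≅ ⨁ A.part M := (A.exists_decomp M).choose_spec.2.some

/-- The inclusion `M_t ⟶ M`. -/
def ι (M : C) (t : Γ) : A.part M t ⟶ M := biproduct.ι (A.part M) t ≫ (A.partIso M).inv

/-- The projection `M ⟶ M_t`. -/
def π (M : C) (t : Γ) : M ⟶ A.part M t := (A.partIso M).hom ≫ biproduct.π (A.part M) t

theorem ι_π (M : C) (t : Γ) : A.ι M t ≫ A.π M t = 𝟙 _ := by
  simp [ι, π]

theorem ι_π_ne (M : C) {s t : Γ} (h : s ≠ t) : A.ι M s ≫ A.π M t = 0 :=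
  A.hom_eq_zero h (A.part_mem M s) (A.part_mem M t) _

theorem π_ι_sum (M : C) : ∑ t, A.π M t ≫ A.ι M t = 𝟙 M := by
  have h := IsBilimit.total (biproduct.isBilimit (A.part M))
  have h2 : (A.partIso M).hom ≫ (∑ t, biproduct.π (A.part M) t ≫ biproduct.ι (A.part M) t) ≫
      (A.partIso M).inv = 𝟙 M := by
    refine Eq.trans (congrArg (fun x => (A.partIso M).hom ≫ x ≫ (A.partIso M).inv) h) ?_
    exact (congrArg _ (Category.id_comp _)).trans (A.partIso M).hom_inv_id
  rw [Preadditive.sum_comp, Preadditive.comp_sum] at h2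
  simpa [ι, π] using h2

theorem comp_π_ι {M Y : C} {t : Γ} (hY : A.comp t Y) (f : Y ⟶ M) :
    f ≫ A.π M t ≫ A.ι M t = f := by
  conv_rhs => rw [← Category.comp_id f, ← A.π_ι_sum M, Preadditive.comp_sum]
  rw [Finset.sum_eq_single t]
  · intro s _ hs
    rw [← Category.assoc, A.hom_eq_zero hs.symm hY (A.part_mem M s) (f ≫ A.π M s), zero_comp]
  · simp

/-- An additive functor out of `C` sees only the components. -/
theorem functor_hom_ext {D : Type*} [Category D] [Preadditive D] (F : C ⥤ D) [F.Additive] {M : C}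
    {N : D} {a b : F.obj M ⟶ N} (h : ∀ t, F.map (A.ι M t) ≫ a = F.map (A.ι M t) ≫ b) : a = b := by
  have e : 𝟙 (F.obj M) = ∑ t, F.map (A.π M t) ≫ F.map (A.ι M t) := by
    rw [← F.map_id, ← A.π_ι_sum M, F.map_sum]
    simp
  rw [← Category.id_comp a, ← Category.id_comp b, e, Preadditive.sum_comp, Preadditive.sum_comp]
  exact Finset.sum_congr rfl fun t _ => by rw [Category.assoc, Category.assoc, h]

variable [MonoidalPreadditive C]

/-- For isomorphisms `u_g : U ◁ g ≅ U` (`g ∈ G`), the isomorphism `(U ⊗ M) ◁ g ≅ U ⊗ M ◁ g` which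
on the homogeneous component `M_t` is
`(u_{t ▶ g} ⊗ id) η^g_{U,M_t} : (U ⊗ M_t) ◁ g ≅ U ◁ (t ▶ g) ⊗ M_t ◁ g ≅ U ⊗ M_t ◁ g`. -/
def τ {U : C} (u : ∀ g, (A.act g).obj U ≅ U) (g : G) (M : C) :
    (A.act g).obj (U ⊗ M) ≅ U ⊗ (A.act g).obj M where
  hom := ∑ t, (A.act g).map (U ◁ A.π M t) ≫ (A.E rfl U (A.part_mem M t)).hom ≫
    ((u (mp.lact t g)).hom ⊗ₘ (A.act g).map (A.ι M t))
  inv := ∑ t, ((u (mp.lact t g)).inv ⊗ₘ (A.act g).map (A.π M t)) ≫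
    (A.E rfl U (A.part_mem M t)).inv ≫ (A.act g).map (U ◁ A.ι M t)
  hom_inv_id := by
    refine A.functor_hom_ext (tensorLeft U ⋙ A.act g) (M := M) fun s => ?_
    change (A.act g).map (U ◁ A.ι M s) ≫ (∑ t, (A.act g).map (U ◁ A.π M t) ≫
      (A.E rfl U (A.part_mem M t)).hom ≫
        ((u (mp.lact t g)).hom ⊗ₘ (A.act g).map (A.ι M t))) ≫ _ =
      (A.act g).map (U ◁ A.ι M s) ≫ 𝟙 _
    rw [Preadditive.sum_comp, Preadditive.comp_sum, Finset.sum_eq_single s]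
    · rw [← Category.assoc, ← Category.assoc, ← Functor.map_comp, ← whiskerLeft_comp, A.ι_π,
        whiskerLeft_id, CategoryTheory.Functor.map_id, Category.id_comp, Preadditive.comp_sum,
        Finset.sum_eq_single s]
      · rw [Category.assoc, tensorHom_comp_tensorHom_assoc, ← Functor.map_comp, A.ι_π]
        simp
      · intro t _ ht
        rw [Category.assoc, tensorHom_comp_tensorHom_assoc, ← Functor.map_comp, A.ι_π_ne _ ht.symm]
        simp
      · simp
    · intro t _ ht
      rw [← Category.assoc, ← Category.assoc, ← Functor.map_comp, ← whiskerLeft_comp,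
        A.ι_π_ne _ ht.symm]
      simp
    · simp
  inv_hom_id := by
    refine A.functor_hom_ext (A.act g ⋙ tensorLeft U) (M := M) fun s => ?_
    change U ◁ (A.act g).map (A.ι M s) ≫ (∑ t, ((u (mp.lact t g)).inv ⊗ₘ (A.act g).map (A.π M t)) ≫
      (A.E rfl U (A.part_mem M t)).inv ≫ (A.act g).map (U ◁ A.ι M t)) ≫ _ =
      U ◁ (A.act g).map (A.ι M s) ≫ 𝟙 _
    rw [Preadditive.sum_comp, Preadditive.comp_sum, Finset.sum_eq_single s]
    · rw [Category.assoc, ← id_tensorHom, tensorHom_comp_tensorHom_assoc, ← Functor.map_comp,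
        A.ι_π, Preadditive.comp_sum, Finset.sum_eq_single s]
      · rw [Category.assoc, ← Functor.map_comp_assoc, ← whiskerLeft_comp, A.ι_π]
        simp only [whiskerLeft_id, CategoryTheory.Functor.map_id, Category.id_comp,
          Iso.inv_hom_id_assoc, tensorHom_comp_tensorHom, Category.comp_id, Iso.inv_hom_id]
      · intro t _ ht
        rw [Category.assoc, ← Functor.map_comp_assoc, ← whiskerLeft_comp, A.ι_π_ne _ ht.symm]
        simp
      · simp
    · intro t _ ht
      rw [Category.assoc, ← id_tensorHom, tensorHom_comp_tensorHom_assoc, ← Functor.map_comp,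
        A.ι_π_ne _ ht.symm]
      simp
    · simp

theorem τ_hom_app {U : C} (u : ∀ g, (A.act g).obj U ≅ U) {g l : G} {M Y : C} {t : Γ}
    (w : mp.lact t g = l)
    (hY : A.comp t Y) (f : Y ⟶ M) :
    (A.act g).map (U ◁ f) ≫ (A.τ u g M).hom =
      (A.E w U hY).hom ≫ ((u l).hom ⊗ₘ (A.act g).map f) := by
  subst w
  simp only [τ, Preadditive.comp_sum]
  rw [Finset.sum_eq_single t]
  · rw [← Functor.map_comp_assoc, ← whiskerLeft_comp, A.E_natural_right_assoc rfl hY (A.part_mem M t),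
      ← id_tensorHom, tensorHom_comp_tensorHom, ← Functor.map_comp, Category.assoc,
      A.comp_π_ι hY f, Category.id_comp]
  · intro s _ hs
    rw [← Functor.map_comp_assoc, ← whiskerLeft_comp,
      A.hom_eq_zero hs.symm hY (A.part_mem M s) (f ≫ A.π M s)]
    simp
  · simp

/-- For `u_g : U ◁ g ≅ U` and `v_g : V ◁ g ≅ V` (`g ∈ G`), the isomorphisms
`w_g : (U ⊗ V) ◁ g ≅ U ⊗ V` given on `U ⊗ V_t` by `(u_{t ▶ g} ⊗ v_g) η^g_{U,V_t}`. -/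
def w {U V : C} (u : ∀ g, (A.act g).obj U ≅ U) (v : ∀ g, (A.act g).obj V ≅ V) (g : G) :
    (A.act g).obj (U ⊗ V) ≅ U ⊗ V :=
  A.τ u g V ≪≫ whiskerLeftIso U (v g)

section W

variable {U V W : C} (u : ∀ g, (A.act g).obj U ≅ U) (v : ∀ g, (A.act g).obj V ≅ V)
  (z : ∀ g, (A.act g).obj W ≅ W)

theorem w_app {g l : G} {t : Γ} {Y : C} (e : mp.lact t g = l) (hY : A.comp t Y)
    (f : Y ⟶ V) :
    (A.act g).map (U ◁ f) ≫ (A.w u v g).hom =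
      (A.E e U hY).hom ≫ ((u l).hom ⊗ₘ ((A.act g).map f ≫ (v g).hom)) := by
  rw [w, Iso.trans_hom, ← Category.assoc, A.τ_hom_app u e hY, Category.assoc,
    whiskerLeftIso_hom, ← id_tensorHom, tensorHom_comp_tensorHom, Category.comp_id]

theorem w_app' {g l : G} {t : Γ} {X Y : C} (e : mp.lact t g = l) (hY : A.comp t Y)
    (p : X ⟶ U) (f : Y ⟶ V) :
    (A.act g).map (p ⊗ₘ f) ≫ (A.w u v g).hom =
      (A.E e X hY).hom ≫ (((A.act l).map p ≫ (u l).hom) ⊗ₘ ((A.act g).map f ≫ (v g).hom)) := by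
  rw [MonoidalCategory.tensorHom_def, Functor.map_comp, Category.assoc, A.w_app u v e hY,
    A.E_natural_left_assoc, ← tensorHom_id, tensorHom_comp_tensorHom, Category.id_comp]

theorem hom_ext_tensor {D : Type*} [Category D] [Preadditive D] (F : C ⥤ D) [F.Additive] {U V : C}
    {N : D} {a b : F.obj (U ⊗ V) ⟶ N}
    (h : ∀ t, F.map (U ◁ A.ι V t) ≫ a = F.map (U ◁ A.ι V t) ≫ b) : a = b :=
  A.functor_hom_ext (tensorLeft U ⋙ F) (M := V) h

theorem hom_ext_tensor₃ {D : Type*} [Category D] [Preadditive D] (F : C ⥤ D) [F.Additive]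
    {U V W : C} {N : D} {a b : F.obj ((U ⊗ V) ⊗ W) ⟶ N}
    (h : ∀ s t, F.map ((U ◁ A.ι V s) ⊗ₘ A.ι W t) ≫ a = F.map ((U ◁ A.ι V s) ⊗ₘ A.ι W t) ≫ b) :
    a = b := by
  refine A.hom_ext_tensor F fun t => ?_
  refine A.functor_hom_ext (tensorLeft U ⋙ tensorRight (A.part W t) ⋙ F) (M := V) fun s => ?_
  have := h s t
  rw [MonoidalCategory.tensorHom_def, F.map_comp, Category.assoc, Category.assoc] at this
  exact this

theorem w_assoc (g : G) :
    (A.act g).map (α_ U V W).hom ≫ (A.w u (A.w v z) g).hom =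
      (A.w (A.w u v) z g).hom ≫ (α_ U V W).hom := by
  refine A.hom_ext_tensor₃ (A.act g) fun s t => ?_
  have hV := A.part_mem V s
  have hW := A.part_mem W t
  have e₁ := A.w_app' (A.w u v) z rfl hW (U ◁ A.ι V s) (A.ι W t) (g := g)
  have e₂ := A.w_app u v rfl hV (A.ι V s) (g := mp.lact t g)
  have e₃ := A.w_app u (A.w v z) (mp.mul_lact s t g) (A.comp_tensor hV hW)
    (A.ι V s ⊗ₘ A.ι W t) (g := g)
  have e₄ := A.w_app' v z rfl hW (A.ι V s) (A.ι W t) (g := g)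
  have e₅ := A.E_assoc U hV hW (rfl : mp.lact t g = _) rfl (mp.mul_lact s t g)
  have e₆ : ((U ◁ A.ι V s) ⊗ₘ A.ι W t) ≫ (α_ U V W).hom =
      (α_ _ _ _).hom ≫ U ◁ (A.ι V s ⊗ₘ A.ι W t) := by
    rw [← id_tensorHom, associator_naturality, id_tensorHom]
  rw [← Functor.map_comp_assoc, e₆, Functor.map_comp, Category.assoc, e₃, e₄, reassoc_of% e₁, e₂]
  have e₇ : ∀ {P P₁ P₂ Q Q₁ R R₁ : C} (a : P ⟶ P₁ ⊗ P₂) (b : P₁ ⟶ Q) (c : P₂ ⟶ Q₁) (d : R ⟶ R₁),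
      ((a ≫ (b ⊗ₘ c)) ⊗ₘ d) ≫ (α_ _ _ _).hom = a ▷ R ≫ (α_ _ _ _).hom ≫ (b ⊗ₘ (c ⊗ₘ d)) := by
    intros
    rw [← associator_naturality, ← tensorHom_id, tensorHom_comp_tensorHom_assoc, Category.id_comp]
  rw [e₇, reassoc_of% e₅, ← id_tensorHom, tensorHom_comp_tensorHom, Category.id_comp]

theorem w_leftUnit (g : G) :
    (A.act g).map (λ_ V).hom ≫ (v g).hom = (A.w A.η₀ v g).hom ≫ (λ_ V).hom := by
  refine A.hom_ext_tensor (A.act g) fun t => ?_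
  have hV := A.part_mem V t
  rw [reassoc_of% (A.w_app A.η₀ v rfl hV (A.ι V t)), ← Functor.map_comp_assoc,
    leftUnitor_naturality, Functor.map_comp,
    ← A.E_left_unit hV rfl, MonoidalCategory.tensorHom_def]
  simp only [Category.assoc, leftUnitor_naturality]

theorem w_rightUnit [IsFusionCategory k C] (g : G) :
    (A.act g).map (ρ_ U).hom ≫ (u g).hom = (A.w u A.η₀ g).hom ≫ (ρ_ U).hom := by
  have e₁ : (A.w u A.η₀ g).hom =
      (A.E (mp.one_lact g) U A.comp_one).hom ≫ ((u g).hom ⊗ₘ (A.η₀ g).hom) := by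
    have h := A.w_app u A.η₀ (mp.one_lact g) A.comp_one (𝟙 (𝟙_ C))
    rwa [whiskerLeft_id, CategoryTheory.Functor.map_id, CategoryTheory.Functor.map_id,
      Category.id_comp, Category.id_comp] at h
  rw [e₁, ← A.E_right_unit U A.comp_one (mp.one_lact g) rfl]
  simp only [castIso_rfl, Iso.refl_hom, id_tensorHom, Category.assoc, MonoidalCategory.tensorHom_def']
  simp

theorem w_mul
    (hu : ∀ {g h l : G} (e : g * h = l),
      (A.R e U).hom ≫ (u l).hom = (A.act h).map (u g).hom ≫ (u h).hom)
    (hv : ∀ {g h l : G} (e : g * h = l),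
      (A.R e V).hom ≫ (v l).hom = (A.act h).map (v g).hom ≫ (v h).hom) {g h l : G} (e : g * h = l) :
    (A.R e (U ⊗ V)).hom ≫ (A.w u v l).hom = (A.act h).map (A.w u v g).hom ≫ (A.w u v h).hom := by
  subst e
  refine A.hom_ext_tensor (A.act g ⋙ A.act h) fun t => ?_
  have hV := A.part_mem V t
  change (A.act h).map ((A.act g).map (U ◁ A.ι V t)) ≫ _ =
    (A.act h).map ((A.act g).map (U ◁ A.ι V t)) ≫ _
  rw [A.R_natural_assoc, A.w_app u v rfl hV, ← Functor.map_comp_assoc, A.w_app u v rfl hV,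
    Functor.map_comp, Category.assoc, A.w_app' u v rfl (A.comp_act g hV),
    A.E_mul_assoc U hV rfl rfl rfl rfl (mp.lact_mul _ _ _).symm, tensorHom_comp_tensorHom,
    hu, Functor.map_comp, Category.assoc, ← hv rfl, A.R_natural_assoc]

theorem w_whiskerLeft {V' : C} (v' : ∀ g, (A.act g).obj V' ≅ V') (b : V ⟶ V')
    (hb : ∀ g, (A.act g).map b ≫ (v' g).hom = (v g).hom ≫ b) (g : G) :
    (A.act g).map (U ◁ b) ≫ (A.w u v' g).hom = (A.w u v g).hom ≫ U ◁ b := by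
  refine A.hom_ext_tensor (A.act g) fun t => ?_
  have hV := A.part_mem V t
  rw [← Functor.map_comp_assoc, ← whiskerLeft_comp, A.w_app u v' rfl hV,
    reassoc_of% (A.w_app u v rfl hV (A.ι V t)), ← id_tensorHom, tensorHom_comp_tensorHom,
    Category.assoc, ← hb, Functor.map_comp, Category.assoc, Category.comp_id]

theorem w_whiskerRight {U' : C} (u' : ∀ g, (A.act g).obj U' ≅ U') (a : U ⟶ U')
    (ha : ∀ g, (A.act g).map a ≫ (u' g).hom = (u g).hom ≫ a) (g : G) :
    (A.act g).map (a ▷ V) ≫ (A.w u' v g).hom = (A.w u v g).hom ≫ a ▷ V := by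
  refine A.hom_ext_tensor (A.act g) fun t => ?_
  have hV := A.part_mem V t
  rw [← Functor.map_comp_assoc, ← tensorHom_def', A.w_app' u' v rfl hV,
    reassoc_of% (A.w_app u v rfl hV (A.ι V t)), ← tensorHom_id, tensorHom_comp_tensorHom, ha,
    Category.comp_id]

end W

/-- Objects of the crossed extension `C^{(G,Γ)}`: objects `U` with isomorphisms `u_g : U ◁ g ≅ U`
such that `u_{gh} R²_{g,h} = u_h (u_g ◁ h)`. -/
structure CrossedExt where
  U : C
  u : ∀ g, (A.act g).obj U ≅ U
  u_mul : ∀ g h, (A.mulIso g h).hom.app U ≫ (u (g * h)).hom = (A.act h).map (u g).hom ≫ (u h).hom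

namespace CrossedExt

variable {A}

/-- Equivariant morphisms: `f : U ⟶ V` with `v_g (f ◁ g) = f u_g`. -/
@[ext]
structure Hom (X Y : CrossedExt A) where
  f : X.U ⟶ Y.U
  comm : ∀ g, (A.act g).map f ≫ (Y.u g).hom = (X.u g).hom ≫ f

instance : Category (CrossedExt A) where
  Hom := Hom
  id X := ⟨𝟙 _, fun g => by simp⟩
  comp a b := ⟨a.f ≫ b.f, fun g => by
    rw [Functor.map_comp, Category.assoc, b.comm, ← Category.assoc, a.comm, Category.assoc]⟩
  id_comp a := Hom.ext (Category.id_comp _)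
  comp_id a := Hom.ext (Category.comp_id _)
  assoc a b c := Hom.ext (Category.assoc _ _ _)

@[ext] theorem hom_ext {X Y : CrossedExt A} {a b : X ⟶ Y} (h : a.f = b.f) : a = b := Hom.ext h

variable (A) in
/-- The forgetful functor to `C`. -/
@[simps] def forget : CrossedExt A ⥤ C where
  obj X := X.U
  map a := a.f

instance : (forget A).Faithful where
  map_injective h := hom_ext h

/-- Equivariant morphisms as a subspace of the morphisms in `C`. -/
def homEquiv (X Y : CrossedExt A) :
    (X ⟶ Y) ≃ ({ carrier := {f | ∀ g, (A.act g).map f ≫ (Y.u g).hom = (X.u g).hom ≫ f}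
                 zero_mem' := fun g => by simp
                 add_mem' := fun {a b} ha hb g => by
                    rw [Functor.map_add, Preadditive.add_comp, Preadditive.comp_add, ha, hb]
                 smul_mem' := fun c a ha g => by
                    rw [Functor.map_smul, Linear.smul_comp, Linear.comp_smul, ha] } :
      Submodule k (X.U ⟶ Y.U)) where
  toFun a := ⟨a.f, a.comm⟩
  invFun a := ⟨a.1, a.2⟩
  left_inv _ := rfl
  right_inv _ := rfl

instance (X Y : CrossedExt A) : AddCommGroup (X ⟶ Y) := (homEquiv X Y).addCommGroup

instance (X Y : CrossedExt A) : Module k (X ⟶ Y) := (homEquiv X Y).module k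

instance : Preadditive (CrossedExt A) where
  add_comp _ _ _ a b c := Hom.ext (Preadditive.add_comp _ _ _ _ _ _)
  comp_add _ _ _ a b c := Hom.ext (Preadditive.comp_add _ _ _ _ _ _)

instance : Linear k (CrossedExt A) where
  smul_comp _ _ _ c a b := Hom.ext (Linear.smul_comp _ _ _ _ _ _)
  comp_smul _ _ _ a c b := Hom.ext (Linear.comp_smul _ _ _ _ _ _)

theorem u_R (X : CrossedExt A) {g h l : G} (w : g * h = l) :
    (A.R w X.U).hom ≫ (X.u l).hom = (A.act h).map (X.u g).hom ≫ (X.u h).hom := by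
  subst w
  simpa [R] using X.u_mul g h

/-- An isomorphism in `C` which is equivariant. -/
@[simps] def mkIso {X Y : CrossedExt A} (e : X.U ≅ Y.U)
    (h : ∀ g, (A.act g).map e.hom ≫ (Y.u g).hom = (X.u g).hom ≫ e.hom) : X ≅ Y where
  hom := ⟨e.hom, h⟩
  inv := ⟨e.inv, fun g => by
    rw [← cancel_epi ((A.act g).map e.hom), ← Functor.map_comp_assoc, Iso.hom_inv_id,
      CategoryTheory.Functor.map_id, Category.id_comp, ← Category.assoc, h, Category.assoc, Iso.hom_inv_id,
      Category.comp_id]⟩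
  hom_inv_id := Hom.ext e.hom_inv_id
  inv_hom_id := Hom.ext e.inv_hom_id

/-- The tensor product `(U, u) ⊗ (V, v) = (U ⊗ V, w)`. -/
def tensor (X Y : CrossedExt A) : CrossedExt A where
  U := X.U ⊗ Y.U
  u := A.w X.u Y.u
  u_mul g h := by
    simpa [R] using A.w_mul X.u Y.u (u_R X) (u_R Y) (rfl : g * h = _)

variable (A) in
/-- The unit object `(1, η₀)`. -/
def unit : CrossedExt A where
  U := 𝟙_ C
  u := A.η₀
  u_mul := A.η₀_mul

variable [IsFusionCategory k C]

instance : MonoidalCategoryStruct (CrossedExt A) where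
  tensorObj := tensor
  tensorUnit := unit A
  whiskerLeft X _ _ b := ⟨X.U ◁ b.f, A.w_whiskerLeft X.u _ _ b.f b.comm⟩
  whiskerRight a Y := ⟨a.f ▷ Y.U, A.w_whiskerRight _ Y.u _ a.f a.comm⟩
  associator X Y Z := mkIso (α_ X.U Y.U Z.U) (A.w_assoc X.u Y.u Z.u)
  leftUnitor Y := mkIso (λ_ Y.U) (A.w_leftUnit Y.u)
  rightUnitor X := mkIso (ρ_ X.U) (A.w_rightUnit X.u)

instance : MonoidalCategory (CrossedExt A) :=
  Monoidal.induced (forget A)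
    { μIso := fun X Y => Iso.refl (X.U ⊗ Y.U)
      εIso := Iso.refl (𝟙_ C)
      whiskerLeft_eq := fun X {Y Y'} b => by
        change X.U ◁ b.f = 𝟙 _ ≫ X.U ◁ b.f ≫ 𝟙 _
        simp
      whiskerRight_eq := fun {X X'} a Y => by
        change a.f ▷ Y.U = 𝟙 _ ≫ a.f ▷ Y.U ≫ 𝟙 _
        simp
      tensorHom_eq := fun {X X' Y Y'} a b => by
        change a.f ▷ Y.U ≫ X'.U ◁ b.f = 𝟙 _ ≫ (a.f ⊗ₘ b.f) ≫ 𝟙 _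
        simp [MonoidalCategory.tensorHom_def]
      associator_eq := fun X Y Z => by
        change (α_ X.U Y.U Z.U).hom = (𝟙 _ ≫ (𝟙 _ ⊗ₘ 𝟙 _)) ≫ (α_ X.U Y.U Z.U).hom ≫
          (𝟙 _ ⊗ₘ 𝟙 _) ≫ 𝟙 _
        simp
      leftUnitor_eq := fun Y => by
        change (λ_ Y.U).hom = (𝟙 _ ≫ (𝟙 _ ⊗ₘ 𝟙 _)) ≫ (λ_ Y.U).hom
        simp
      rightUnitor_eq := fun X => by
        change (ρ_ X.U).hom = (𝟙 _ ≫ (𝟙 _ ⊗ₘ 𝟙 _)) ≫ (ρ_ X.U).hom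
        simp }

end CrossedExt

end CrossedAction

section ExtendRestrict

open MonoidalRightAction CategoryTheory.Mat_

variable {k : Type*} [Field k] {B D : Type*} [Category B] [Preadditive B] [MonoidalCategory B]
  [MonoidalPreadditive B] [Category D] [Preadditive D] [Linear k D] [HasFiniteBiproducts D]
  [MonoidalRightAction B D] [IsBiadditiveAction B D]

instance [IsLinearAction k B D] : IsLinearAction k (Mat_ B) D where
  actionHomLeft_add f g X := by
    change mActL (f + g) X = mActL f X + mActL g X
    refine biproduct.hom_ext' _ _ fun i => ?_
    rw [Preadditive.comp_add, ι_mActL, ι_mActL, ι_mActL, IsBiadditiveAction.actionHomLeft_add,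
      Preadditive.add_comp]
  actionHomLeft_smul c m n f X := by
    change mActL (c • f) X = c • mActL f X
    refine biproduct.hom_ext' _ _ fun i => ?_
    rw [Linear.comp_smul, ι_mActL, ι_mActL, IsLinearAction.actionHomLeft_smul, Linear.smul_comp]

namespace CategoryTheory.Mat_

/-- An object of `B` as a one-entry family. -/
abbrev single (x : B) : Mat_ B := ⟨PUnit, fun _ => x⟩

/-- `m ⊗ (x) ≅ m ⊗ x`: a direct sum with one summand. -/
def actSingle (m : D) (x : B) : m ⊙ᵣ single x ≅ m ⊙ᵣ x where
  hom := biproduct.π (fun _ : PUnit => m ⊙ᵣ x) PUnit.unit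
  inv := biproduct.ι (fun _ : PUnit => m ⊙ᵣ x) PUnit.unit
  hom_inv_id := by
    refine biproduct.hom_ext' _ _ fun ⟨⟩ => ?_
    rw [biproduct.ι_π_self_assoc]
    exact (Category.comp_id _).symm
  inv_hom_id := biproduct.ι_π_self _ _

theorem ι_actSingle (m : D) (x : B) (i : PUnit) :
    biproduct.ι (fun _ : PUnit => m ⊙ᵣ x) i ≫ (actSingle m x).hom = 𝟙 _ :=
  biproduct.ι_π_self _ _

theorem actSingle_natural_left {m n : D} (f : m ⟶ n) (x : B) :
    f ⊵ᵣ single x ≫ (actSingle n x).hom = (actSingle m x).hom ≫ f ⊵ᵣ x := by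
  change mActL f (single x) ≫ _ = _
  refine biproduct.hom_ext' _ _ fun i => ?_
  rw [reassoc_of% (ι_mActL f (single x) i)]
  erw [ι_actSingle, reassoc_of% (ι_actSingle m x i)]
  rw [Category.comp_id]

theorem actSingle_natural_right (m : D) {x y : B} (a : x ⟶ y) :
    m ⊴ᵣ (diag (X := single x) (Y := single y) id fun _ => a) ≫ (actSingle m y).hom =
      (actSingle m x).hom ≫ m ⊴ᵣ a := by
  change mActR m _ ≫ _ = _
  refine biproduct.hom_ext' _ _ fun i => ?_
  rw [reassoc_of% (mActR_diag m (X := single x) (Y := single y) id (fun _ => a) i)]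
  erw [ι_actSingle, reassoc_of% (ι_actSingle m x i)]
  rw [Category.comp_id]

theorem actSingle_assoc (m : D) (x y : B) :
    m ⊴ᵣ (diag (X := single x ⊗ single y) (Y := single (x ⊗ y)) (fun _ => PUnit.unit)
        fun _ => 𝟙 (x ⊗ y)) ≫ (actSingle m (x ⊗ y)).hom ≫ (αᵣ m x y).hom =
      (αᵣ m (single x) (single y)).hom ≫ (actSingle (m ⊙ᵣ single x) y).hom ≫
        (actSingle m x).hom ⊵ᵣ y := by
  change mActR m _ ≫ _ = (mAssoc m (single x) (single y)).hom ≫ _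
  refine biproduct.hom_ext' _ _ fun ⟨i, j⟩ => ?_
  erw [reassoc_of% (mActR_diag m (X := tObj (single x) (single y)) (Y := single (x ⊗ y))
    (fun _ => PUnit.unit) (fun _ => 𝟙 (x ⊗ y)) (i, j)),
    reassoc_of% (ι_mAssoc_hom m (single x) (single y) i j)]
  erw [reassoc_of% (ι_actSingle m (x ⊗ y) PUnit.unit),
    reassoc_of% (ι_actSingle (m ⊙ᵣ single x) y j), ← comp_actionHomLeft, ι_actSingle]
  simp

theorem actSingle_unit (m : D) :
    (actSingle m (𝟙_ B)).hom ≫ (ρᵣ m).hom = (ρᵣ[Mat_ B] m).hom := by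
  change _ = (mUnit m).hom
  refine biproduct.hom_ext' _ _ fun i => ?_
  erw [reassoc_of% (ι_actSingle m (𝟙_ B) i)]
  rw [mUnit, biproduct.ι_desc]

end CategoryTheory.Mat_

namespace ModuleEnd

/-- A module functor over the additive envelope of `B` is a module functor over `B`. -/
def restrict (P : ModuleEnd k (Mat_ B) D) : ModuleEnd k B D where
  F := P.F
  additive := P.additive
  linear := P.linear
  s m x := P.F.mapIso (actSingle m x).symm ≪≫ P.s m (single x) ≪≫ actSingle (P.F.obj m) x
  s_natural_left {m n} f x := by
    simp only [Iso.trans_hom, Functor.mapIso_hom, Iso.symm_hom, Category.assoc]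
    rw [← actSingle_natural_left, ← reassoc_of% (P.s_natural_left f (single x)),
      ← Functor.map_comp_assoc, ← Functor.map_comp_assoc]
    congr 2
    rw [Iso.eq_inv_comp, ← reassoc_of% (actSingle_natural_left f x), Iso.hom_inv_id,
      Category.comp_id]
  s_natural_right m x y a := by
    simp only [Iso.trans_hom, Functor.mapIso_hom, Iso.symm_hom, Category.assoc]
    rw [← actSingle_natural_right, ← reassoc_of% (P.s_natural_right m _),
      ← Functor.map_comp_assoc, ← Functor.map_comp_assoc]
    congr 2
    rw [Iso.eq_inv_comp, ← reassoc_of% (actSingle_natural_right m a), Iso.hom_inv_id,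
      Category.comp_id]
  s_assoc m x y := by
    simp only [Iso.trans_hom, Functor.mapIso_hom, Iso.symm_hom, Category.assoc]
    let φ : single x ⊗ single y ⟶ single (x ⊗ y) :=
      diag (X := single x ⊗ single y) (Y := single (x ⊗ y)) (fun _ => PUnit.unit)
        fun _ => 𝟙 (x ⊗ y)
    let ψ : single (x ⊗ y) ⟶ single x ⊗ single y :=
      diag (X := single (x ⊗ y)) (Y := single x ⊗ single y) (fun _ => (PUnit.unit, PUnit.unit))
        fun _ => 𝟙 (x ⊗ y)
    have h₁ : ∀ n : D, n ⊴ᵣ φ ≫ (actSingle n (x ⊗ y)).hom ≫ (αᵣ n x y).hom =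
      (αᵣ n (single x) (single y)).hom ≫ (actSingle (n ⊙ᵣ single x) y).hom ≫
        (actSingle n x).hom ⊵ᵣ y := fun n => actSingle_assoc n x y
    have h₂ : ∀ n : D, n ⊴ᵣ ψ ≫ n ⊴ᵣ φ = 𝟙 _ := fun n => by
      rw [← actionHomRight_comp, ← actionHomRight_id]
      congr 1
      refine (diag_comp_diag (X := single (x ⊗ y)) (Y := single x ⊗ single y)
        (Z := single (x ⊗ y)) _ _ _ _).trans ?_
      rw [id_eq_diag]
      exact diag_congr (X := single (x ⊗ y)) (Y := single (x ⊗ y)) id fun _ => Category.comp_id _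
    have h₃ : (actSingle (P.F.obj m) (x ⊗ y)).hom ≫ (αᵣ (P.F.obj m) x y).hom =
        P.F.obj m ⊴ᵣ ψ ≫ (αᵣ (P.F.obj m) (single x) (single y)).hom ≫
          (actSingle (P.F.obj m ⊙ᵣ single x) y).hom ≫ (actSingle (P.F.obj m) x).hom ⊵ᵣ y := by
      rw [← h₁, reassoc_of% (h₂ (P.F.obj m))]
    have h₄ : P.F.map (actSingle m (x ⊗ y)).inv ≫ P.F.map (m ⊴ᵣ ψ) ≫
        P.F.map (αᵣ m (single x) (single y)).hom =
        P.F.map (αᵣ m x y).hom ≫ P.F.map ((actSingle m x).inv ⊵ᵣ y) ≫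
          P.F.map (actSingle (m ⊙ᵣ single x) y).inv := by
      simp only [← Functor.map_comp]
      congr 1
      have h₅ : (actSingle m x).hom ⊵ᵣ y ≫ (actSingle m x).inv ⊵ᵣ y = 𝟙 _ := by
        rw [← comp_actionHomLeft, Iso.hom_inv_id, id_actionHomLeft]
      rw [Iso.inv_comp_eq, ← cancel_mono (actSingle (m ⊙ᵣ single x) y).hom,
        ← cancel_mono ((actSingle m x).hom ⊵ᵣ y)]
      have h₆ : (actSingle m x).inv ⊵ᵣ y ≫ (actSingle m x).hom ⊵ᵣ y = 𝟙 _ := by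
        rw [← comp_actionHomLeft, Iso.inv_hom_id, id_actionHomLeft]
      simp only [Category.assoc, Iso.inv_hom_id_assoc]
      rw [← h₁, reassoc_of% (h₂ m), h₆, Category.comp_id]
    have h₇ := actSingle_natural_left (P.s m (single x)).hom y
    have h₈ := actSingle_natural_left (P.F.map (actSingle m x).inv) y
    have h₉ := P.s_natural_left (actSingle m x).inv (single y)
    have h₁₀ : P.F.map ((actSingle m x).inv ⊵ᵣ y) ≫ P.F.map (actSingle (m ⊙ᵣ single x) y).inv =
        P.F.map (actSingle (m ⊙ᵣ x) y).inv ≫ P.F.map ((actSingle m x).inv ⊵ᵣ single y) := by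
      rw [← Functor.map_comp, ← Functor.map_comp]
      congr 1
      rw [Iso.comp_inv_eq, Category.assoc, actSingle_natural_left, Iso.inv_hom_id_assoc]
    rw [h₃, ← reassoc_of% (P.s_natural_right m ψ), reassoc_of% (P.s_assoc m (single x) (single y)),
      reassoc_of% h₄, comp_actionHomLeft, comp_actionHomLeft, reassoc_of% h₁₀, reassoc_of% h₉,
      ← reassoc_of% h₈, ← reassoc_of% h₇]
  s_unit m := by
    simp only [Iso.trans_hom, Functor.mapIso_hom, Iso.symm_hom, Category.assoc]
    rw [actSingle_unit]
    erw [P.s_unit]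
    rw [← actSingle_unit, ← Functor.map_comp, Iso.inv_hom_id_assoc]

theorem map_biproduct_hom_ext {J : Type} [Finite J] (F : D ⥤ D) [F.Additive] {f : J → D} {N : D}
    {a b : F.obj (⨁ f) ⟶ N}
    (h : ∀ i, F.map (biproduct.ι f i) ≫ a = F.map (biproduct.ι f i) ≫ b) : a = b := by
  rw [← cancel_epi (F.mapBiproduct f).inv, F.mapBiproduct_inv]
  refine biproduct.hom_ext' _ _ fun i => ?_
  rw [biproduct.ι_desc_assoc, biproduct.ι_desc_assoc]
  exact h i

/-- `F (m ⊗ (x_i)) = F (⨁ i, m ⊗ x_i) ≅ ⨁ i, F (m ⊗ x_i) ≅ ⨁ i, F m ⊗ x_i`. -/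
def extendIso (P : ModuleEnd k B D) (m : D) (X : Mat_ B) :
    P.F.obj (m ⊙ᵣ X) ≅ P.F.obj m ⊙ᵣ X :=
  P.F.mapBiproduct (fun i => m ⊙ᵣ X.X i) ≪≫ biproduct.mapIso fun i => P.s m (X.X i)

theorem ι_extend (P : ModuleEnd k B D) (m : D) (X : Mat_ B) (i : X.ι) :
    P.F.map (biproduct.ι (fun i => m ⊙ᵣ X.X i) i) ≫ (P.extendIso m X).hom =
      (P.s m (X.X i)).hom ≫ biproduct.ι (fun i => P.F.obj m ⊙ᵣ X.X i) i := by
  have h : P.F.map (biproduct.ι (fun i => m ⊙ᵣ X.X i) i) =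
      biproduct.ι _ i ≫ (P.F.mapBiproduct (fun i => m ⊙ᵣ X.X i)).inv := by
    rw [P.F.mapBiproduct_inv, biproduct.ι_desc]
  rw [extendIso, h, Iso.trans_hom, Category.assoc, Iso.inv_hom_id_assoc, biproduct.mapIso_hom]
  exact biproduct.ι_map _ _

/-- A module functor over `B` extends to the additive envelope, by additivity. -/
def extend (P : ModuleEnd k B D) : ModuleEnd k (Mat_ B) D where
  F := P.F
  additive := P.additive
  linear := P.linear
  s m X := P.extendIso m X
  s_natural_left {m n} f X := by
    refine map_biproduct_hom_ext P.F fun i => ?_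
    rw [← Functor.map_comp_assoc]
    erw [ι_mActL f X i]
    rw [Functor.map_comp, Category.assoc, ι_extend, reassoc_of% (P.s_natural_left f (X.X i)),
      reassoc_of% (ι_extend P m X i)]
    erw [ι_mActL]
  s_natural_right m X Y a := by
    refine map_biproduct_hom_ext P.F fun i => ?_
    rw [← Functor.map_comp_assoc, reassoc_of% (ι_extend P m X i)]
    erw [ι_mActR, ι_mActR]
    rw [Functor.map_sum, Preadditive.sum_comp, Preadditive.comp_sum]
    refine Finset.sum_congr rfl fun j _ => ?_
    rw [Functor.map_comp, Category.assoc, ι_extend, reassoc_of% (P.s_natural_right m (a i j))]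
  s_assoc m X Y := by
    refine map_biproduct_hom_ext P.F fun ⟨i, j⟩ => ?_
    erw [reassoc_of% (ι_extend P m (tObj X Y) (i, j))]
    rw [← Functor.map_comp_assoc]
    erw [ι_mAssoc_hom, ι_mAssoc_hom]
    rw [reassoc_of% (P.s_assoc m (X.X i) (Y.X j))]
    rw [Functor.map_comp, Functor.map_comp, Category.assoc, Category.assoc]
    erw [reassoc_of% (ι_extend P (mAct m X) Y j), ι_mActL]
    have h := congrArg (fun f => f ⊵ᵣ Y.X j) (ι_extend P m X i)
    simp only [comp_actionHomLeft] at h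
    rw [reassoc_of% (P.s_natural_left _ (Y.X j))]
    erw [reassoc_of% h]
    rfl
  s_unit m := by
    refine map_biproduct_hom_ext P.F fun i => ?_
    erw [reassoc_of% (ι_extend P m uObj i)]
    rw [← Functor.map_comp]
    change _ ≫ _ ≫ (mUnit _).hom = P.F.map (_ ≫ (mUnit _).hom)
    erw [mUnit, mUnit, biproduct.ι_desc, biproduct.ι_desc, P.s_unit]

/-- `restrict` on morphisms. -/
def restrictMap {P Q : ModuleEnd k (Mat_ B) D} (a : P ⟶ Q) : restrict P ⟶ restrict Q :=
  ⟨a.ε, fun m x => by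
    change a.ε.app (m ⊙ᵣ x) ≫ Q.F.map (actSingle m x).inv ≫ (Q.s m (single x)).hom ≫
      (actSingle (Q.F.obj m) x).hom = (P.F.map (actSingle m x).inv ≫ (P.s m (single x)).hom ≫
      (actSingle (P.F.obj m) x).hom) ≫ a.ε.app m ⊵ᵣ x
    rw [← NatTrans.naturality_assoc, reassoc_of% (a.comm m (single x)), actSingle_natural_left,
      Category.assoc, Category.assoc]⟩

/-- `extend` on morphisms. -/
def extendMap {P Q : ModuleEnd k B D} (a : P ⟶ Q) : extend P ⟶ extend Q :=
  ⟨a.ε, fun m X => by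
    change a.ε.app (m ⊙ᵣ X) ≫ (Q.extendIso m X).hom = (P.extendIso m X).hom ≫ mActL (a.ε.app m) X
    refine map_biproduct_hom_ext P.F fun i => ?_
    have n := a.ε.naturality (biproduct.ι (fun i => m ⊙ᵣ X.X i) i)
    erw [reassoc_of% n]
    rw [ι_extend, reassoc_of% (ι_extend P m X i)]
    erw [reassoc_of% (a.comm m (X.X i)), ι_mActL (a.ε.app m) X i]⟩

end ModuleEnd

end ExtendRestrict


namespace CrossedAction

variable {k C G Γ : Type*} [Field k] [Group G] [Group Γ] [Fintype Γ]
  [Category C] [Abelian C] [Linear k C] [MonoidalCategory C] {mp : MatchedPair G Γ}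
  (A : CrossedAction k C mp) [MonoidalPreadditive C] [MonoidalLinear k C] [IsFusionCategory k C]

instance : IsBiadditiveAction (HomogObj A) C where
  actionHomLeft_add f g x := A.actL_add f g x
  actionHomRight_add M _ _ a b := A.actR_add M a b

instance : IsLinearAction k (HomogObj A) C where
  actionHomLeft_add f g x := A.actL_add f g x
  actionHomLeft_smul c _ _ f x := by
    change (A.act x.g).map (c • f) ▷ x.obj = c • (A.act x.g).map f ▷ x.obj
    rw [Functor.map_smul, MonoidalLinear.smul_whiskerRight]

section Tau

variable {A} {U : C} (u : ∀ g, (A.act g).obj U ≅ U)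

theorem τ_hom_app' {g l : G} {M X Y : C} {t : Γ} (w : mp.lact t g = l)
    (hY : A.comp t Y) (p : X ⟶ U) (f : Y ⟶ M) :
    (A.act g).map (p ⊗ₘ f) ≫ (A.τ u g M).hom =
      (A.E w X hY).hom ≫ (((A.act l).map p ≫ (u l).hom) ⊗ₘ (A.act g).map f) := by
  rw [MonoidalCategory.tensorHom_def, Functor.map_comp, Category.assoc, A.τ_hom_app u w hY,
    A.E_natural_left_assoc, ← tensorHom_id, tensorHom_comp_tensorHom, Category.id_comp]

theorem τ_natural (g : G) {M N : C} (f : M ⟶ N) :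
    (A.act g).map (U ◁ f) ≫ (A.τ u g N).hom = (A.τ u g M).hom ≫ U ◁ (A.act g).map f := by
  refine A.hom_ext_tensor (A.act g) fun t => ?_
  have hM := A.part_mem M t
  rw [← Functor.map_comp_assoc, ← whiskerLeft_comp, A.τ_hom_app u rfl hM,
    reassoc_of% (A.τ_hom_app u rfl hM (A.ι M t)), ← id_tensorHom, tensorHom_comp_tensorHom,
    Category.comp_id, Functor.map_comp]

theorem τ_cast {g h : G} (e : g = h) (M : C) :
    (A.castIso e _).hom ≫ (A.τ u h M).hom = (A.τ u g M).hom ≫ U ◁ (A.castIso e M).hom := by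
  subst e; simp

theorem τ_left {V : C} (v : ∀ g, (A.act g).obj V ≅ V) (f : U ⟶ V)
    (hf : ∀ g, (A.act g).map f ≫ (v g).hom = (u g).hom ≫ f) (g : G) (M : C) :
    (A.act g).map (f ▷ M) ≫ (A.τ v g M).hom = (A.τ u g M).hom ≫ f ▷ _ := by
  refine A.hom_ext_tensor (A.act g) fun t => ?_
  have hM := A.part_mem M t
  rw [← Functor.map_comp_assoc, ← tensorHom_def', τ_hom_app' v rfl hM,
    reassoc_of% (A.τ_hom_app u rfl hM (A.ι M t)), ← tensorHom_id,
    tensorHom_comp_tensorHom, hf, Category.comp_id]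

theorem τ_assoc {g l : G} {s : Γ} (N : C) {x : C} (hx : A.comp s x) (e : mp.lact s g = l) :
    (A.act g).map (α_ U N x).hom ≫ (A.τ u g (N ⊗ x)).hom ≫ U ◁ (A.E e N hx).hom =
      (A.E e (U ⊗ N) hx).hom ≫ (A.τ u l N).hom ▷ (A.act g).obj x ≫ (α_ _ _ _).hom := by
  subst e
  refine A.functor_hom_ext (tensorLeft U ⋙ tensorRight x ⋙ A.act g) (M := N) fun t => ?_
  change (A.act g).map ((U ◁ A.ι N t) ▷ x) ≫ _ = (A.act g).map ((U ◁ A.ι N t) ▷ x) ≫ _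
  have hN := A.part_mem N t
  have h₁ : (U ◁ A.ι N t) ▷ x ≫ (α_ U N x).hom = (α_ _ _ _).hom ≫ U ◁ (A.ι N t ▷ x) := by simp
  rw [A.E_natural_left_assoc, ← comp_whiskerRight_assoc, A.τ_hom_app u rfl hN,
    ← Functor.map_comp_assoc, h₁, Functor.map_comp, Category.assoc,
    reassoc_of% (A.τ_hom_app u (mp.mul_lact t s g) (A.comp_tensor hN hx) (A.ι N t ▷ x)),
    comp_whiskerRight_assoc, ← tensorHom_id (_ ⊗ₘ _), associator_naturality,
    reassoc_of% (A.E_assoc U hN hx rfl rfl (mp.mul_lact t s g)), ← id_tensorHom U,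
    ← id_tensorHom (_ : C) (A.E _ _ _).hom,
    tensorHom_comp_tensorHom, tensorHom_comp_tensorHom, A.E_natural_left, Category.comp_id,
    Category.id_comp, tensorHom_id]

theorem τ_R (hu : ∀ {g h l : G} (e : g * h = l),
      (A.R e U).hom ≫ (u l).hom = (A.act h).map (u g).hom ≫ (u h).hom) {g h l : G} (e : g * h = l)
    (M : C) :
    (A.R e (U ⊗ M)).hom ≫ (A.τ u l M).hom =
      (A.act h).map (A.τ u g M).hom ≫ (A.τ u h _).hom ≫ U ◁ (A.R e M).hom := by
  subst e
  refine A.hom_ext_tensor (A.act g ⋙ A.act h) fun t => ?_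
  have hM := A.part_mem M t
  change (A.act h).map ((A.act g).map (U ◁ A.ι M t)) ≫ _ =
    (A.act h).map ((A.act g).map (U ◁ A.ι M t)) ≫ _
  rw [A.R_natural_assoc, A.τ_hom_app u rfl hM, ← Functor.map_comp_assoc, A.τ_hom_app u rfl hM,
    Functor.map_comp, Category.assoc,
    reassoc_of% (τ_hom_app' u rfl (A.comp_act g hM) (u (mp.lact t g)).hom ((A.act g).map (A.ι M t))),
    A.E_mul_assoc U hM rfl rfl rfl rfl (mp.lact_mul _ _ _).symm, tensorHom_comp_tensorHom, hu,
    ← A.R_natural, ← id_tensorHom, tensorHom_comp_tensorHom, Category.comp_id]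

theorem u_one (hu : ∀ {g h l : G} (e : g * h = l),
      (A.R e U).hom ≫ (u l).hom = (A.act h).map (u g).hom ≫ (u h).hom) :
    A.oneIso.hom.app U ≫ (u 1).hom = 𝟙 U := by
  have h := hu (mul_one (1 : G)) =≫ 𝟙 _
  have h₂ := A.one_R (mul_one (1 : G)) rfl U
  rw [Category.comp_id, Category.comp_id] at h
  have h₃ := congrArg (fun f => A.oneIso.hom.app _ ≫ f) h
  beta_reduce at h₃
  rw [reassoc_of% h₂, castIso_rfl] at h₃
  have h₄ := A.oneIso.hom.naturality (u 1).hom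
  simp only [Functor.id_obj, Functor.id_map] at h₄
  rw [← reassoc_of% h₄, Iso.refl_hom, Category.id_comp] at h₃
  rw [← cancel_epi (u 1).hom, Category.comp_id]
  exact h₃.symm

theorem τ_one (hu : ∀ {g h l : G} (e : g * h = l),
      (A.R e U).hom ≫ (u l).hom = (A.act h).map (u g).hom ≫ (u h).hom) (M : C) :
    A.oneIso.hom.app (U ⊗ M) ≫ (A.τ u 1 M).hom = U ◁ A.oneIso.hom.app M := by
  refine A.hom_ext_tensor (𝟭 C) fun t => ?_
  have hM := A.part_mem M t
  have h := A.oneIso.hom.naturality (U ◁ A.ι M t)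
  have h' := A.oneIso.hom.naturality (A.ι M t)
  simp only [Functor.id_obj, Functor.id_map] at h h' ⊢
  rw [reassoc_of% h, A.τ_hom_app u (mp.lact_one t) hM, reassoc_of% (A.E_one U hM (mp.lact_one t)),
    tensorHom_comp_tensorHom, u_one u hu, ← h', id_tensorHom, whiskerLeft_comp]

end Tau

/-- `s_{M, g ⋈ x} = ((η^g_{U,M})⁻¹ ⊗ id) (u_{|M| ▶ g}⁻¹ ⊗ id ⊗ id) α⁻¹ :
U ⊗ (M ◁ g ⊗ x) ≅ (U ⊗ M) ◁ g ⊗ x` for homogeneous `M`, extended additively to all `M`. -/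
def tensorIso {U : C} (u : ∀ g, (A.act g).obj U ≅ U) (M : C) (x : HomogObj A) :
    U ⊗ A.actObj M x ≅ A.actObj (U ⊗ M) x :=
  (α_ U _ x.obj).symm ≪≫ whiskerRightIso (A.τ u x.g M).symm x.obj

theorem tensorIso_inv {U : C} (u : ∀ g, (A.act g).obj U ≅ U) (M : C) (x : HomogObj A) :
    (A.tensorIso u M x).inv = (A.τ u x.g M).hom ▷ x.obj ≫ (α_ U _ x.obj).hom := rfl

theorem iso_swap {X X' Y Y' : C} (e₁ : X ≅ Y) (e₂ : X' ≅ Y') {a : X ⟶ X'} {b : Y ⟶ Y'}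
    (h : e₁.inv ≫ a = b ≫ e₂.inv) : a ≫ e₂.hom = e₁.hom ≫ b := by
  rw [Iso.inv_comp_eq] at h
  rw [h]
  simp

theorem assoc_aux {U P Q N N' S x y : C} (f : P ⟶ Q) (g : Q ⟶ U ⊗ S) (z : S ⟶ N' ⊗ x)
    (p : P ⟶ N ⊗ x) (r : N ⟶ U ⊗ N')
    (h : f ≫ g ≫ U ◁ z = p ≫ r ▷ x ≫ (α_ U N' x).hom) :
    (p ▷ y ≫ (α_ N x y).hom) ≫ r ▷ (x ⊗ y) ≫ (α_ U N' (x ⊗ y)).hom =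
      f ▷ y ≫ (g ▷ y ≫ (α_ U S y).hom) ≫ U ◁ (z ▷ y ≫ (α_ N' x y).hom) := by
  have h' := congrArg (fun f => f ▷ y) h
  simp only [comp_whiskerRight] at h'
  have e : f ▷ y ≫ (g ▷ y ≫ (α_ U S y).hom) ≫ U ◁ (z ▷ y ≫ (α_ N' x y).hom) =
      (f ▷ y ≫ g ▷ y ≫ (U ◁ z) ▷ y) ≫ (α_ U (N' ⊗ x) y).hom ≫ U ◁ (α_ N' x y).hom := by
    simp
  rw [e, h']
  simp

/-- The module functor `(U ⊗ -, s)` over the symbols. -/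
def tensorModuleEnd (X : CrossedExt A) : ModuleEnd k (HomogObj A) C where
  F := tensorLeft X.U
  additive := inferInstance
  linear := inferInstance
  s M x := A.tensorIso X.u M x
  s_natural_left {M N} f x := by
    refine iso_swap (A.tensorIso X.u M x) (A.tensorIso X.u N x) ?_
    change _ ≫ X.U ◁ ((A.act x.g).map f ▷ x.obj) = (A.act x.g).map (X.U ◁ f) ▷ x.obj ≫ _
    rw [tensorIso_inv, tensorIso_inv, ← comp_whiskerRight_assoc, τ_natural]
    simp
  s_natural_right M x y a := by
    refine iso_swap (A.tensorIso X.u M x) (A.tensorIso X.u M y) ?_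
    change _ ≫ X.U ◁ (A.actR M a) = A.actR (X.U ⊗ M) a ≫ _
    by_cases h : x.g = y.g
    · rw [A.actR_eq _ _ h, A.actR_eq _ _ h, tensorIso_inv, tensorIso_inv,
        MonoidalCategory.tensorHom_def' (A.castIso h (X.U ⊗ M)).hom, Category.assoc,
        Category.assoc, ← comp_whiskerRight_assoc, τ_cast, MonoidalCategory.tensorHom_def']
      simp only [comp_whiskerRight, whiskerLeft_comp, Category.assoc]
      rw [← Category.assoc (_ ◁ a.f), whisker_exchange]
      simp
    · rw [A.actR_eq_zero _ _ h, A.actR_eq_zero _ _ h]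
      simp
  s_assoc M x y := by
    have key : (A.actAssoc (X.U ⊗ M) x y).inv ≫ (A.tensorIso X.u M (x ⊗ y)).inv =
        A.actL (A.tensorIso X.u M x).inv y ≫ (A.tensorIso X.u (A.actObj M x) y).inv ≫
          X.U ◁ (A.actAssoc M x y).inv := by
      have h₁ := τ_R X.u (CrossedExt.u_R X) (rfl : x.g * mp.lact x.deg y.g = _) M
      have h₂ := τ_assoc X.u ((A.act x.g).obj M) x.mem (rfl : mp.lact x.deg y.g = _)
      have h₃ := A.E_natural_left (rfl : mp.lact x.deg y.g = _) x.mem (A.τ X.u x.g M).hom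
      rw [actAssoc_inv, actAssoc_inv, tensorIso_inv, tensorIso_inv, tensorIso_inv]
      change _ = (A.act y.g).map ((A.τ X.u x.g M).hom ▷ x.obj ≫ (α_ _ _ _).hom) ▷ y.obj ≫ _
      change _ ≫ (A.τ X.u (x.g * mp.lact x.deg y.g) M).hom ▷ ((A.act y.g).obj x.obj ⊗ y.obj) ≫
        (α_ _ _ ((A.act y.g).obj x.obj ⊗ y.obj)).hom = _
      have h₄ : (A.act y.g).map ((A.τ X.u x.g M).hom ▷ x.obj ≫ (α_ _ _ _).hom) ≫
          (A.τ X.u y.g (A.actObj M x)).hom ≫ X.U ◁ ((A.E rfl ((A.act x.g).obj M) x.mem).hom ≫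
            (A.R rfl M).hom ▷ _) =
          (A.E rfl _ x.mem).hom ≫ ((A.R rfl _).hom ≫ (A.τ X.u _ M).hom) ▷ _ ≫ (α_ _ _ _).hom := by
        rw [h₁, Functor.map_comp, Category.assoc, whiskerLeft_comp, reassoc_of% h₂, reassoc_of% h₃]
        simp
      refine assoc_aux _ _ _ _ _ ?_
      rw [h₄]
      simp
    let e₁ := A.tensorIso X.u M (x ⊗ y) ≪≫ A.actAssoc (X.U ⊗ M) x y
    let e₂ := whiskerLeftIso X.U (A.actAssoc M x y) ≪≫ A.tensorIso X.u (A.actObj M x) y ≪≫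
      whiskerRightIso ((A.act y.g).mapIso (A.tensorIso X.u M x)) y.obj
    have h : e₁ = e₂ := Iso.ext_inv (key.trans (Category.assoc _ _ _).symm)
    exact congrArg Iso.hom h
  s_unit M := by
    change (A.tensorIso X.u M (𝟙_ _)).hom ≫ (A.actUnit (X.U ⊗ M)).hom = X.U ◁ (A.actUnit M).hom
    let e₁ := A.tensorIso X.u M (𝟙_ _) ≪≫ A.actUnit (X.U ⊗ M)
    let e₂ := whiskerLeftIso X.U (A.actUnit M)
    have key : A.oneIso.hom.app (X.U ⊗ M) ≫ (ρ_ ((A.act 1).obj (X.U ⊗ M))).inv ≫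
        (A.τ X.u 1 M).hom ▷ 𝟙_ C ≫ (α_ X.U ((A.act 1).obj M) (𝟙_ C)).hom =
          X.U ◁ (A.oneIso.hom.app M ≫ (ρ_ ((A.act 1).obj M)).inv) := by
      rw [← rightUnitor_inv_naturality_assoc, reassoc_of% (τ_one X.u (CrossedExt.u_R X) M)]
      simp
    have h : e₁ = e₂ := Iso.ext_inv ((Category.assoc _ _ _).trans key)
    exact congrArg Iso.hom h

end CrossedAction


namespace CrossedAction

variable {k C G Γ : Type*} [Field k] [Group G] [Group Γ] [Fintype Γ]
  [Category C] [Abelian C] [Linear k C] [MonoidalCategory C] {mp : MatchedPair G Γ}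
  (A : CrossedAction k C mp) [MonoidalPreadditive C] [MonoidalLinear k C] [IsFusionCategory k C]

/-- The bicrossed product `vec_G ⋈ C`. Its objects are finite families `(g_i ⋈ X_i)`, thought of as
direct sums, with `X_i` homogeneous (any object of `C` is a direct sum of such), its morphisms are
matrices of morphisms of `vec_G ⊠ C`, and
`(g ⋈ X) ⊗ (h ⋈ Y) = g (|X| ▶ h) ⋈ (X ◁ h ⊗ Y)`. -/
abbrev Bicrossed : Type _ := Mat_ (HomogObj A)

/-- `C` as a right `vec_G ⋈ C`-module category, `M ⊗ (g_i ⋈ X_i) = ⨁ i, M ◁ g_i ⊗ X_i`. -/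
instance : MonoidalRightAction (Bicrossed A) C := inferInstanceAs (MonoidalRightAction (Mat_ _) C)

/-- The dual category `End_{vec_G ⋈ C}(C)`. -/
abbrev Dual : Type _ := ModuleEnd k (Bicrossed A) C

/-- The object `g ⋈ 1`. -/
abbrev gOne (g : G) : HomogObj A := ⟨g, 1, 𝟙_ C, A.comp_one⟩

section Eval

variable {A} (P : ModuleEnd k (HomogObj A) C)

/-- The isomorphism
`u_g = F(r_1) F(η₀^g ⊗ id) s⁻¹_{1, g ⋈ 1} r⁻¹_{F(1) ◁ g} : F(1) ◁ g ≅ F(1)`. -/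
def evalIso (g : G) : (A.act g).obj (P.F.obj (𝟙_ C)) ≅ P.F.obj (𝟙_ C) :=
  (ρ_ ((A.act g).obj (P.F.obj (𝟙_ C)))).symm ≪≫ (P.s (𝟙_ C) (A.gOne g)).symm ≪≫
    P.F.mapIso (whiskerRightIso (A.η₀ g) (𝟙_ C)) ≪≫ P.F.mapIso (ρ_ (𝟙_ C))

theorem evalIso_spec (g : G) :
    (P.s (𝟙_ C) (A.gOne g)).hom ≫ (ρ_ ((A.act g).obj (P.F.obj (𝟙_ C)))).hom ≫ (evalIso P g).hom =
      P.F.map ((ρ_ ((A.act g).obj (𝟙_ C))).hom ≫ (A.η₀ g).hom) := by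
  rw [← rightUnitor_naturality, Functor.map_comp]
  simp [evalIso]

/-- The isomorphism `(g ⋈ 1) ⊗ (h ⋈ 1) ≅ gh ⋈ 1`. -/
def gOneMul (g h : G) : A.gOne g ⊗ A.gOne h ⟶ A.gOne (g * h) :=
  (HomogObj.mkIso (congrArg (g * ·) (mp.one_lact h))
    (whiskerRightIso (A.η₀ h) (𝟙_ C) ≪≫ ρ_ (𝟙_ C))).hom

theorem R_cast_left {g a b : G} (e : a = b) (M : C) :
    (A.R (rfl : g * a = _) M).hom ≫ (A.castIso (congrArg (g * ·) e) M).hom =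
      (A.castIso e _).hom ≫ (A.R rfl M).hom := by
  subst e; simp

theorem actAssoc_gOne (M : C) (g h : G) :
    (A.actAssoc M (A.gOne g) (A.gOne h)).hom ≫
        (A.act h).map (ρ_ ((A.act g).obj M)).hom ▷ 𝟙_ C ≫ (ρ_ _).hom ≫ (A.R rfl M).hom =
      A.actR M (gOneMul g h) ≫ (ρ_ _).hom := by
  have h₁ := A.E_right_unit ((A.act g).obj M) A.comp_one rfl (mp.one_lact h)
  have h₂ := R_cast_left (A := A) (g := g) (mp.one_lact h) M
  have h₃ : ∀ {P Q P' Q' : C} (p : P ⟶ Q ⊗ P') (c : Q ⟶ Q') (d : P' ⟶ 𝟙_ C),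
      (p ▷ 𝟙_ C ≫ (α_ _ _ _).hom) ≫ (c ⊗ₘ (d ▷ 𝟙_ C ≫ (ρ_ (𝟙_ C)).hom)) ≫ (ρ_ Q').hom =
        (ρ_ P).hom ≫ p ≫ (c ⊗ₘ d) ≫ (ρ_ Q').hom := by
    intros P Q P' Q' p c d
    rw [rightUnitor_naturality, MonoidalCategory.tensorHom_def, MonoidalCategory.tensorHom_def]
    simp
  rw [← Iso.eq_inv_comp, actAssoc_inv, A.actR_eq M _ (congrArg (g * ·) (mp.one_lact h))]
  refine Eq.trans ?_ (h₃ _ _ _).symm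
  rw [rightUnitor_naturality_assoc, ← h₁]
  simp only [Category.assoc]
  congr 2
  rw [← tensorHom_id, tensorHom_comp_tensorHom_assoc, h₂, Category.id_comp,
    ← rightUnitor_naturality, ← tensorHom_id, tensorHom_comp_tensorHom_assoc, Category.comp_id]

theorem evalIso_mul (g h : G) :
    (A.R rfl _).hom ≫ (evalIso P (g * h)).hom =
      (A.act h).map (evalIso P g).hom ≫ (evalIso P h).hom := by
  have h₁ : (P.s (𝟙_ C) (A.gOne g ⊗ A.gOne h)).hom ≫
      (A.actAssoc (P.F.obj (𝟙_ C)) (A.gOne g) (A.gOne h)).hom =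
      P.F.map (A.actAssoc (𝟙_ C) (A.gOne g) (A.gOne h)).hom ≫
        (P.s (A.actObj (𝟙_ C) (A.gOne g)) (A.gOne h)).hom ≫
          (A.act h).map (P.s (𝟙_ C) (A.gOne g)).hom ▷ 𝟙_ C :=
    P.s_assoc (𝟙_ C) (A.gOne g) (A.gOne h)
  have h₂ : P.F.map (A.actR (𝟙_ C) (gOneMul g h)) ≫ (P.s (𝟙_ C) (A.gOne (g * h))).hom =
      (P.s (𝟙_ C) (A.gOne g ⊗ A.gOne h)).hom ≫ A.actR (P.F.obj (𝟙_ C)) (gOneMul g h) :=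
    P.s_natural_right (𝟙_ C) (gOneMul (A := A) g h)
  have h₃ := actAssoc_gOne (A := A) (𝟙_ C) g h
  have h₄ := actAssoc_gOne (A := A) (P.F.obj (𝟙_ C)) g h
  have h₅ : (A.R rfl (𝟙_ C)).hom ≫ (A.η₀ (g * h)).hom =
      (A.act h).map (A.η₀ g).hom ≫ (A.η₀ h).hom := by
    simpa [R] using A.η₀_mul g h
  have h₆ : P.F.map ((A.act h).map ((ρ_ ((A.act g).obj (𝟙_ C))).hom ≫ (A.η₀ g).hom) ▷ 𝟙_ C) ≫
      (P.s (𝟙_ C) (A.gOne h)).hom = (P.s (A.actObj (𝟙_ C) (A.gOne g)) (A.gOne h)).hom ≫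
        (A.act h).map (P.F.map ((ρ_ ((A.act g).obj (𝟙_ C))).hom ≫ (A.η₀ g).hom)) ▷ 𝟙_ C :=
    P.s_natural_left ((ρ_ ((A.act g).obj (𝟙_ C))).hom ≫ (A.η₀ g).hom) (A.gOne h)
  have h₇ : (A.actAssoc (𝟙_ C) (A.gOne g) (A.gOne h)).hom ≫
      (A.act h).map ((ρ_ ((A.act g).obj (𝟙_ C))).hom ≫ (A.η₀ g).hom) ▷ 𝟙_ C ≫ (ρ_ _).hom ≫
        (A.η₀ h).hom = A.actR (𝟙_ C) (gOneMul g h) ≫ (ρ_ _).hom ≫ (A.η₀ (g * h)).hom := by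
    rw [← reassoc_of% h₃, h₅]
    simp
  have e₁ := evalIso_spec P g
  have e₂ := evalIso_spec P h
  have e₃ := evalIso_spec P (g * h)
  have iso : IsIso ((P.s (𝟙_ C) (A.gOne g ⊗ A.gOne h)).hom ≫
      (A.actAssoc (P.F.obj (𝟙_ C)) (A.gOne g) (A.gOne h)).hom ≫
        (A.act h).map (ρ_ ((A.act g).obj (P.F.obj (𝟙_ C)))).hom ▷ 𝟙_ C ≫ (ρ_ _).hom) := by
    infer_instance
  rw [← cancel_epi ((P.s (𝟙_ C) (A.gOne g ⊗ A.gOne h)).hom ≫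
      (A.actAssoc (P.F.obj (𝟙_ C)) (A.gOne g) (A.gOne h)).hom ≫
        (A.act h).map (ρ_ ((A.act g).obj (P.F.obj (𝟙_ C)))).hom ▷ 𝟙_ C ≫ (ρ_ _).hom)]
  simp only [Category.assoc]
  rw [reassoc_of% h₄, ← reassoc_of% h₂, e₃, ← Functor.map_comp, ← h₇, reassoc_of% h₁,
    Functor.map_comp, Functor.map_comp, ← e₂, reassoc_of% h₆, ← e₁, ← rightUnitor_naturality_assoc]
  simp only [Functor.map_comp, comp_whiskerRight, Category.assoc]

theorem evalIso_natural {P Q : ModuleEnd k (HomogObj A) C} (a : P ⟶ Q) (g : G) :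
    (A.act g).map (a.ε.app (𝟙_ C)) ≫ (evalIso Q g).hom =
      (evalIso P g).hom ≫ a.ε.app (𝟙_ C) := by
  have h₁ := evalIso_spec P g
  have h₂ := evalIso_spec Q g
  have h₃ := a.comm (𝟙_ C) (A.gOne g)
  change _ = _ ≫ (A.act g).map (a.ε.app (𝟙_ C)) ▷ 𝟙_ C at h₃
  rw [← cancel_epi ((P.s (𝟙_ C) (A.gOne g)).hom ≫ (ρ_ ((A.act g).obj (P.F.obj (𝟙_ C)))).hom),
    Category.assoc, Category.assoc, reassoc_of% h₁, ← rightUnitor_naturality_assoc,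
    ← reassoc_of% h₃, h₂, a.ε.naturality]
  rfl

end Eval

/-- The functor `T : (F, s) ↦ (F(1), u)`, `T(ε) = ε_1`. -/
def evalFunctor : Dual A ⥤ CrossedExt A where
  obj P :=
    { U := P.F.obj (𝟙_ C)
      u := evalIso P.restrict
      u_mul := fun g h => by
        have h := evalIso_mul P.restrict g h
        simp only [R, castIso_rfl, Iso.trans_refl] at h
        exact h }
  map a := ⟨a.ε.app (𝟙_ C), fun g => evalIso_natural (ModuleEnd.restrictMap a) g⟩
  map_id _ := rfl
  map_comp _ _ := rfl

/-- The functor `S : (U, u) ↦ (U ⊗ -, s)`, `S(f) = f ⊗ id`. -/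
def tensorFunctor : CrossedExt A ⥤ Dual A where
  obj X := (A.tensorModuleEnd X).extend
  map {X Y} f := ModuleEnd.extendMap (P := A.tensorModuleEnd X) (Q := A.tensorModuleEnd Y)
    ⟨(tensoringLeft C).map f.f, fun M x => by
      refine iso_swap (A.tensorIso X.u M x) (A.tensorIso Y.u M x) ?_
      change _ ≫ f.f ▷ _ = (A.act x.g).map (f.f ▷ M) ▷ x.obj ≫ _
      rw [tensorIso_inv, tensorIso_inv, ← comp_whiskerRight_assoc, τ_left X.u Y.u f.f f.comm]
      simp⟩
  map_id X := by
    ext M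
    exact id_whiskerRight _ _
  map_comp f g := by
    ext M
    exact comp_whiskerRight _ _ _

end CrossedAction

end

/-!
A module functor `(F, s)` over `vec_G ⋈ C` is determined by `F(1)` and the isomorphisms
`u_g : F(1) ◁ g ≅ F(1)`. Indeed `M = 1 ⊗ (1 ⋈ M)` up to `R⁰` for homogeneous `M`, so the constraint
`s_{1, 1 ⋈ M}` gives an isomorphism `F(M) ≅ F(1) ⊗ M` (`homogCompare`), which extends additively to
`F ≅ F(1) ⊗ -` (`compareIso`). Because `g ⋈ Y ≅ (g ⋈ 1) ⊗ (1 ⋈ Y)`, the pentagon expresses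
`s_{1, g ⋈ Y}` through `u_g` and this comparison (`constraint_unit`). As
`(1 ⋈ M) ⊗ (g ⋈ X) = (t ▶ g) ⋈ (M ◁ g ⊗ X)` for `M` of degree `t`, the pentagon for
`(1, 1 ⋈ M, g ⋈ X)` then turns `s_{M, g ⋈ X}` into the constraint `(η⁻¹ ⊗ id)(u_{t ▶ g}⁻¹ ⊗ id) α⁻¹`
of `F(1) ⊗ -` (`homogCompare_constraint`, `compareHom_constraint`). So the comparison is an
isomorphism of module functors `F ≅ S(T(F))`. It is natural in `F`, since a morphism of module
functors commutes with the constraints (`compareHom_hom`).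

In the other direction, `T(S(U, u))` is `(U, u) ⊗ (1, η₀)` (`eq_w_η₀`), which the right unit
constraint identifies with `(U, u)`.

The isomorphism `α⁻¹ : U ⊗ (V ⊗ M) ≅ (U ⊗ V) ⊗ M` is one of module functors because the
isomorphisms `(U ⊗ M) ◁ g ≅ U ⊗ M ◁ g` are multiplicative in `(U, u)` (`τ_w`), and its coherence is
that of `C`; the quasi-inverse `T` of the monoidal functor `S` is then monoidal as well.

All of this takes place over the symbols `g ⋈ X`. The passage to their direct sums is the formal
fact that a module functor over an additive envelope is determined by its restriction
(`ModuleEnd.ι_s`).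
-/

noncomputable section

attribute [local instance] Abelian.hasFiniteBiproducts

namespace CrossedAction

variable {k C G Γ : Type*} [Field k] [Group G] [Group Γ] [Fintype Γ]
  [Category C] [Abelian C] [Linear k C] [MonoidalCategory C] {mp : MatchedPair G Γ}
  (A : CrossedAction k C mp) [MonoidalPreadditive C] [MonoidalLinear k C] [IsFusionCategory k C]

/-! ### The module constraint on symbols -/

/-- The isomorphism `(M ◁ g ⊗ X) ◁ h ⊗ Y ≅ M ◁ a ⊗ (X ◁ h ⊗ Y)`, for `X` of degree `s`, `l = s ▶ h`
and `a = gl`. It is the inverse of `actAssoc`, with the group elements kept as variables. -/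
def assocIso {g h l a : G} {s : Γ} {X : C} (wl : mp.lact s h = l) (wa : g * l = a) (M : C)
    (hX : A.comp s X) (Y : C) :
    (A.act h).obj ((A.act g).obj M ⊗ X) ⊗ Y ≅ (A.act a).obj M ⊗ ((A.act h).obj X ⊗ Y) :=
  whiskerRightIso (A.E wl ((A.act g).obj M) hX ≪≫ whiskerRightIso (A.R wa M) _) Y ≪≫ α_ _ _ _

theorem assocIso_hom {g h l a : G} {s : Γ} {X : C} (wl : mp.lact s h = l) (wa : g * l = a) (M : C)
    (hX : A.comp s X) (Y : C) :
    (A.assocIso wl wa M hX Y).hom =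
      ((A.E wl ((A.act g).obj M) hX).hom ≫ (A.R wa M).hom ▷ _) ▷ Y ≫ (α_ _ _ _).hom := rfl

/-- For `X = 1` and `h = 1` the module associativity is the associativity of `C`, up to `R⁰`. -/
theorem one_assocIso {g l : G} (wl : mp.lact 1 1 = l) (wa : g * l = g) (M Y : C) :
    A.oneIso.hom.app ((A.act g).obj M ⊗ 𝟙_ C) ▷ Y ≫ (A.assocIso wl wa M A.comp_one Y).hom =
      (α_ _ _ _).hom ≫ (A.act g).obj M ◁ (A.oneIso.hom.app (𝟙_ C) ▷ Y) := by
  obtain rfl : l = 1 := by rw [← wl, mp.one_lact]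
  rw [assocIso_hom, ← comp_whiskerRight_assoc, reassoc_of% (A.E_one ((A.act g).obj M) A.comp_one wl),
    MonoidalCategory.tensorHom_def']
  have h := A.one_R wa rfl M
  simp only [Category.assoc, ← comp_whiskerRight_assoc, ← comp_whiskerRight, h]
  simp

/-- Acting first by `1 ⋈ X`, the module associativity is `η ⊗ id` followed by the associativity of
`C`, up to `R⁰`. -/
theorem map_one_assocIso {g l : G} {t : Γ} {X : C} (wl : mp.lact t g = l) (wa : 1 * l = l) (M : C)
    (hX : A.comp t X) (Y : C) :
    (A.act g).map (A.oneIso.hom.app M ▷ X) ▷ Y ≫ (A.assocIso wl wa M hX Y).hom =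
      (A.E wl M hX).hom ▷ Y ≫ (α_ _ _ _).hom := by
  rw [assocIso_hom, ← comp_whiskerRight_assoc]
  erw [A.E_natural_left_assoc]
  rw [← comp_whiskerRight, A.map_one_R wa rfl]
  simp

section ModuleConstraint

variable {A} (P : ModuleEnd k (HomogObj A) C)

/-- The module constraint `s_{M, g ⋈ X} : F (M ◁ g ⊗ X) ≅ F M ◁ g ⊗ X`. -/
def constraint (g : G) {t : Γ} {X : C} (hX : A.comp t X) (M : C) :
    P.F.obj ((A.act g).obj M ⊗ X) ≅ (A.act g).obj (P.F.obj M) ⊗ X :=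
  P.s M ⟨g, t, X, hX⟩

theorem constraint_left (g : G) {t : Γ} {X : C} (hX : A.comp t X) {M N : C} (f : M ⟶ N) :
    P.F.map ((A.act g).map f ▷ X) ≫ (constraint P g hX N).hom =
      (constraint P g hX M).hom ≫ (A.act g).map (P.F.map f) ▷ X :=
  P.s_natural_left f ⟨g, t, X, hX⟩

theorem constraint_right (g : G) {t t' : Γ} {X Y : C} (hX : A.comp t X) (hY : A.comp t' Y) (M : C)
    (f : X ⟶ Y) :
    P.F.map ((A.act g).obj M ◁ f) ≫ (constraint P g hY M).hom =
      (constraint P g hX M).hom ≫ (A.act g).obj (P.F.obj M) ◁ f := by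
  let b : (⟨g, t, X, hX⟩ : HomogObj A) ⟶ ⟨g, t', Y, hY⟩ := ⟨f, fun h => absurd rfl h⟩
  have h : P.F.map (A.actR M b) ≫ (constraint P g hY M).hom =
      (constraint P g hX M).hom ≫ A.actR (P.F.obj M) b := P.s_natural_right M b
  rw [A.actR_eq _ b rfl, A.actR_eq _ b rfl] at h
  simpa [b] using h

/-- The pentagon axiom of a module functor, in terms of `assocIso`. -/
theorem constraint_assoc {g h l a : G} {s t : Γ} {X Y : C} (wl : mp.lact s h = l) (wa : g * l = a)
    (M : C) (hX : A.comp s X) (hY : A.comp t Y) :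
    P.F.map (A.assocIso wl wa M hX Y).hom ≫
        (constraint P a (A.comp_tensor (A.comp_act h hX) hY) M).hom =
      (constraint P h hY _).hom ≫ (A.act h).map (constraint P g hX M).hom ▷ Y ≫
        (A.assocIso wl wa (P.F.obj M) hX Y).hom := by
  subst wl wa
  let x : HomogObj A := ⟨g, s, X, hX⟩
  let y : HomogObj A := ⟨h, t, Y, hY⟩
  have e₁ : ∀ N : C, (A.assocIso rfl rfl N hX Y).inv = (A.actAssoc N x y).hom := fun N => by
    refine congrArg Iso.inv (Iso.ext (β := (A.actAssoc N x y).symm) ?_)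
    exact (A.actAssoc_inv N x y).symm
  have e : (constraint P _ (A.comp_tensor (A.comp_act h hX) hY) M).hom ≫
      (A.assocIso rfl rfl (P.F.obj M) hX Y).inv = P.F.map (A.assocIso rfl rfl M hX Y).inv ≫
        (constraint P h hY _).hom ≫ (A.act h).map (constraint P g hX M).hom ▷ Y := by
    rw [e₁, e₁]
    exact P.s_assoc M x y
  rw [Iso.comp_inv_eq] at e
  simp only [e, Category.assoc]
  rw [← Functor.map_comp_assoc, Iso.hom_inv_id, CategoryTheory.Functor.map_id,
    Category.id_comp]

/-! ### The comparison `F(Y) ≅ F(1) ⊗ Y` for homogeneous `Y` -/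

/-- The isomorphism `F(Y) ≅ F(1 ◁ 1 ⊗ Y) ≅ F(1) ◁ 1 ⊗ Y ≅ F(1) ⊗ Y` for homogeneous `Y`, made of the
module constraint `s_{1, 1 ⋈ Y}` and the unit `R⁰` of the group action. -/
def homogCompare {t : Γ} {Y : C} (hY : A.comp t Y) : P.F.obj Y ≅ P.F.obj (𝟙_ C) ⊗ Y :=
  P.F.mapIso ((λ_ Y).symm ≪≫ whiskerRightIso (A.oneIso.app (𝟙_ C)) Y) ≪≫
    constraint P 1 hY (𝟙_ C) ≪≫ whiskerRightIso (A.oneIso.app (P.F.obj (𝟙_ C))).symm Y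

theorem homogCompare_spec {t : Γ} {Y : C} (hY : A.comp t Y) :
    (constraint P 1 hY (𝟙_ C)).hom =
      P.F.map (A.oneIso.inv.app (𝟙_ C) ▷ Y ≫ (λ_ Y).hom) ≫ (homogCompare P hY).hom ≫
        A.oneIso.hom.app (P.F.obj (𝟙_ C)) ▷ Y := by
  have h : (A.oneIso.inv.app (𝟙_ C) ▷ Y ≫ (λ_ Y).hom) ≫ (λ_ Y).inv ≫
      A.oneIso.hom.app (𝟙_ C) ▷ Y = 𝟙 _ := by
    simp [← comp_whiskerRight]
  simp only [homogCompare, Iso.trans_hom, Functor.mapIso_hom, Iso.symm_hom, whiskerRightIso_hom,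
    Iso.app_hom, Category.assoc, Iso.app_inv]
  rw [← Functor.map_comp_assoc, h]
  simp [← comp_whiskerRight]

theorem homogCompare_natural {t t' : Γ} {Y Y' : C} (hY : A.comp t Y) (hY' : A.comp t' Y')
    (f : Y ⟶ Y') :
    P.F.map f ≫ (homogCompare P hY').hom = (homogCompare P hY).hom ≫ P.F.obj (𝟙_ C) ◁ f := by
  have h := constraint_right P 1 hY hY' (𝟙_ C) f
  have e : f ≫ (λ_ Y').inv ≫ A.oneIso.hom.app (𝟙_ C) ▷ Y' =
      ((λ_ Y).inv ≫ A.oneIso.hom.app (𝟙_ C) ▷ Y) ≫ (A.act 1).obj (𝟙_ C) ◁ f := by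
    simp [← whisker_exchange]
  simp only [homogCompare, Iso.trans_hom, Functor.mapIso_hom, Iso.symm_hom, whiskerRightIso_hom,
    Iso.app_hom, Category.assoc]
  rw [← Functor.map_comp_assoc, e, Functor.map_comp, Category.assoc, reassoc_of% h]
  simp [whisker_exchange]

/-- The constraint `s_{1, g ⋈ Y}` is determined by `u_g` and the comparison `F(Y) ≅ F(1) ⊗ Y`,
because `g ⋈ Y ≅ (g ⋈ 1) ⊗ (1 ⋈ Y)`. -/
theorem constraint_unit (g : G) {t : Γ} {Y : C} (hY : A.comp t Y) :
    (constraint P g hY (𝟙_ C)).hom ≫ (evalIso P g).hom ▷ Y =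
      P.F.map ((A.η₀ g).hom ▷ Y ≫ (λ_ Y).hom) ≫ (homogCompare P hY).hom := by
  have w : g * mp.lact 1 1 = g := by rw [mp.one_lact, mul_one]
  -- the pentagon for `(1, g ⋈ 1, 1 ⋈ Y)`
  have e₁ := constraint_assoc P rfl w (𝟙_ C) A.comp_one hY
  -- the definition of `u_g`, solved for the constraint at `g ⋈ 1`
  have e₂ : (constraint P g A.comp_one (𝟙_ C)).hom = P.F.map ((ρ_ _).hom ≫ (A.η₀ g).hom) ≫
      (evalIso P g).inv ≫ (ρ_ _).inv := by
    rw [← evalIso_spec P g]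
    simp [constraint]
  have e₃ := constraint_left P 1 hY ((ρ_ ((A.act g).obj (𝟙_ C))).hom ≫ (A.η₀ g).hom)
  -- the identification `Y ≅ 1 ◁ 1 ⊗ Y` transports `(g ⋈ 1) ⊗ (1 ⋈ Y)` to `g ⋈ Y`
  have e₆ := constraint_right P g hY (A.comp_tensor (A.comp_act 1 A.comp_one) hY) (𝟙_ C)
    ((λ_ Y).inv ≫ A.oneIso.hom.app (𝟙_ C) ▷ Y)
  have e₇ : ∀ N : C, N ◁ ((λ_ Y).inv ≫ A.oneIso.hom.app (𝟙_ C) ▷ Y) =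
      (ρ_ N).inv ▷ Y ≫ (α_ _ _ _).hom ≫ N ◁ (A.oneIso.hom.app (𝟙_ C) ▷ Y) := fun N => by
    simp
  have e₈ : ∀ N : C, (ρ_ ((A.act g).obj N)).inv ▷ Y ≫
      A.oneIso.hom.app ((A.act g).obj N ⊗ 𝟙_ C) ▷ Y ≫
        (A.assocIso rfl w N A.comp_one Y).hom =
      (A.act g).obj N ◁ ((λ_ Y).inv ≫ A.oneIso.hom.app (𝟙_ C) ▷ Y) := fun N => by
    rw [e₇, A.one_assocIso]
    rfl
  have e₉ : A.oneIso.hom.app (P.F.obj (𝟙_ C)) ▷ Y ≫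
      (A.act 1).map ((evalIso P g).inv ≫ (ρ_ _).inv) ▷ Y ≫
        (A.assocIso rfl w (P.F.obj (𝟙_ C)) A.comp_one Y).hom =
      (evalIso P g).inv ▷ Y ≫ (A.act g).obj (P.F.obj (𝟙_ C)) ◁
        ((λ_ Y).inv ≫ A.oneIso.hom.app (𝟙_ C) ▷ Y) := by
    have n := A.oneIso.hom.naturality ((evalIso P g).inv ≫ (ρ_ _).inv)
    simp only [Functor.id_obj, Functor.id_map] at n
    rw [← e₈, ← comp_whiskerRight_assoc, ← n]
    simp
  have e₁₀ : (ρ_ ((A.act g).obj (𝟙_ C))).inv ▷ Y ≫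
      A.oneIso.hom.app ((A.act g).obj (𝟙_ C) ⊗ 𝟙_ C) ▷ Y ≫
        (A.act 1).map ((ρ_ ((A.act g).obj (𝟙_ C))).hom ≫ (A.η₀ g).hom) ▷ Y ≫
          A.oneIso.inv.app (𝟙_ C) ▷ Y ≫ (λ_ Y).hom = (A.η₀ g).hom ▷ Y ≫ (λ_ Y).hom := by
    have n := A.oneIso.hom.naturality ((ρ_ ((A.act g).obj (𝟙_ C))).hom ≫ (A.η₀ g).hom)
    simp only [Functor.id_obj, Functor.id_map] at n
    have n' : A.oneIso.hom.app (𝟙_ C) ▷ Y ≫ A.oneIso.inv.app (𝟙_ C) ▷ Y = 𝟙 _ := by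
      rw [← comp_whiskerRight, Iso.hom_inv_id_app, id_whiskerRight]
    rw [← comp_whiskerRight_assoc (A.oneIso.hom.app _), ← n]
    simp [reassoc_of% n']
  -- both sides of the pentagon end with that identification, which is then cancelled
  rw [e₂, Functor.map_comp (A.act 1), comp_whiskerRight, Category.assoc, ← reassoc_of% e₃,
    homogCompare_spec] at e₁
  have e₁₁ := congrArg (fun f => P.F.map ((ρ_ ((A.act g).obj (𝟙_ C))).inv ▷ Y ≫
      A.oneIso.hom.app ((A.act g).obj (𝟙_ C) ⊗ 𝟙_ C) ▷ Y) ≫ f) e₁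
  simp only [Category.assoc] at e₁₁
  rw [← Functor.map_comp_assoc, Category.assoc, e₈, e₆, e₉, ← Functor.map_comp_assoc,
    ← Functor.map_comp_assoc] at e₁₁
  simp only [Category.assoc] at e₁₁
  rw [e₁₀, ← Category.assoc, ← Category.assoc] at e₁₁
  have e₁₂ : IsIso ((λ_ Y).inv ≫ A.oneIso.hom.app (𝟙_ C) ▷ Y) := inferInstance
  rw [cancel_mono] at e₁₁
  rw [e₁₁]
  simp [← comp_whiskerRight]

/-- The comparison `F(M) ≅ F(1) ⊗ M`, for homogeneous `M`, respects the module constraints. This is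
the pentagon for `(1, 1 ⋈ M, g ⋈ X)`, whose side at the product `(1 ⋈ M) ⊗ (g ⋈ X)` is evaluated by
`constraint_unit` for the group element `t ▶ g`; that is where `u_{t ▶ g}` comes from. -/
theorem homogCompare_constraint (g : G) {s t : Γ} {M X : C} (hM : A.comp t M) (hX : A.comp s X) :
    (constraint P g hX M).hom ≫ (A.act g).map (homogCompare P hM).hom ▷ X ≫
        (A.τ (evalIso P) g M).hom ▷ X ≫ (α_ _ _ _).hom =
      (homogCompare P (A.comp_tensor (A.comp_act g hM) hX)).hom := by
  have e₁ := constraint_assoc P (rfl : mp.lact t g = _) (one_mul _) (𝟙_ C) hM hX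
  have e₂ := homogCompare_spec P hM
  have e₃ := constraint_left P g hX (A.oneIso.inv.app (𝟙_ C) ▷ M ≫ (λ_ M).hom)
  have e₄ := A.map_one_assocIso rfl (one_mul _) (P.F.obj (𝟙_ C)) hM X (g := g)
  have e₅ := A.map_one_assocIso rfl (one_mul _) (𝟙_ C) hM X (g := g)
  have e₆ := constraint_unit P (mp.lact t g) (A.comp_tensor (A.comp_act g hM) hX)
  have e₇ := A.τ_hom_app (evalIso P) rfl hM (𝟙 M) (g := g)
  have e₈ := A.E_left_unit hM (rfl : mp.lact t g = _)
  rw [whiskerLeft_id, CategoryTheory.Functor.map_id, CategoryTheory.Functor.map_id,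
    Category.id_comp, tensorHom_id] at e₇
  have e₉ : (A.act g).map ((λ_ M).inv ≫ A.oneIso.hom.app (𝟙_ C) ▷ M) ▷ X ≫
      (A.act g).map (A.oneIso.inv.app (𝟙_ C) ▷ M ≫ (λ_ M).hom) ▷ X = 𝟙 _ := by
    rw [← comp_whiskerRight, ← Functor.map_comp]
    simp [← comp_whiskerRight_assoc]
  rw [e₂, Functor.map_comp, comp_whiskerRight, Functor.map_comp (A.act g), comp_whiskerRight,
    Category.assoc, Category.assoc, ← reassoc_of% e₃, e₄] at e₁
  have e₁₀ := congrArg (fun f => P.F.map ((A.act g).map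
      ((λ_ M).inv ≫ A.oneIso.hom.app (𝟙_ C) ▷ M) ▷ X) ≫ f ≫ (evalIso P (mp.lact t g)).hom ▷ _) e₁
  simp only [Category.assoc] at e₁₀
  rw [e₆, ← Functor.map_comp_assoc _ _ ((A.act g).map (A.oneIso.inv.app (𝟙_ C) ▷ M ≫ _) ▷ X), e₉,
    CategoryTheory.Functor.map_id, Category.id_comp, ← associator_naturality_left,
    ← comp_whiskerRight_assoc (A.E _ _ hM).hom, ← e₇] at e₁₀
  rw [← e₁₀, ← Functor.map_comp_assoc, ← Functor.map_comp_assoc]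
  have e₁₁ : ((A.act g).map ((λ_ M).inv ≫ A.oneIso.hom.app (𝟙_ C) ▷ M) ▷ X ≫
      (A.assocIso rfl (one_mul (mp.lact t g)) (𝟙_ C) hM X).hom) ≫
        (A.η₀ (mp.lact t g)).hom ▷ ((A.act g).obj M ⊗ X) ≫ (λ_ ((A.act g).obj M ⊗ X)).hom =
      𝟙 _ := by
    have e₁₂ := congrArg (fun f => (A.act g).map (λ_ M).inv ▷ X ≫ f ▷ X) e₈
    simp only [← comp_whiskerRight, ← Functor.map_comp, Iso.inv_hom_id] at e₁₂
    rw [Functor.map_comp, comp_whiskerRight, Category.assoc, Category.assoc, reassoc_of% e₅]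
    refine Eq.trans ?_ (e₁₂.trans ?_)
    · simp
    · simp
  rw [e₁₁]
  simp

end ModuleConstraint

end CrossedAction

/-! ### Module functors over an additive envelope -/

section ExtendRestrict

open MonoidalRightAction CategoryTheory.Mat_

variable {k : Type*} [Field k] {B D : Type*} [Category B] [Preadditive B] [MonoidalCategory B]
  [MonoidalPreadditive B] [Category D] [Preadditive D] [Linear k D] [HasFiniteBiproducts D]
  [MonoidalRightAction B D] [IsBiadditiveAction B D]

namespace CategoryTheory.Mat_

/-- The inclusion of the one-entry family `(X_i)` into `X`. -/
def singleHom (X : Mat_ B) (i : X.ι) : single (X.X i) ⟶ X :=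
  diag (X := single (X.X i)) (fun _ => i) fun _ => 𝟙 _

theorem actSingle_inv_singleHom (m : D) (X : Mat_ B) (i : X.ι) :
    (actSingle m (X.X i)).inv ≫ m ⊴ᵣ singleHom X i = biproduct.ι (fun i => m ⊙ᵣ X.X i) i := by
  refine (mActR_diag m (X := single (X.X i)) (Y := X) (fun _ => i) (fun _ => 𝟙 _)
    PUnit.unit).trans ?_
  rw [actionHomRight_id, Category.id_comp]

end CategoryTheory.Mat_

namespace ModuleEnd

/-- A module functor over the additive envelope is determined by its restriction. -/
theorem ι_s (P : ModuleEnd k (Mat_ B) D) (m : D) (X : Mat_ B) (i : X.ι) :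
    P.F.map (biproduct.ι (fun i => m ⊙ᵣ X.X i) i) ≫ (P.s m X).hom =
      (P.restrict.s m (X.X i)).hom ≫ biproduct.ι (fun i => P.F.obj m ⊙ᵣ X.X i) i := by
  rw [← actSingle_inv_singleHom, ← actSingle_inv_singleHom, Functor.map_comp, Category.assoc]
  refine (congrArg (P.F.map (actSingle m (X.X i)).inv ≫ ·)
    (P.s_natural_right m (singleHom X i))).trans ?_
  simp [restrict]

theorem restrict_extend_s (P : ModuleEnd k B D) (m : D) (x : B) :
    (P.extend.restrict.s m x).hom = (P.s m x).hom := by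
  have h := ι_extend P m (single x) PUnit.unit
  change P.F.map (biproduct.ι (fun _ : PUnit => m ⊙ᵣ x) PUnit.unit) ≫
    (P.extendIso m (single x)).hom ≫ biproduct.π (fun _ : PUnit => P.F.obj m ⊙ᵣ x) PUnit.unit = _
  rw [reassoc_of% h, biproduct.ι_π_self, Category.comp_id]

/-- `P` is the extension of its restriction. -/
def isoExtendRestrict (P : ModuleEnd k (Mat_ B) D) : P ≅ P.restrict.extend :=
  mkIso (Iso.refl P.F) fun m X => by
    have h (e : P.F.obj (m ⊙ᵣ X) ≅ P.F.obj m ⊙ᵣ X)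
        (he : ∀ i, P.F.map (biproduct.ι (fun i => m ⊙ᵣ X.X i) i) ≫ e.hom =
          (P.restrict.s m (X.X i)).hom ≫ biproduct.ι (fun i => P.F.obj m ⊙ᵣ X.X i) i) :
        𝟙 (P.F.obj (m ⊙ᵣ X)) ≫ e.hom = (P.s m X).hom ≫ 𝟙 (P.F.obj m) ⊵ᵣ X := by
      rw [Category.id_comp, id_actionHomLeft, Category.comp_id]
      exact map_biproduct_hom_ext P.F fun i => (he i).trans (ι_s P m X i).symm
    exact h (P.restrict.extendIso m X) (ι_extend P.restrict m X)

/-- Extension to the additive envelope is functorial on isomorphisms. -/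
def extendMapIso {P Q : ModuleEnd k B D} (e : P ≅ Q) : P.extend ≅ Q.extend where
  hom := extendMap e.hom
  inv := extendMap e.inv
  hom_inv_id := by
    ext m
    exact congrArg (fun f : P ⟶ P => f.ε.app m) e.hom_inv_id
  inv_hom_id := by
    ext m
    exact congrArg (fun f : Q ⟶ Q => f.ε.app m) e.inv_hom_id

/-- Extension to the additive envelope is compatible with composition. -/
def extendTensorIso (P Q : ModuleEnd k B D) : P.extend ⊗ Q.extend ≅ (P ⊗ Q).extend :=
  mkIso (Iso.refl (Q.F ⋙ P.F)) fun m X => by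
    refine map_biproduct_hom_ext (Q.F ⋙ P.F) fun i => ?_
    have h := ι_extend (P ⊗ Q) m X i
    have h₁ := ι_extend Q m X i
    have h₂ := ι_extend P (Q.F.obj m) X i
    refine Eq.trans ((congrArg _ (Category.id_comp _)).trans h) ?_
    change (P.F.map (Q.s m (X.X i)).hom ≫ (P.s (Q.F.obj m) (X.X i)).hom) ≫ _ =
      P.F.map (Q.F.map (biproduct.ι (fun i => m ⊙ᵣ X.X i) i)) ≫
        (P.F.map (Q.extendIso m X).hom ≫ (P.extendIso (Q.F.obj m) X).hom) ≫ 𝟙 _ ⊵ᵣ X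
    rw [id_actionHomLeft, Category.comp_id, ← Functor.map_comp_assoc, h₁, Functor.map_comp,
      Category.assoc]
    exact (Category.assoc _ _ _).trans (congrArg _ h₂.symm)

/-- The identity functor extends to the identity functor. -/
def extendUnitIso : 𝟙_ (ModuleEnd k (Mat_ B) D) ≅ (𝟙_ (ModuleEnd k B D)).extend :=
  mkIso (Iso.refl (𝟭 D)) fun m X => by
    have h (e : m ⊙ᵣ X ≅ m ⊙ᵣ X) (he : ∀ i, biproduct.ι (fun i => m ⊙ᵣ X.X i) i ≫ e.hom =
        𝟙 (m ⊙ᵣ X.X i) ≫ biproduct.ι (fun i => m ⊙ᵣ X.X i) i) :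
        𝟙 (m ⊙ᵣ X) ≫ e.hom = 𝟙 (m ⊙ᵣ X) ≫ 𝟙 m ⊵ᵣ X := by
      rw [Category.id_comp, Category.id_comp, id_actionHomLeft]
      exact biproduct.hom_ext' _ _ fun i =>
        (he i).trans ((Category.id_comp _).trans (Category.comp_id _).symm)
    exact h ((𝟙_ (ModuleEnd k B D)).extendIso m X) (ι_extend (𝟙_ (ModuleEnd k B D)) m X)

end ModuleEnd

end ExtendRestrict

namespace CrossedAction

variable {k C G Γ : Type*} [Field k] [Group G] [Group Γ] [Fintype Γ]
  [Category C] [Abelian C] [Linear k C] [MonoidalCategory C] {mp : MatchedPair G Γ}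
  {A : CrossedAction k C mp} [MonoidalPreadditive C] [MonoidalLinear k C] [IsFusionCategory k C]

section Compare

/-! ### The comparison `F ≅ F(1) ⊗ -` -/

variable (P : ModuleEnd k (HomogObj A) C)

theorem homogCompare_natural_inv {t t' : Γ} {Y Y' : C} (hY : A.comp t Y) (hY' : A.comp t' Y')
    (f : Y ⟶ Y') :
    P.F.obj (𝟙_ C) ◁ f ≫ (homogCompare P hY').inv = (homogCompare P hY).inv ≫ P.F.map f := by
  rw [Iso.comp_inv_eq, Category.assoc, homogCompare_natural P hY hY', Iso.inv_hom_id_assoc]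

/-- The additive extension of `homogCompare` to all objects. -/
def compareHom (M : C) : P.F.obj M ⟶ P.F.obj (𝟙_ C) ⊗ M :=
  ∑ t, P.F.map (A.π M t) ≫ (homogCompare P (A.part_mem M t)).hom ≫ P.F.obj (𝟙_ C) ◁ A.ι M t

/-- The inverse of `compareHom`. -/
def compareInv (M : C) : P.F.obj (𝟙_ C) ⊗ M ⟶ P.F.obj M :=
  ∑ t, P.F.obj (𝟙_ C) ◁ A.π M t ≫ (homogCompare P (A.part_mem M t)).inv ≫ P.F.map (A.ι M t)

theorem sum_π_ι_comp {M Y : C} (f : Y ⟶ M) : ∑ t, (f ≫ A.π M t) ≫ A.ι M t = f := by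
  simp only [Category.assoc]
  rw [← Preadditive.comp_sum, A.π_ι_sum, Category.comp_id]

theorem map_compareHom {t : Γ} {M Y : C} (hY : A.comp t Y) (f : Y ⟶ M) :
    P.F.map f ≫ compareHom P M = (homogCompare P hY).hom ≫ P.F.obj (𝟙_ C) ◁ f := by
  conv_rhs => rw [← sum_π_ι_comp (A := A) f, whiskerLeft_sum, Preadditive.comp_sum]
  rw [compareHom, Preadditive.comp_sum]
  refine Finset.sum_congr rfl fun s _ => ?_
  rw [← Functor.map_comp_assoc, whiskerLeft_comp,
    reassoc_of% (homogCompare_natural P hY (A.part_mem M s) (f ≫ A.π M s))]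

theorem whiskerLeft_compareInv {t : Γ} {M Y : C} (hY : A.comp t Y) (f : Y ⟶ M) :
    P.F.obj (𝟙_ C) ◁ f ≫ compareInv P M = (homogCompare P hY).inv ≫ P.F.map f := by
  conv_rhs => rw [← sum_π_ι_comp (A := A) f, Functor.map_sum, Preadditive.comp_sum]
  rw [compareInv, Preadditive.comp_sum]
  refine Finset.sum_congr rfl fun s _ => ?_
  rw [← whiskerLeft_comp_assoc, Functor.map_comp P.F (f ≫ _),
    reassoc_of% (homogCompare_natural_inv P hY (A.part_mem M s) (f ≫ A.π M s))]

theorem compareHom_natural {M N : C} (f : M ⟶ N) :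
    P.F.map f ≫ compareHom P N = compareHom P M ≫ P.F.obj (𝟙_ C) ◁ f := by
  refine A.functor_hom_ext P.F fun t => ?_
  rw [← Functor.map_comp_assoc, map_compareHom P (A.part_mem M t),
    reassoc_of% (map_compareHom P (A.part_mem M t) (A.ι M t)), whiskerLeft_comp]

theorem compareHom_inv_id (M : C) : compareHom P M ≫ compareInv P M = 𝟙 _ := by
  refine A.functor_hom_ext P.F fun t => ?_
  rw [reassoc_of% (map_compareHom P (A.part_mem M t) (A.ι M t)),
    whiskerLeft_compareInv P (A.part_mem M t), Iso.hom_inv_id_assoc, Category.comp_id]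

theorem compareInv_hom_id (M : C) : compareInv P M ≫ compareHom P M = 𝟙 _ := by
  refine A.functor_hom_ext (tensorLeft (P.F.obj (𝟙_ C))) fun t => ?_
  change P.F.obj (𝟙_ C) ◁ A.ι M t ≫ _ = P.F.obj (𝟙_ C) ◁ A.ι M t ≫ 𝟙 _
  rw [reassoc_of% (whiskerLeft_compareInv P (A.part_mem M t) (A.ι M t)),
    map_compareHom P (A.part_mem M t), Iso.inv_hom_id_assoc, Category.comp_id]

/-- The isomorphism `F ≅ F(1) ⊗ -` for a module functor `F`. -/
def compareIso : P.F ≅ tensorLeft (P.F.obj (𝟙_ C)) :=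
  NatIso.ofComponents
    (fun M => ⟨compareHom P M, compareInv P M, compareHom_inv_id P M, compareInv_hom_id P M⟩)
    fun f => compareHom_natural P f

/-- The comparison is compatible with the module constraints; by additivity in `M` this reduces to
the homogeneous case. -/
theorem compareHom_constraint (M : C) (x : HomogObj A) :
    (constraint P x.g x.mem M).hom ≫ (A.act x.g).map (compareHom P M) ▷ x.obj ≫
      (A.tensorIso (evalIso P) M x).inv = compareHom P ((A.act x.g).obj M ⊗ x.obj) := by
  refine A.functor_hom_ext (A.act x.g ⋙ tensorRight x.obj ⋙ P.F) (M := M) fun t => ?_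
  change P.F.map ((A.act x.g).map (A.ι M t) ▷ x.obj) ≫ _ =
    P.F.map ((A.act x.g).map (A.ι M t) ▷ x.obj) ≫ _
  have hM := A.part_mem M t
  have h := congrArg (fun f => (A.act x.g).map f ▷ x.obj) (map_compareHom P hM (A.ι M t))
  have h₁ := congrArg (fun f => f ▷ x.obj) (τ_natural (evalIso P) x.g (A.ι M t))
  simp only [Functor.map_comp, comp_whiskerRight] at h h₁
  rw [map_compareHom P (A.comp_tensor (A.comp_act x.g hM) x.mem),
    reassoc_of% (constraint_left P x.g x.mem (A.ι M t)), reassoc_of% h, tensorIso_inv,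
    reassoc_of% h₁, ← homogCompare_constraint P x.g hM x.mem]
  simp

/-- The object `(F(1), u)` of the crossed extension given by a module functor over the symbols. -/
def evalObj : CrossedExt A where
  U := P.F.obj (𝟙_ C)
  u := evalIso P
  u_mul g h := by
    have h := evalIso_mul P g h
    simp only [R, castIso_rfl, Iso.trans_refl] at h
    exact h

/-- A module functor `F` over the symbols is isomorphic, as a module functor, to `F(1) ⊗ -`. -/
def compareModuleIso : P ≅ A.tensorModuleEnd (evalObj P) :=
  ModuleEnd.mkIso (compareIso P) fun M x => by
    have h := compareHom_constraint P M x
    rw [← Category.assoc, Iso.comp_inv_eq] at h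
    exact h.symm

theorem homogCompare_hom {P Q : ModuleEnd k (HomogObj A) C} (a : P ⟶ Q) {t : Γ} {Y : C}
    (hY : A.comp t Y) : a.ε.app Y ≫ (homogCompare Q hY).hom =
      (homogCompare P hY).hom ≫ a.ε.app (𝟙_ C) ▷ Y := by
  have h : a.ε.app _ ≫ (constraint Q 1 hY (𝟙_ C)).hom =
      (constraint P 1 hY (𝟙_ C)).hom ≫ (A.act 1).map (a.ε.app (𝟙_ C)) ▷ Y :=
    a.comm (𝟙_ C) ⟨1, t, Y, hY⟩
  have n := a.ε.naturality ((λ_ Y).inv ≫ A.oneIso.hom.app (𝟙_ C) ▷ Y)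
  have n₁ := A.oneIso.inv.naturality (a.ε.app (𝟙_ C))
  simp only [Functor.id_obj, Functor.id_map] at n₁
  simp only [homogCompare, Iso.trans_hom, Functor.mapIso_hom, Iso.symm_hom, whiskerRightIso_hom,
    Iso.app_hom, Iso.app_inv, Category.assoc]
  rw [← reassoc_of% n, reassoc_of% h, ← comp_whiskerRight, n₁, comp_whiskerRight]

/-- The comparison is natural in the module functor. -/
theorem compareHom_hom {P Q : ModuleEnd k (HomogObj A) C} (a : P ⟶ Q) (M : C) :
    a.ε.app M ≫ compareHom Q M = compareHom P M ≫ a.ε.app (𝟙_ C) ▷ M := by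
  refine A.functor_hom_ext P.F fun t => ?_
  have hM := A.part_mem M t
  rw [a.ε.naturality_assoc, map_compareHom Q hM, reassoc_of% (map_compareHom P hM (A.ι M t)),
    reassoc_of% (homogCompare_hom a hM), whisker_exchange]

end Compare

/-! ### Unit and counit -/

variable (A)

/-- The unit `F ≅ F(1) ⊗ -` of the equivalence. -/
def dualUnitIso : 𝟭 (Dual A) ≅ A.evalFunctor ⋙ A.tensorFunctor :=
  NatIso.ofComponents
    (fun P => P.isoExtendRestrict ≪≫ ModuleEnd.extendMapIso (compareModuleIso P.restrict))
    fun {P Q} a => by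
      ext M
      exact (congrArg (a.ε.app M ≫ ·) (Category.id_comp _)).trans
        ((compareHom_hom (ModuleEnd.restrictMap a) M).trans
          (congrArg (· ≫ a.ε.app (𝟙_ C) ▷ M) (Category.id_comp _).symm))

/-- The equation defining `u_g` for the module functor `U ⊗ -` has the structure isomorphism of
`(U, u) ⊗ (1, η₀)` as its only solution. -/
theorem eq_w_η₀ (X : CrossedExt A) (g : G)
    (v : (A.act g).obj (X.U ⊗ 𝟙_ C) ≅ X.U ⊗ 𝟙_ C)
    (h : (A.tensorIso X.u (𝟙_ C) (A.gOne g)).hom ≫ (ρ_ ((A.act g).obj (X.U ⊗ 𝟙_ C))).hom ≫ v.hom =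
      X.U ◁ ((ρ_ ((A.act g).obj (𝟙_ C))).hom ≫ (A.η₀ g).hom)) :
    v.hom = (A.w X.u A.η₀ g).hom := by
  have e : (ρ_ ((A.act g).obj (X.U ⊗ 𝟙_ C))).hom ≫ v.hom = ((A.τ X.u g (𝟙_ C)).hom ▷ 𝟙_ C ≫
      (α_ _ _ _).hom) ≫ X.U ◁ ((ρ_ ((A.act g).obj (𝟙_ C))).hom ≫ (A.η₀ g).hom) :=
    (Iso.eq_inv_comp (A.tensorIso X.u (𝟙_ C) (A.gOne g))).mpr h
  rw [← cancel_epi (ρ_ _).hom, e]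
  simp [w]

/-- The counit `(U ⊗ 1, u') ≅ (U, u)` of the equivalence. -/
def dualCounitIso : A.tensorFunctor ⋙ A.evalFunctor ≅ 𝟭 (CrossedExt A) :=
  NatIso.ofComponents
    (fun X => CrossedExt.mkIso (ρ_ X.U) fun g => by
      let P := (A.tensorModuleEnd X).extend.restrict
      have e : (P.s (𝟙_ C) (A.gOne g)).hom = (A.tensorIso X.u (𝟙_ C) (A.gOne g)).hom :=
        ModuleEnd.restrict_extend_s _ _ _
      have h : (evalIso P g).hom = (A.w X.u A.η₀ g).hom := A.eq_w_η₀ X g (evalIso P g)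
        ((congrArg (· ≫ (ρ_ _).hom ≫ (evalIso P g).hom) e).symm.trans (evalIso_spec P g))
      exact (A.w_rightUnit X.u g).trans (congrArg (· ≫ (ρ_ X.U).hom) h.symm))
    fun {X Y} f => by
      ext
      exact rightUnitor_naturality f.f

end CrossedAction

namespace CrossedAction

variable {k C G Γ : Type*} [Field k] [Group G] [Group Γ] [Fintype Γ]
  [Category C] [Abelian C] [Linear k C] [MonoidalCategory C] {mp : MatchedPair G Γ}
  (A : CrossedAction k C mp) [MonoidalPreadditive C] [MonoidalLinear k C] [IsFusionCategory k C]

/-! ### The monoidal structures -/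

/-- `τ` is multiplicative in the equivariant object. -/
theorem τ_w {U V : C} (u : ∀ g, (A.act g).obj U ≅ U) (v : ∀ g, (A.act g).obj V ≅ V) (g : G)
    (M : C) :
    (A.act g).map (α_ U V M).hom ≫ (A.τ u g (V ⊗ M)).hom ≫ U ◁ (A.τ v g M).hom =
      (A.τ (A.w u v) g M).hom ≫ (α_ _ _ _).hom := by
  refine A.hom_ext_tensor₃ (A.act g) fun s t => ?_
  have hV := A.part_mem V s
  have hM := A.part_mem M t
  have e₁ := τ_hom_app' (A.w u v) rfl hM (U ◁ A.ι V s) (A.ι M t) (g := g)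
  have e₂ := A.w_app u v rfl hV (A.ι V s) (g := mp.lact t g)
  have e₃ := A.τ_hom_app u (mp.mul_lact s t g) (A.comp_tensor hV hM)
    (A.ι V s ⊗ₘ A.ι M t) (g := g)
  have e₄ := τ_hom_app' v rfl hM (A.ι V s) (A.ι M t) (g := g)
  have e₅ := A.E_assoc U hV hM (rfl : mp.lact t g = _) rfl (mp.mul_lact s t g)
  have e₆ : ((U ◁ A.ι V s) ⊗ₘ A.ι M t) ≫ (α_ U V M).hom =
      (α_ _ _ _).hom ≫ U ◁ (A.ι V s ⊗ₘ A.ι M t) := by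
    rw [← id_tensorHom, associator_naturality, id_tensorHom]
  have e₇ {P P₁ P₂ Q Q₁ R R₁ : C} (a : P ⟶ P₁ ⊗ P₂) (b : P₁ ⟶ Q) (c : P₂ ⟶ Q₁) (d : R ⟶ R₁) :
      ((a ≫ (b ⊗ₘ c)) ⊗ₘ d) ≫ (α_ _ _ _).hom = a ▷ R ≫ (α_ _ _ _).hom ≫ (b ⊗ₘ (c ⊗ₘ d)) := by
    rw [← associator_naturality, ← tensorHom_id, tensorHom_comp_tensorHom_assoc, Category.id_comp]
  rw [← Functor.map_comp_assoc, e₆, Functor.map_comp, Category.assoc, reassoc_of% e₃,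
    ← id_tensorHom U, tensorHom_comp_tensorHom, Category.comp_id, e₄, reassoc_of% e₁, e₂, e₇,
    reassoc_of% e₅, ← id_tensorHom, tensorHom_comp_tensorHom, Category.id_comp]

/-- `τ` for the unit object `(1, η₀)` is trivial. -/
theorem τ_η₀ (g : G) (M : C) :
    (A.τ A.η₀ g M).hom ≫ (λ_ _).hom = (A.act g).map (λ_ M).hom := by
  refine A.hom_ext_tensor (A.act g) fun t => ?_
  have hM := A.part_mem M t
  rw [reassoc_of% (A.τ_hom_app A.η₀ rfl hM (A.ι M t)), ← Functor.map_comp,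
    leftUnitor_naturality, Functor.map_comp, ← A.E_left_unit hM rfl,
    MonoidalCategory.tensorHom_def]
  simp only [Category.assoc, leftUnitor_naturality]

theorem tensorIso_w {U V : C} (u : ∀ g, (A.act g).obj U ≅ U) (v : ∀ g, (A.act g).obj V ≅ V)
    (M : C) (x : HomogObj A) :
    ((A.tensorIso u (V ⊗ M) x).inv ≫ U ◁ (A.tensorIso v M x).inv) ≫ (α_ U V _).inv =
      (A.act x.g).map (α_ U V M).inv ▷ x.obj ≫ (A.tensorIso (A.w u v) M x).inv := by
  have h := A.τ_w u v x.g M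
  rw [← (A.act x.g).mapIso_hom, ← Iso.eq_inv_comp, (A.act x.g).mapIso_inv] at h
  have h' := congrArg (fun f => f ▷ x.obj) h
  simp only [comp_whiskerRight] at h'
  simp only [tensorIso_inv, whiskerLeft_comp, Category.assoc]
  rw [← associator_naturality_middle_assoc, reassoc_of% h']
  simp

theorem tensorIso_η₀ (M : C) (x : HomogObj A) :
    (λ_ (A.actObj M x)).inv =
      (A.act x.g).map (λ_ M).inv ▷ x.obj ≫ (A.tensorIso A.η₀ M x).inv := by
  have h := A.τ_η₀ x.g M
  have h' := congrArg (fun f => (A.act x.g).map (λ_ M).inv ▷ x.obj ≫ f ▷ x.obj) h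
  simp only [← comp_whiskerRight, ← Functor.map_comp, Iso.inv_hom_id] at h'
  rw [← cancel_mono (λ_ _).hom, Iso.inv_hom_id, tensorIso_inv, Category.assoc, Category.assoc,
    leftUnitor_tensor_hom]
  simpa using h'.symm

variable {A}

/-- `U ⊗ (V ⊗ -) ≅ (U ⊗ V) ⊗ -` as module functors over the symbols. -/
def tensorModuleEndMul (X Y : CrossedExt A) :
    A.tensorModuleEnd X ⊗ A.tensorModuleEnd Y ≅ A.tensorModuleEnd (X ⊗ Y) :=
  ModuleEnd.mkIso (NatIso.ofComponents (fun M => (α_ X.U Y.U M).symm)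
    fun f => associator_inv_naturality_right X.U Y.U f) fun M x =>
      iso_swap (whiskerLeftIso X.U (A.tensorIso Y.u M x) ≪≫ A.tensorIso X.u (Y.U ⊗ M) x)
        (A.tensorIso (A.w X.u Y.u) M x) (A.tensorIso_w X.u Y.u M x)

/-- `- ≅ 1 ⊗ -` as module functors over the symbols. -/
def tensorModuleEndOne :
    𝟙_ (ModuleEnd k (HomogObj A) C) ≅ A.tensorModuleEnd (𝟙_ (CrossedExt A)) :=
  ModuleEnd.mkIso (leftUnitorNatIso C).symm fun M x =>
    iso_swap (Iso.refl (A.actObj M x)) (A.tensorIso A.η₀ M x)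
      ((Category.id_comp _).trans (A.tensorIso_η₀ M x))

/-- The tensor structure `S(U,u) ∘ S(V,v) ≅ S((U,u) ⊗ (V,v))`, given by `α⁻¹`. -/
def tensorFunctorMul (X Y : CrossedExt A) :
    A.tensorFunctor.obj X ⊗ A.tensorFunctor.obj Y ≅ A.tensorFunctor.obj (X ⊗ Y) :=
  ModuleEnd.extendTensorIso _ _ ≪≫ ModuleEnd.extendMapIso (tensorModuleEndMul X Y)

/-- The unit structure `id ≅ S(1, η₀)`, given by `ℓ⁻¹`. -/
def tensorFunctorOne : 𝟙_ (Dual A) ≅ A.tensorFunctor.obj (𝟙_ (CrossedExt A)) :=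
  ModuleEnd.extendUnitIso ≪≫ ModuleEnd.extendMapIso tensorModuleEndOne

theorem tensorFunctorMul_app (X Y : CrossedExt A) (M : C) :
    (tensorFunctorMul X Y).hom.ε.app M = (α_ X.U Y.U M).inv :=
  Category.id_comp _

theorem tensorFunctorOne_app (M : C) :
    (tensorFunctorOne (A := A)).hom.ε.app M = (λ_ M).inv :=
  Category.id_comp _

variable (A) in
/-- `S` is a monoidal functor. -/
def tensorFunctorCoreMonoidal : A.tensorFunctor.CoreMonoidal where
  εIso := tensorFunctorOne
  μIso := tensorFunctorMul
  μIso_hom_natural_left {X Y} f Z := by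
    ext M
    change f.f ▷ (Z.U ⊗ M) ≫ (tensorFunctorMul Y Z).hom.ε.app M =
      (tensorFunctorMul X Z).hom.ε.app M ≫ (f.f ▷ Z.U) ▷ M
    rw [tensorFunctorMul_app, tensorFunctorMul_app]
    exact associator_inv_naturality_left f.f Z.U M
  μIso_hom_natural_right {X Y} Z f := by
    ext M
    change Z.U ◁ (f.f ▷ M) ≫ (tensorFunctorMul Z Y).hom.ε.app M =
      (tensorFunctorMul Z X).hom.ε.app M ≫ (Z.U ◁ f.f) ▷ M
    rw [tensorFunctorMul_app, tensorFunctorMul_app]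
    exact associator_inv_naturality_middle Z.U f.f M
  associativity X Y Z := by
    ext M
    change (tensorFunctorMul X Y).hom.ε.app (Z.U ⊗ M) ≫
        (tensorFunctorMul (X ⊗ Y) Z).hom.ε.app M ≫ (α_ X.U Y.U Z.U).hom ▷ M =
      𝟙 _ ≫ X.U ◁ (tensorFunctorMul Y Z).hom.ε.app M ≫ (tensorFunctorMul X (Y ⊗ Z)).hom.ε.app M
    rw [tensorFunctorMul_app, tensorFunctorMul_app, tensorFunctorMul_app, tensorFunctorMul_app]
    have h : (α_ X.U Y.U (Z.U ⊗ M)).inv ≫ (α_ (X.U ⊗ Y.U) Z.U M).inv ≫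
        (α_ X.U Y.U Z.U).hom ▷ M = X.U ◁ (α_ Y.U Z.U M).inv ≫ (α_ X.U (Y.U ⊗ Z.U) M).inv := by
      simp
    exact h.trans (Category.id_comp _).symm
  left_unitality X := by
    ext M
    change 𝟙 _ = (tensorFunctorOne (A := A)).hom.ε.app (X.U ⊗ M) ≫
      (tensorFunctorMul (𝟙_ _) X).hom.ε.app M ≫ (λ_ X.U).hom ▷ M
    rw [tensorFunctorOne_app, tensorFunctorMul_app]
    change 𝟙 (X.U ⊗ M) = (λ_ _).inv ≫ (α_ (𝟙_ C) X.U M).inv ≫ _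
    simp
  right_unitality X := by
    ext M
    change 𝟙 _ = X.U ◁ (tensorFunctorOne (A := A)).hom.ε.app M ≫
      (tensorFunctorMul X (𝟙_ _)).hom.ε.app M ≫ (ρ_ X.U).hom ▷ M
    rw [tensorFunctorOne_app, tensorFunctorMul_app]
    change 𝟙 (X.U ⊗ M) = X.U ◁ (λ_ M).inv ≫ (α_ X.U (𝟙_ C) M).inv ≫ _
    simp

variable (A)

/-- `T` and `S` are mutually quasi-inverse. -/
def dualEquivalence : Dual A ≌ CrossedExt A :=
  CategoryTheory.Equivalence.mk A.evalFunctor A.tensorFunctor A.dualUnitIso A.dualCounitIso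

instance : A.tensorFunctor.Additive where
  map_add {_ _ f g} := by
    ext M
    exact MonoidalPreadditive.add_whiskerRight f.f g.f

instance : A.tensorFunctor.Linear k where
  map_smul f c := by
    ext M
    exact MonoidalLinear.smul_whiskerRight c f.f M

instance : A.tensorFunctor.Monoidal := A.tensorFunctorCoreMonoidal.toMonoidal

/-- The monoidal structure of `T`, transported from its quasi-inverse `S`. -/
instance evalFunctorMonoidal : A.evalFunctor.Monoidal :=
  letI : A.dualEquivalence.symm.functor.Monoidal := inferInstanceAs A.tensorFunctor.Monoidal
  A.dualEquivalence.symm.inverseMonoidal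

instance : A.evalFunctor.Additive where
  map_add := rfl

instance : A.evalFunctor.Linear k where
  map_smul _ _ := rfl

end CrossedAction

end

open Functor in
theorem theorem3p5 {k C G Γ : Type*} [Field k] [IsAlgClosed k] [CharZero k]
    [Group G] [Finite G] [Group Γ] [Fintype Γ]
    [Category C] [Abelian C] [Linear k C] [MonoidalCategory C] [MonoidalPreadditive C]
    [MonoidalLinear k C] [RigidCategory C] [IsFusionCategory k C]
    {mp : MatchedPair G Γ} (A : CrossedAction k C mp) :
    ∃ e : A.Dual ≌ A.CrossedExt, e.functor = A.evalFunctor ∧ e.inverse = A.tensorFunctor ∧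
      (∃ _ : A.tensorFunctor.Additive, A.tensorFunctor.Linear k) ∧
      (∃ _ : A.evalFunctor.Additive, A.evalFunctor.Linear k) ∧
      (∃ _ : A.tensorFunctor.Monoidal, ∀ (X Y : A.CrossedExt) (M : C),
        (LaxMonoidal.μ A.tensorFunctor X Y).ε.app M = (α_ X.U Y.U M).inv) ∧
      Nonempty A.evalFunctor.Monoidal := by
  exact ⟨A.dualEquivalence, rfl, rfl, ⟨inferInstance, inferInstance⟩,
    ⟨inferInstance, inferInstance⟩, ⟨inferInstance, CrossedAction.tensorFunctorMul_app⟩,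
    ⟨A.evalFunctorMonoidal⟩⟩
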